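/- Consider $n$ arms. Arm $i\in[n]$ has a finite state space $\mathcal S^i$, actions $\{0,1\}$ (passive, active), known rewards $r^i:\mathcal S^i\times\{0,1\}\to[0,R_{\max}]$ with $R_{\max}>0$, and transition probabilities $P^i(s'\mid s,a;\theta^i)$ that depend (measurably) on an unknown parameter $\theta^i\in\Theta^i$. At each time exactly $m$ arms are activated, $1\le m\le n$; given the past, the arms move independently. The per-step reward is $\boldsymbol r(\boldsymbol s,\boldsymbol a)=\sum_i r^i(s^i,a^i)$ in Model A and $\boldsymbol r(\boldsymbol s,\boldsymbol a)=\sum_i r^i(s^i,a^i)\mathbf 1\{a^i=1\}$ in Model B (where $r^i(\cdot,0)$ is taken to be $0$ below). The true parameters $\theta^i_\star$ are independent with priors $\phi^i_1$, and the initial states $S^i_1$ are independent of each other and of $\theta_\star$, with known distributions. For an arm with parameter $\theta^i$ and $\lambda\in\mathbb R$, let $\pi^i_\lambda:\mathcal S^i\to\{0,1\}$ be an optimal stationary policy for the long-run average (liminf) of $r^i(S_t,A_t)-\lambda A_t$, and let $\mathcal W^i_\lambda=\{s:\pi^i_\lambda(s)=0\}$. The arm is indexable if $\mathcal W^i_{\lambda_1}\subseteq\mathcal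 W^i_{\lambda_2}$ whenever $\lambda_1\le\lambda_2$; its Whittle index is $w^i(s)=\inf\{\lambda:s\in\mathcal W^i_\lambda\}$. The Whittle index policy $\boldsymbol\mu_\theta$ for $\theta=(\theta^1,\dots,\theta^n)\in\Theta=\prod_i\Theta^i$ activates, in each joint state, $m$ arms with the largest Whittle indices (ties broken by any rule measurable in $\theta$). Let $\boldsymbol P_\theta$ be the joint transition matrix under $\boldsymbol\mu_\theta$ in model $\theta$, and $J_\theta$ the average reward of $\boldsymbol\mu_\theta$ in model $\theta$. Assume: 1. for all $i$ and $\theta^i\in\Theta^i$, arm $i$ with parameter $\theta^i$ is indexable; 2. for every $\theta\in\Theta$, $J_\theta$ does not depend on the initial state, and there is a bounded function $\boldsymbol V_\theta$ with $J_\theta+\boldsymbol V_\theta(\boldsymbol s)=\boldsymbol r(\boldsymbol s,\boldsymbol\mu_\theta(\boldsymbol s))+[\boldsymbol P_\theta\boldsymbol V_\theta](\boldsymbol s)$ for all $\boldsymbol s$; 3. there is $\lambda^*<1$ such that for all $\theta\in\Theta$, $1-\min_{\boldsymbol s,\boldsymbol s'}\sum_{\boldsymbol z}\min\{\boldsymbol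 P_\theta(\boldsymbol z\mid\boldsymbol s),\boldsymbol P_\theta(\boldsymbol z\mid\boldsymbol s')\}\le\lambda^*$. The algorithm RB-TSDE works in episodes. Let $N^i_t(s,a)$ be the number of times $1\le\tau<t$ with $(S^i_\tau,A^i_\tau)=(s,a)$. Episode $1$ starts at $t_1=1$, and $T_0=1$; episode $k+1$ starts at the first $t_{k+1}>t_k$ such that $t_{k+1}-t_k>T_{k-1}$ or $N^i_{t_{k+1}}(s,a)>2N^i_{t_k}(s,a)$ for some $i,s,a$, and $T_k=t_{k+1}-t_k$. At the start of episode $k$, $\theta^i_k$ is sampled, independently over $i$, from the posterior distribution of $\theta^i_\star$ given the states and actions of arm $i$ before $t_k$ and the state at $t_k$; during episode $k$ the policy $\boldsymbol\mu_{\theta_k}$ is applied. Then for every integer $T\ge2$ the Bayesian regret satisfies $$\mathbb E\Bigl[T J_{\theta_\star}-\sum_{t=1}^T\boldsymbol r(\boldsymbol S_t,\boldsymbol A_t)\Bigr]<40\,\alpha\,\frac{R_{\max}}{1-\lambda^*}\,\bar{\mathsf S}_n\sqrt{T\log T},$$ where $\log$ is the natural logarithm, $\bar{\mathsf S}_n=\sum_{i}|\mathcal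 S^i|$, and $\alpha=n$ for Model A, $\alpha=m$ for Model B. -/

import Mathlib

open MeasureTheory ProbabilityTheory Filter Finset
open scoped ENNReal

noncomputable section

namespace RestlessBandit

/-! ### Finite Markov reward processes -/

/-- Long-run average reward `liminf_N (1/N) ∑_{t < N} E[ρ(X_t) | X_0 = x]` of a finite Markov chain
with transition matrix `K` and per-step reward `ρ`, where `E[ρ(X_t) | X_0 = x] = (K ^ t ρ)(x)`. -/
def averageReward {X : Type*} [Fintype X] [DecidableEq X] (K : Matrix X X ℝ) (ρ : X → ℝ)
    (x : X) : ℝ :=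
  liminf (fun N : ℕ => (∑ t ∈ range N, ((K ^ t).mulVec ρ) x) / (N : ℝ)) atTop

/-- Ergodicity coefficient `1 - min_{x, y} ∑_z min (K(z | x)) (K(z | y))`. -/
def ergodicityCoeff {X : Type*} [Fintype X] (K : Matrix X X ℝ) : ℝ :=
  1 - ⨅ p : X × X, ∑ z, min (K p.1 z) (K p.2 z)

/-! ### A single arm with action space `{passive, active} = {false, true}` -/

section Arm

variable {X : Type*}

/-- Average reward of the stationary policy `g` on one arm when every activation costs `lam`. -/
def armAverageReward [Fintype X] [DecidableEq X] (P : X → Bool → X → ℝ) (r : X → Bool → ℝ) (lam : ℝ) (g : X → Bool)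
    (x : X) : ℝ :=
  averageReward (Matrix.of fun s s' => P s (g s) s')
    (fun s => r s (g s) - lam * (if g s = true then 1 else 0)) x

/-- `g` maximizes the `lam`-penalized average reward among all policies `X → {0, 1}`
(whatever the initial state). -/
def IsOptimalArmPolicy [Fintype X] [DecidableEq X] (P : X → Bool → X → ℝ) (r : X → Bool → ℝ)
    (lam : ℝ) (g : X → Bool) : Prop :=
  ∀ (g' : X → Bool) (x : X), armAverageReward P r lam g' x ≤ armAverageReward P r lam g x

/-- Passive set at penalty `lam` of the family `lam ↦ g lam` of (optimal) policies. -/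
def passiveSet (g : ℝ → X → Bool) (lam : ℝ) : Set X := {s | g lam s = false}

/-- The arm is indexable, `g lam` being the optimal policy at penalty `lam`: each `g lam` is
optimal, and the passive sets are non-decreasing in the penalty. -/
def IsIndexable [Fintype X] [DecidableEq X] (P : X → Bool → X → ℝ) (r : X → Bool → ℝ)
    (g : ℝ → X → Bool) : Prop :=
  (∀ lam, IsOptimalArmPolicy P r lam (g lam)) ∧
    ∀ lam₁ lam₂ : ℝ, lam₁ ≤ lam₂ → passiveSet g lam₁ ⊆ passiveSet g lam₂

/-- Whittle index of a state: the infimum (in the extended reals) of the penalties for which the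
state is passive. -/
def whittleIndex (g : ℝ → X → Bool) (s : X) : EReal :=
  sInf ((fun lam : ℝ => (lam : EReal)) '' {lam : ℝ | s ∈ passiveSet g lam})

end Arm

/-! ### Restless bandits with unknown transition matrices -/

/-- Which arms yield a reward: all of them (`A`), or the active ones only (`B`). -/
inductive RewardModel
  | A
  | B

/-- The factor `α`: `n` in Model A, `m` in Model B. -/
def RewardModel.alpha (n m : ℕ) : RewardModel → ℝ
  | .A => n
  | .B => m

/-- A Bayesian restless bandit with `n` arms: arm `i` has finite state space `S i`, parameter space
`Θ i` and transition probabilities `P i θ s a s' = P^i(s' | s, a; θ)`. -/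
structure Bandit {n : ℕ} (S : Fin n → Type*) [∀ i, Fintype (S i)]
    (Θ : Fin n → Type*) [∀ i, MeasurableSpace (Θ i)] where
  /-- transition probabilities, as a function of the unknown parameter -/
  P : ∀ i, Θ i → S i → Bool → S i → ℝ
  P_nonneg : ∀ i θ s a s', 0 ≤ P i θ s a s'
  P_sum : ∀ i θ s a, ∑ s', P i θ s a s' = 1
  P_measurable : ∀ i s a s', Measurable fun θ => P i θ s a s'
  /-- per-step rewards, with values in `[0, Rmax]` -/
  r : ∀ i, S i → Bool → ℝ
  Rmax : ℝ
  r_nonneg : ∀ i s a, 0 ≤ r i s a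
  r_le : ∀ i s a, r i s a ≤ Rmax
  /-- distribution of the initial state of each arm -/
  init : ∀ i, S i → ℝ
  init_nonneg : ∀ i s, 0 ≤ init i s
  init_sum : ∀ i, ∑ s, init i s = 1
  /-- prior of the unknown parameter of each arm -/
  prior : ∀ i, Measure (Θ i)
  prior_prob : ∀ i, IsProbabilityMeasure (prior i)

/-! ### Episodes -/

section Episodes

variable {n : ℕ} {S : Fin n → Type*} [∀ i, DecidableEq (S i)]

/-- `N_t(x, u)`: number of times `1 ≤ τ < t` at which an arm with state path `s` and action path
`a` is at the state-action pair `(x, u)`. -/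
def visits {X : Type*} [DecidableEq X] (s : ℕ → X) (a : ℕ → Bool) (t : ℕ) (x : X) (u : Bool) : ℕ :=
  #{τ ∈ Ico 1 t | s τ = x ∧ a τ = u}

open Classical in
/-- The pair `(t_k, T_{k-1})` for the episode `k` to which time `t` belongs: start of this episode,
and length of the previous one. A new episode starts at `t` iff `t_k + T_{k-1} < t` or
`2 N_{t_k} < N_t` for some arm, state and action, where `t_k`, `T_{k-1}` belong to `t - 1`. -/
def schedule (s : ℕ → ∀ i, S i) (a : ℕ → Fin n → Bool) : ℕ → ℕ × ℕ
  | 0 => (0, 0)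
  | t + 1 =>
    if (schedule s a t).1 + (schedule s a t).2 < t + 1 ∨
        ∃ (i : Fin n) (x : S i) (u : Bool),
          2 * visits (fun τ => s τ i) (fun τ => a τ i) (schedule s a t).1 x u <
            visits (fun τ => s τ i) (fun τ => a τ i) (t + 1) x u
    then (t + 1, t + 1 - (schedule s a t).1)
    else schedule s a t

/-- An episode starts at time `t`. -/
def EpisodeStart (s : ℕ → ∀ i, S i) (a : ℕ → Fin n → Bool) (t : ℕ) : Prop :=
  (schedule s a t).1 = t

end Episodes

namespace Bandit

variable {n : ℕ} {S : Fin n → Type*} [∀ i, Fintype (S i)] [∀ i, DecidableEq (S i)]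
  {Θ : Fin n → Type*} [∀ i, MeasurableSpace (Θ i)] (M : Bandit S Θ)

/-- Reward yielded by arm `i`: in Model B a passive arm yields nothing. -/
def armReward (kind : RewardModel) (i : Fin n) (s : S i) (a : Bool) : ℝ :=
  match kind with
  | .A => M.r i s a
  | .B => if a = true then M.r i s a else 0

/-- Aggregate per-step reward. -/
def reward (kind : RewardModel) (s : ∀ i, S i) (a : Fin n → Bool) : ℝ :=
  ∑ i, M.armReward kind i (s i) (a i)

/-- Joint transition probability `∏ i, P^i(s'^i | s^i, a^i; θ^i)`. -/
def jointP (θ : ∀ i, Θ i) (s : ∀ i, S i) (a : Fin n → Bool) (s' : ∀ i, S i) : ℝ :=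
  ∏ i, M.P i (θ i) (s i) (a i) (s' i)

/-- Joint transition matrix under the stationary policy `f`. -/
def policyMatrix (θ : ∀ i, Θ i) (f : (∀ i, S i) → Fin n → Bool) :
    Matrix (∀ i, S i) (∀ i, S i) ℝ :=
  Matrix.of fun s s' => M.jointP θ s (f s) s'

/-- Average reward in model `θ` of the stationary policy `f` from initial state `s`. -/
def policyAverageReward (kind : RewardModel) (θ : ∀ i, Θ i) (f : (∀ i, S i) → Fin n → Bool)
    (s : ∀ i, S i) : ℝ :=
  averageReward (M.policyMatrix θ f) (fun x => M.reward kind x (f x)) s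

/-- Bayes' rule: `φ(dθ) P(s' | s, a; θ) / ∫ P(s' | s, a; θ') φ(dθ')`. -/
def bayesUpdate (i : Fin n) (φ : Measure (Θ i)) (s : S i) (a : Bool) (s' : S i) :
    Measure (Θ i) :=
  (∫⁻ θ, ENNReal.ofReal (M.P i θ s a s') ∂φ)⁻¹ •
    φ.withDensity fun θ => ENNReal.ofReal (M.P i θ s a s')

/-- Posterior of the parameter of arm `i` at time `t ≥ 1` given
`s 1, a 1, …, s (t - 1), a (t - 1), s t`. -/
def posterior (i : Fin n) (s : ℕ → S i) (a : ℕ → Bool) : ℕ → Measure (Θ i)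
  | 0 => M.prior i
  | 1 => M.prior i
  | t + 2 => M.bayesUpdate i (posterior i s a (t + 1)) (s (t + 1)) (a (t + 1)) (s (t + 2))

end Bandit

/-- `μ θ s` activates `m` arms whose Whittle indices at the current states are the `m` largest, for
the model `θ`; `g i θ lam` is the optimal policy of arm `i` at penalty `lam`. Ties are broken in any
way that is measurable in `θ`. -/
structure IsWhittlePolicy {n : ℕ} {S : Fin n → Type*} {Θ : Fin n → Type*}
    [∀ i, MeasurableSpace (Θ i)] (m : ℕ) (g : ∀ i, Θ i → ℝ → S i → Bool)
    (μ : (∀ i, Θ i) → (∀ i, S i) → Fin n → Bool) : Prop where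
  card_active : ∀ θ s, #{i | μ θ s i = true} = m
  largest : ∀ θ s i j, μ θ s i = true → μ θ s j = false →
    whittleIndex (g j (θ j)) (s j) ≤ whittleIndex (g i (θ i)) (s i)
  measurable : ∀ s, Measurable fun θ => μ θ s

/-! ### Runs of RB-TSDE -/

section Runs

variable {n : ℕ} {S : Fin n → Type*} {Θ : Fin n → Type*} [∀ i, MeasurableSpace (Θ i)] {Ω : Type*}

/-- The σ-algebra generated by the true parameter and by the states, actions and parameters in use
at the times `1 ≤ τ < t`. -/
abbrev pastSigma (θs : Ω → ∀ i, Θ i) (X : ℕ → Ω → ∀ i, S i) (A : ℕ → Ω → Fin n → Bool)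
    (θh : ℕ → Ω → ∀ i, Θ i) (t : ℕ) : MeasurableSpace Ω :=
  MeasurableSpace.comap θs inferInstance ⊔
    ⨆ τ ∈ Set.Ico 1 t, (MeasurableSpace.comap (X τ) ⊤ ⊔ MeasurableSpace.comap (A τ) ⊤ ⊔
      MeasurableSpace.comap (θh τ) inferInstance)

/-- A run of RB-TSDE with the policies `μ θ` on the probability space `(Ω, Pr)`: `θs` is the true
parameter, `X t` and `A t` are the states and actions at time `t ≥ 1`, and `θh t` is the parameter
in use at time `t` (the sample of the episode to which `t` belongs). -/
structure IsRBTSDE [∀ i, Fintype (S i)] [∀ i, DecidableEq (S i)] [MeasurableSpace Ω]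
    (M : Bandit S Θ) (μ : (∀ i, Θ i) → (∀ i, S i) → Fin n → Bool) (Pr : Measure Ω)
    (θs : Ω → ∀ i, Θ i) (X : ℕ → Ω → ∀ i, S i) (A : ℕ → Ω → Fin n → Bool)
    (θh : ℕ → Ω → ∀ i, Θ i) : Prop where
  measurable_param : Measurable θs
  measurable_state : ∀ t, 1 ≤ t → ∀ s, MeasurableSet (X t ⁻¹' {s})
  measurable_sample : ∀ t, 1 ≤ t → Measurable (θh t)
  /-- The true parameters of the arms follow the priors, independently across arms and of the
  initial states, which are independent across arms. -/
  init : ∀ B : Set (∀ i, Θ i), MeasurableSet B → ∀ s : ∀ i, S i,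
    Pr (θs ⁻¹' B ∩ X 1 ⁻¹' {s}) =
      Measure.pi M.prior B * ENNReal.ofReal (∏ i, M.init i (s i))
  /-- At the start of an episode, parameters are sampled from the posteriors, independently across
  arms and, given the observed history, of everything else so far. -/
  sample : ∀ t, 1 ≤ t → ∀ B : Set (∀ i, Θ i), MeasurableSet B →
    ∀ᵐ ω ∂Pr, EpisodeStart (fun τ => X τ ω) (fun τ => A τ ω) t →
      (Pr⟦θh t ⁻¹' B | pastSigma θs X A θh t ⊔ MeasurableSpace.comap (X t) ⊤⟧) ω =
        (Measure.pi fun i => M.posterior i (fun τ => X τ ω i) (fun τ => A τ ω i) t).real B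
  /-- Within an episode the sampled parameters are kept. -/
  keep : ∀ t, 1 ≤ t → ∀ ω, ¬ EpisodeStart (fun τ => X τ ω) (fun τ => A τ ω) t →
    θh t ω = θh (t - 1) ω
  /-- The policy of the parameter in use is applied. -/
  action : ∀ t, 1 ≤ t → ∀ ω, A t ω = μ (θh t ω) (X t ω)
  /-- The states move according to the true model, given the whole past. -/
  dynamics : ∀ t, 1 ≤ t → ∀ s' : ∀ i, S i,
    Pr⟦X (t + 1) ⁻¹' {s'} | pastSigma θs X A θh (t + 1)⟧
      =ᵐ[Pr] fun ω => M.jointP (θs ω) (X t ω) (A t ω) s'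

end Runs

end RestlessBandit

end

/-!
The proof is a posterior sampling argument.

*Bias.* Under `μ θ`, the transition matrix contracts the span of every function by the factor `λ*`,
so the bias in the Bellman equation has span at most `B = C / (1 - λ*)`, where `C = α Rmax` bounds
the rewards (`bellman_span_le`). Normalized to have minimum `0`, the bias `V θ` is a limit of
accumulated rewards, hence measurable in `θ` (`exists_measurable_bias`).

*Posterior sampling.* By induction on time, given the history of states and actions, the true
parameter is distributed according to the posterior and independent of the parameter in use
(`IsRBTSDE.bayes`). So at the start of an episode, the sampled and the true parameter have the same
law given the history, and either may replace the other in expectations of functions of the history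
(`IsRBTSDE.integral_sample_eq`).

*Decomposition.* With the parameter `θ_t` in use at time `t`, the Bellman equation expresses the
reward by `J(θ_t)` and `V(θ_t)`, and the regret splits into three parts
(`IsRBTSDE.integral_regret_le`):
* `T J(θ_*) - ∑ J(θ_t)`. If the lengths of the episodes were known when they start, its expectation
  would vanish; as an episode is at most one step longer than the previous one, it is at most `C`
  per episode.
* `∑ (V(θ_t)(S_{t+1}) - V(θ_t)(S_t))` telescopes within the episodes, and is at most `B` per episode.
* The differences of the expectations of `V(θ_t)` after one step in the models `θ_t` and `θ_*` are at
  most `B / 2` times the `ℓ¹` distance of the joint transition probabilities, hence of the sum of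
  the distances for the individual arms (`sum_abs_prod_sub_prod_le`).

*Number of episodes.* In a run of episodes without doubling, the lengths increase by one, and if
the arms have `S` states in total, there are `O(S log T)` doublings, so that there are
`O(√(S T log T))` episodes (`numEpisodes_le`).

*Concentration.* For each arm, the parameter in use and the true one are both in a confidence set
around the empirical transition probabilities at the start of the episode, except with small
probability. For the true parameter, this follows from an exponential supermartingale and a union
bound (`IsRBTSDE.measureReal_implausible_le`), and for the sampled one by posterior sampling. The
widths of the confidence sets add up to `O(s √(T log T))` for an arm with `s` states, because visit
counts at most double within an episode (`sum_inv_sqrt_visits_schedule_le`).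
-/

namespace RestlessBandit

/-! ### Ergodicity coefficient, span and bias of a finite Markov chain -/

section MarkovChain

variable {X : Type*} [Fintype X] {K : Matrix X X ℝ}

theorem one_sub_sum_min_le_ergodicityCoeff (K : Matrix X X ℝ) (x y : X) :
    1 - ∑ z, min (K x z) (K y z) ≤ ergodicityCoeff K := by
  have h := ciInf_le (f := fun p : X × X => ∑ z, min (K p.1 z) (K p.2 z))
    (Set.finite_range _).bddBelow (x, y)
  unfold ergodicityCoeff
  simp only at h
  linarith

theorem ergodicityCoeff_nonneg [Nonempty X] (hK : ∀ x, ∑ z, K x z = 1) :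
    0 ≤ ergodicityCoeff K := by
  obtain ⟨x⟩ := ‹Nonempty X›
  have h := one_sub_sum_min_le_ergodicityCoeff K x x
  simp only [min_self, hK] at h
  linarith

/-- A stochastic matrix contracts the span of a function by its ergodicity coefficient: the common
part `min (K x) (K y)` of two rows cancels in the difference. -/
theorem mulVec_sub_mulVec_le (hK : ∀ x, ∑ z, K x z = 1) {V : X → ℝ} {a b : ℝ}
    (ha : ∀ z, a ≤ V z) (hb : ∀ z, V z ≤ b) (x y : X) :
    K.mulVec V x - K.mulVec V y ≤ ergodicityCoeff K * (b - a) := by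
  have hab : a ≤ b := (ha x).trans (hb x)
  have h1 : ∑ z, (K x z - min (K x z) (K y z)) * V z
      ≤ ∑ z, (K x z - min (K x z) (K y z)) * b :=
    sum_le_sum fun z _ => mul_le_mul_of_nonneg_left (hb z) (sub_nonneg.2 (min_le_left _ _))
  have h2 : ∑ z, (K y z - min (K x z) (K y z)) * a
      ≤ ∑ z, (K y z - min (K x z) (K y z)) * V z :=
    sum_le_sum fun z _ => mul_le_mul_of_nonneg_left (ha z) (sub_nonneg.2 (min_le_right _ _))
  rw [← sum_mul, sum_sub_distrib, hK] at h1 h2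
  have h3 : K.mulVec V x - K.mulVec V y = ∑ z, (K x z - min (K x z) (K y z)) * V z -
      ∑ z, (K y z - min (K x z) (K y z)) * V z := by
    simp only [Matrix.mulVec, dotProduct, ← sum_sub_distrib]
    exact sum_congr rfl fun z _ => by ring
  have h4 := mul_le_mul_of_nonneg_right (one_sub_sum_min_le_ergodicityCoeff K x y)
    (sub_nonneg.2 hab)
  linarith

theorem mulVec_le_of_le (hK0 : ∀ x z, 0 ≤ K x z) (hK : ∀ x, ∑ z, K x z = 1) {V : X → ℝ} {b : ℝ}
    (hb : ∀ z, V z ≤ b) (x : X) : K.mulVec V x ≤ b := by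
  calc K.mulVec V x ≤ ∑ z, K x z * b :=
        sum_le_sum fun z _ => mul_le_mul_of_nonneg_left (hb z) (hK0 x z)
    _ = b := by rw [← sum_mul, hK, one_mul]

theorem le_mulVec_of_le (hK0 : ∀ x z, 0 ≤ K x z) (hK : ∀ x, ∑ z, K x z = 1) {V : X → ℝ} {a : ℝ}
    (ha : ∀ z, a ≤ V z) (x : X) : a ≤ K.mulVec V x := by
  calc a = ∑ z, K x z * a := by rw [← sum_mul, hK, one_mul]
    _ ≤ K.mulVec V x := sum_le_sum fun z _ => mul_le_mul_of_nonneg_left (ha z) (hK0 x z)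

/-- In the Bellman equation, the average reward lies between the extreme rewards (evaluate at an
extremum of the bias). -/
theorem bellman_averageReward_mem [Nonempty X] (hK0 : ∀ x z, 0 ≤ K x z)
    (hK : ∀ x, ∑ z, K x z = 1) {V ρ : X → ℝ} {J C : ℝ} (hV : ∀ x, J + V x = ρ x + K.mulVec V x)
    (hρ0 : ∀ x, 0 ≤ ρ x) (hρ : ∀ x, ρ x ≤ C) : 0 ≤ J ∧ J ≤ C := by
  obtain ⟨x, hx⟩ := Finite.exists_max V
  obtain ⟨y, hy⟩ := Finite.exists_min V
  have h1 := mulVec_le_of_le hK0 hK hx x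
  have h2 := le_mulVec_of_le hK0 hK hy y
  have := hV x; have := hV y; have := hρ0 y; have := hρ x
  constructor <;> linarith

/-- The span of the bias is at most `C / (1 - l)`, `C` being a bound on the rewards and `l` a bound
on the ergodicity coefficient. -/
theorem bellman_span_le (hK : ∀ x, ∑ z, K x z = 1) {V ρ : X → ℝ} {J C l : ℝ}
    (hV : ∀ x, J + V x = ρ x + K.mulVec V x)
    (hρ0 : ∀ x, 0 ≤ ρ x) (hρ : ∀ x, ρ x ≤ C) (hl : l < 1) (hKl : ergodicityCoeff K ≤ l)
    (x y : X) : V x - V y ≤ C / (1 - l) := by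
  have : Nonempty X := ⟨x⟩
  obtain ⟨p, hp⟩ := Finite.exists_max V
  obtain ⟨q, hq⟩ := Finite.exists_min V
  have h1 := mulVec_sub_mulVec_le hK hq hp p q
  have h2 : ergodicityCoeff K * (V p - V q) ≤ l * (V p - V q) :=
    mul_le_mul_of_nonneg_right hKl (sub_nonneg.2 (hq p))
  have h3 : V p - V q ≤ C / (1 - l) := by
    rw [le_div_iff₀ (by linarith)]
    have := hV p; have := hV q; have := hρ0 q; have := hρ p
    nlinarith
  have := hp x; have := hq y
  linarith

variable [DecidableEq X]

/-- Iterating the Bellman equation. -/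
theorem bellman_sum_pow {V ρ : X → ℝ} {J : ℝ} (hK : ∀ x, ∑ z, K x z = 1)
    (hV : ∀ x, J + V x = ρ x + K.mulVec V x) (N : ℕ) (x : X) :
    ∑ t ∈ range N, (K ^ t).mulVec ρ x = N * J + V x - (K ^ N).mulVec V x := by
  have hone : ∀ N : ℕ, (K ^ N).mulVec (fun _ => J) = fun _ => J := by
    intro N
    induction N with
    | zero => simp
    | succ N ih =>
      rw [pow_succ, ← Matrix.mulVec_mulVec]
      have : K.mulVec (fun _ => J) = fun _ => J := by
        ext x; simp only [Matrix.mulVec, dotProduct, ← sum_mul, hK, one_mul]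
      rw [this, ih]
  have hρ : ρ = (fun _ => J) + V - K.mulVec V := by
    ext x; simp only [Pi.add_apply, Pi.sub_apply]; linarith [hV x]
  induction N with
  | zero => simp
  | succ N ih =>
    rw [sum_range_succ, ih]
    have h1 : (K ^ N).mulVec ρ x
        = J + (K ^ N).mulVec V x - (K ^ (N + 1)).mulVec V x := by
      conv_lhs => rw [hρ]
      rw [Matrix.mulVec_sub, Matrix.mulVec_add, hone, Matrix.mulVec_mulVec, ← pow_succ]
      simp
    rw [h1]; push_cast; ring

theorem pow_mulVec_sub_le (hK : ∀ x, ∑ z, K x z = 1) {V : X → ℝ} {B l : ℝ} (hl0 : 0 ≤ l)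
    (hKl : ergodicityCoeff K ≤ l) (hB : ∀ x y, V x - V y ≤ B) (N : ℕ) (x y : X) :
    (K ^ N).mulVec V x - (K ^ N).mulVec V y ≤ l ^ N * B := by
  have : Nonempty X := ⟨x⟩
  induction N generalizing x y with
  | zero => simpa using hB x y
  | succ N ih =>
    obtain ⟨p, hp⟩ := Finite.exists_max ((K ^ N).mulVec V)
    obtain ⟨q, hq⟩ := Finite.exists_min ((K ^ N).mulVec V)
    rw [pow_succ', ← Matrix.mulVec_mulVec]
    calc _ ≤ ergodicityCoeff K * ((K ^ N).mulVec V p - (K ^ N).mulVec V q) :=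
          mulVec_sub_mulVec_le hK hq hp x y
      _ ≤ l * ((K ^ N).mulVec V p - (K ^ N).mulVec V q) :=
          mul_le_mul_of_nonneg_right hKl (sub_nonneg.2 (hq p))
      _ ≤ l * (l ^ N * B) := mul_le_mul_of_nonneg_left (ih p q) hl0
      _ = l ^ (N + 1) * B := by ring

/-- The bias, up to a constant, is a limit of differences of accumulated rewards, because the
powers of the transition matrix contract the span geometrically. -/
theorem tendsto_sum_pow_sub (hK : ∀ x, ∑ z, K x z = 1) {V ρ : X → ℝ} {J l : ℝ}
    (hV : ∀ x, J + V x = ρ x + K.mulVec V x) (hl : l < 1) (hKl : ergodicityCoeff K ≤ l)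
    (x y : X) :
    Tendsto (fun N : ℕ => ∑ t ∈ range N, (K ^ t).mulVec ρ x - ∑ t ∈ range N, (K ^ t).mulVec ρ y)
      atTop (nhds (V x - V y)) := by
  have : Nonempty X := ⟨x⟩
  have hl0 : 0 ≤ l := (ergodicityCoeff_nonneg hK).trans hKl
  obtain ⟨p, hp⟩ := Finite.exists_max V
  obtain ⟨q, hq⟩ := Finite.exists_min V
  have hB : ∀ x y, V x - V y ≤ V p - V q := fun x y => by linarith [hp x, hq y]
  have hlim : Tendsto (fun N : ℕ => l ^ N * (V p - V q)) atTop (nhds 0) := by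
    simpa using (tendsto_pow_atTop_nhds_zero_of_lt_one hl0 hl).mul_const (V p - V q)
  have h0 : Tendsto (fun N : ℕ => (K ^ N).mulVec V x - (K ^ N).mulVec V y) atTop (nhds 0) := by
    refine squeeze_zero_norm (fun N => ?_) hlim
    rw [Real.norm_eq_abs, abs_le]
    have h1 := pow_mulVec_sub_le hK hl0 hKl hB N x y
    have h2 := pow_mulVec_sub_le hK hl0 hKl hB N y x
    constructor <;> linarith
  have := (tendsto_const_nhds (x := V x - V y)).sub h0
  rw [sub_zero] at this
  refine this.congr fun N => ?_
  rw [bellman_sum_pow hK hV, bellman_sum_pow hK hV]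
  ring

end MarkovChain

/-! ### Products of probability vectors -/

section Product

variable {n : ℕ} {S : Fin n → Type*} [∀ i, Fintype (S i)]

theorem sum_prod_eq_prod_sum (f : ∀ i, S i → ℝ) :
    ∑ s : ∀ i, S i, ∏ i, f i (s i) = ∏ i, ∑ y, f i y := by
  classical
  rw [prod_univ_sum, Fintype.piFinset_univ]

theorem sum_prod_mul_apply {p : ∀ i, S i → ℝ} (hp : ∀ i, ∑ y, p i y = 1) (i : Fin n)
    (f : S i → ℝ) :
    ∑ s : ∀ i, S i, (∏ j, p j (s j)) * f (s i) = ∑ y, p i y * f y := by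
  classical
  have h : ∀ s : ∀ i, S i, (∏ j, p j (s j)) * f (s i) =
      ∏ j, (Function.update p i (fun y => p i y * f y)) j (s j) := by
    intro s
    rw [← mul_prod_erase _ _ (mem_univ i), ← mul_prod_erase univ
      (fun j => (Function.update p i (fun y => p i y * f y)) j (s j)) (mem_univ i)]
    simp only [Function.update_self]
    rw [mul_right_comm]
    congr 1
    exact prod_congr rfl fun j hj => by rw [Function.update_of_ne (ne_of_mem_erase hj)]
  simp_rw [h]
  rw [sum_prod_eq_prod_sum, ← mul_prod_erase _ _ (mem_univ i), prod_eq_one, mul_one]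
  · simp
  · intro j hj
    rw [Function.update_of_ne (ne_of_mem_erase hj), hp]

/-- The `ℓ¹` distance of products of probability vectors is at most the sum of the distances of the
factors, by exchanging one factor at a time. -/
theorem sum_abs_prod_sub_prod_le {p q : ∀ i, S i → ℝ} (hp0 : ∀ i y, 0 ≤ p i y)
    (hq0 : ∀ i y, 0 ≤ q i y) (hp : ∀ i, ∑ y, p i y = 1) (hq : ∀ i, ∑ y, q i y = 1) :
    ∑ s : ∀ i, S i, |∏ i, p i (s i) - ∏ i, q i (s i)| ≤ ∑ i, ∑ y, |p i y - q i y| := by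
  classical
  -- the hybrid vectors: `q` before `i`, `|p - q|` at `i`, `p` after `i`
  let h : Fin n → ∀ j, S j → ℝ := fun i j y =>
    if j = i then |p j y - q j y| else if j < i then q j y else p j y
  have hpt : ∀ s : ∀ i, S i, |∏ i, p i (s i) - ∏ i, q i (s i)| ≤ ∑ i, ∏ j, h i j (s j) := by
    intro s
    have e := prod_sub_ordered univ (fun i => p i (s i)) (fun i => p i (s i) - q i (s i))
    simp only [sub_sub_cancel] at e
    rw [e, sub_sub_cancel]
    refine (abs_sum_le_sum_abs _ _).trans (sum_le_sum fun i _ => le_of_eq ?_)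
    have hsplit : (univ : Finset (Fin n)) =
        insert i (univ.filter (· < i) ∪ univ.filter (i < ·)) := by
      ext j; simp; omega
    rw [hsplit, prod_insert (by simp), prod_union (by
      rw [disjoint_left]; intro j; simp; omega), ← hsplit, abs_mul, abs_mul, abs_prod, abs_prod,
      mul_assoc]
    congr 1
    · simp [h]
    · congr 1
      · refine prod_congr rfl fun j hj => ?_
        have hj' : j < i := by simpa using hj
        simp [h, hj'.ne, hj', abs_of_nonneg (hq0 _ _)]
      · refine prod_congr rfl fun j hj => ?_
        have hj' : i < j := by simpa using hj
        simp [h, hj'.ne', hj'.not_gt, abs_of_nonneg (hp0 _ _)]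
  calc ∑ s : ∀ i, S i, |∏ i, p i (s i) - ∏ i, q i (s i)|
      ≤ ∑ s : ∀ i, S i, ∑ i, ∏ j, h i j (s j) := sum_le_sum fun s _ => hpt s
    _ = ∑ i, ∏ j, ∑ y, h i j y := by
        rw [sum_comm]; exact sum_congr rfl fun i _ => sum_prod_eq_prod_sum _
    _ = ∑ i, ∑ y, |p i y - q i y| := by
        refine sum_congr rfl fun i _ => ?_
        rw [← mul_prod_erase _ _ (mem_univ i), prod_eq_one, mul_one]
        · simp [h]
        · intro j hj
          have hj' := ne_of_mem_erase hj
          by_cases hlt : j < i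
          · simp [h, hj', hlt, hq]
          · simp [h, hj', hlt, hp]

end Product

/-! ### Visit counts -/

section Visits

variable {X : Type*} [DecidableEq X] (s : ℕ → X) (a : ℕ → Bool)

theorem visits_succ {t : ℕ} (ht : 1 ≤ t) (x : X) (u : Bool) :
    visits s a (t + 1) x u = visits s a t x u + if s t = x ∧ a t = u then 1 else 0 := by
  unfold visits
  rw [Nat.Ico_succ_right_eq_insert_Ico ht, filter_insert]
  split_ifs
  · rw [card_insert_of_notMem (by simp)]
  · rfl

theorem visits_mono {t t' : ℕ} (h : t ≤ t') (x : X) (u : Bool) :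
    visits s a t x u ≤ visits s a t' x u :=
  card_le_card (filter_subset_filter _ (Ico_subset_Ico le_rfl h))

theorem visits_le (t : ℕ) (x : X) (u : Bool) : visits s a t x u ≤ t - 1 :=
  (card_filter_le _ _).trans (by simp)

variable {s a} in
theorem visits_congr {s' : ℕ → X} {a' : ℕ → Bool} {t : ℕ}
    (h : ∀ τ, 1 ≤ τ → τ < t → s τ = s' τ ∧ a τ = a' τ) (x : X) (u : Bool) :
    visits s a t x u = visits s' a' t x u := by
  unfold visits
  congr 1
  refine filter_congr fun τ hτ => ?_
  rw [mem_Ico] at hτ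
  rw [(h τ hτ.1 hτ.2).1, (h τ hτ.1 hτ.2).2]

variable [Fintype X]

theorem sum_visits (T : ℕ) : ∑ z : X × Bool, visits s a (T + 1) z.1 z.2 = T := by
  unfold visits
  have := card_eq_sum_card_fiberwise (s := Ico 1 (T + 1)) (t := (univ : Finset (X × Bool)))
    (f := fun τ => (s τ, a τ)) (by intro τ _; simp)
  rw [Nat.card_Ico, Nat.add_sub_cancel] at this
  refine Eq.trans (sum_congr rfl fun z _ => ?_) this.symm
  refine congrArg card (filter_congr fun τ _ => ?_)
  rw [Prod.ext_iff]

theorem inv_sqrt_max_one_le (N : ℕ) :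
    1 / √(max 1 (N : ℝ)) ≤ 5 / 2 * (√((N : ℝ) + 1) - √N) := by
  rcases Nat.eq_zero_or_pos N with rfl | hN
  · norm_num
  · have h1 : (1 : ℝ) ≤ N := by exact_mod_cast hN
    rw [max_eq_right h1, div_le_iff₀ (Real.sqrt_pos.2 (by linarith))]
    have ha : √(N : ℝ) * √N = N := Real.mul_self_sqrt (by linarith)
    have hb : √((N : ℝ) + 1) * √(N : ℝ) = √((N + 1) * N) := (Real.sqrt_mul (by linarith) _).symm
    -- `N + 2/5 ≤ √(N (N + 1))` as soon as `N ≥ 1`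
    have hc : (N : ℝ) + 2 / 5 ≤ √((N + 1) * N) := Real.le_sqrt_of_sq_le (by nlinarith)
    nlinarith

theorem sum_inv_sqrt_visits_le (T : ℕ) :
    ∑ t ∈ Icc 1 T, 1 / √(max 1 (visits s a t (s t) (a t) : ℝ)) ≤
      5 / 2 * ∑ z : X × Bool, √(visits s a (T + 1) z.1 z.2 : ℝ) := by
  induction T with
  | zero => simpa using sum_nonneg fun _ _ => Real.sqrt_nonneg _
  | succ T ih =>
    rw [sum_Icc_succ_top (by omega)]
    have h : ∑ z : X × Bool, √(visits s a (T + 1 + 1) z.1 z.2 : ℝ) =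
        ∑ z : X × Bool, √(visits s a (T + 1) z.1 z.2 : ℝ) +
        (√((visits s a (T + 1) (s (T + 1)) (a (T + 1)) : ℝ) + 1) -
          √(visits s a (T + 1) (s (T + 1)) (a (T + 1)) : ℝ)) := by
      rw [← sub_eq_iff_eq_add', ← sum_sub_distrib, sum_eq_single (s (T + 1), a (T + 1))]
      · simp [visits_succ s a (show 1 ≤ T + 1 by omega)]
      · rintro ⟨x, u⟩ _ hz
        have : ¬ (s (T + 1) = x ∧ a (T + 1) = u) := by
          rintro ⟨rfl, rfl⟩; exact hz rfl
        simp [visits_succ s a (show 1 ≤ T + 1 by omega), this]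
      · simp
    rw [h]
    have := inv_sqrt_max_one_le (visits s a (T + 1) (s (T + 1)) (a (T + 1)))
    linarith

theorem sum_sqrt_visits_le (T : ℕ) :
    ∑ z : X × Bool, √(visits s a (T + 1) z.1 z.2 : ℝ) ≤ √(2 * (Fintype.card X * T)) := by
  refine Real.le_sqrt_of_sq_le ?_
  refine (sq_sum_le_card_mul_sum_sq).trans (le_of_eq ?_)
  have h : ∑ z : X × Bool, √(visits s a (T + 1) z.1 z.2 : ℝ) ^ 2 = T := by
    simp only [Real.sq_sqrt (Nat.cast_nonneg _)]
    exact_mod_cast sum_visits s a T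
  rw [h, card_univ, Fintype.card_prod, Fintype.card_bool]
  push_cast; ring

end Visits

/-! ### Episodes -/

section Schedule

variable {n : ℕ} {S : Fin n → Type*} [∀ i, DecidableEq (S i)]
  (s : ℕ → ∀ i, S i) (a : ℕ → Fin n → Bool)

theorem schedule_fst_le (t : ℕ) : (schedule s a t).1 ≤ t := by
  induction t with
  | zero => simp [schedule]
  | succ t ih =>
    rw [schedule]
    split_ifs
    · rfl
    · omega

theorem le_schedule_add (t : ℕ) : t ≤ (schedule s a t).1 + (schedule s a t).2 := by
  induction t with
  | zero => simp [schedule]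
  | succ t ih =>
    rw [schedule]
    split_ifs with h
    · simp
    · push Not at h
      exact h.1

theorem episodeStart_succ_iff (t : ℕ) : EpisodeStart s a (t + 1) ↔
    ((schedule s a t).1 + (schedule s a t).2 < t + 1 ∨
        ∃ (i : Fin n) (x : S i) (u : Bool),
          2 * visits (fun τ => s τ i) (fun τ => a τ i) (schedule s a t).1 x u <
            visits (fun τ => s τ i) (fun τ => a τ i) (t + 1) x u) := by
  have := schedule_fst_le s a t
  unfold EpisodeStart
  rw [schedule]
  split_ifs with h
  · simpa using h
  · simp only [h, iff_false]; omega

variable {s a}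

theorem schedule_succ_of_start {t : ℕ} (h : EpisodeStart s a (t + 1)) :
    schedule s a (t + 1) = (t + 1, t + 1 - (schedule s a t).1) := by
  rw [schedule, if_pos ((episodeStart_succ_iff s a t).1 h)]

theorem schedule_succ_of_not_start {t : ℕ} (h : ¬ EpisodeStart s a (t + 1)) :
    schedule s a (t + 1) = schedule s a t := by
  rw [schedule, if_neg (mt (episodeStart_succ_iff s a t).2 h)]

theorem episodeStart_one : EpisodeStart s a 1 :=
  (episodeStart_succ_iff s a 0).2 (Or.inl (by simp [schedule]))

theorem one_le_schedule_fst {t : ℕ} (ht : 1 ≤ t) : 1 ≤ (schedule s a t).1 := by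
  induction t, ht using Nat.le_induction with
  | base => exact episodeStart_one.ge
  | succ t _ ih =>
    by_cases h : EpisodeStart s a (t + 1)
    · rw [schedule_succ_of_start h]; simp
    · rwa [schedule_succ_of_not_start h]

theorem schedule_schedule_fst (t : ℕ) : schedule s a (schedule s a t).1 = schedule s a t := by
  induction t with
  | zero => simp [schedule]
  | succ t ih =>
    by_cases h : EpisodeStart s a (t + 1)
    · rw [show (schedule s a (t + 1)).1 = t + 1 from h]
    · rwa [schedule_succ_of_not_start h]

theorem episodeStart_schedule_fst (t : ℕ) : EpisodeStart s a (schedule s a t).1 := by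
  unfold EpisodeStart
  rw [schedule_schedule_fst]

/-- A quantity that only changes at the beginning of the episodes takes at time `t` the value it
had at the beginning of the current episode. -/
theorem eq_at_schedule_fst {α : Type*} {f : ℕ → α}
    (hf : ∀ t, 1 ≤ t → ¬ EpisodeStart s a (t + 1) → f (t + 1) = f t) {t : ℕ} (ht : 1 ≤ t) :
    f t = f (schedule s a t).1 := by
  induction t, ht using Nat.le_induction with
  | base => rw [show (schedule s a 1).1 = 1 from episodeStart_one]
  | succ t ht ih =>
    by_cases h : EpisodeStart s a (t + 1)
    · rw [show (schedule s a (t + 1)).1 = t + 1 from h]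
    · rw [schedule_succ_of_not_start h, hf t ht h, ih]

/-- Visit counts at most double within an episode. -/
theorem visits_le_two_mul (t : ℕ) (i : Fin n) (x : S i) (u : Bool) :
    visits (fun τ => s τ i) (fun τ => a τ i) t x u ≤
      2 * visits (fun τ => s τ i) (fun τ => a τ i) (schedule s a t).1 x u := by
  by_cases h : EpisodeStart s a t
  · rw [show (schedule s a t).1 = t from h]; omega
  · cases t with
    | zero => exact absurd (by simp [EpisodeStart, schedule]) h
    | succ t =>
      rw [schedule_succ_of_not_start h]
      rw [episodeStart_succ_iff] at h
      push Not at h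
      exact h.2 i x u

/-- The schedule at time `t` only depends on the states and actions before `t`. -/
theorem schedule_congr {s' : ℕ → ∀ i, S i} {a' : ℕ → Fin n → Bool} {t : ℕ}
    (h : ∀ τ, 1 ≤ τ → τ < t → s τ = s' τ ∧ a τ = a' τ) :
    schedule s a t = schedule s' a' t := by
  induction t with
  | zero => simp [schedule]
  | succ t ih =>
    have ih' := ih fun τ h1 h2 => h τ h1 (by omega)
    have hle := schedule_fst_le s' a' t
    have hv : ∀ t', t' ≤ t + 1 → ∀ (i : Fin n) (x : S i) (u : Bool),
        visits (fun τ => s τ i) (fun τ => a τ i) t' x u =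
          visits (fun τ => s' τ i) (fun τ => a' τ i) t' x u := fun t' ht' i x u =>
      visits_congr (fun τ h1 h2 => by
        obtain ⟨e1, e2⟩ := h τ h1 (by omega)
        exact ⟨by rw [e1], by rw [e2]⟩) x u
    have hiff : EpisodeStart s a (t + 1) ↔ EpisodeStart s' a' (t + 1) := by
      rw [episodeStart_succ_iff, episodeStart_succ_iff, ih']
      simp only [hv _ (hle.trans (Nat.le_succ t)), hv _ le_rfl]
    by_cases hs : EpisodeStart s a (t + 1)
    · rw [schedule_succ_of_start hs, schedule_succ_of_start (hiff.1 hs), ih']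
    · rw [schedule_succ_of_not_start hs, schedule_succ_of_not_start (mt hiff.2 hs), ih']

variable (s a)

open Classical in
/-- Number of episodes that start at one of the times `1, …, T`. -/
noncomputable def numEpisodes (T : ℕ) : ℕ := #{t ∈ Icc 1 T | EpisodeStart s a t}

open Classical in
theorem numEpisodes_succ (T : ℕ) :
    numEpisodes s a (T + 1) = numEpisodes s a T + if EpisodeStart s a (T + 1) then 1 else 0 := by
  unfold numEpisodes
  rw [← insert_Icc_right_eq_Icc_add_one (by omega), filter_insert]
  split_ifs
  · rw [card_insert_of_notMem (by simp)]
  · rfl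

open Classical in
/-- The lengths of the completed episodes add up to the elapsed time. -/
theorem sum_prevLength (T : ℕ) :
    ∑ t ∈ Icc 1 T, (if EpisodeStart s a t then ((schedule s a t).2 : ℝ) else 0) =
      (schedule s a T).1 := by
  induction T with
  | zero => simp [schedule]
  | succ T ih =>
    rw [sum_Icc_succ_top (by omega), ih]
    by_cases h : EpisodeStart s a (T + 1)
    · have := schedule_fst_le s a T
      rw [if_pos h, schedule_succ_of_start h]
      simp only
      rw [Nat.cast_sub (by omega)]; ring
    · rw [if_neg h, schedule_succ_of_not_start h, add_zero]

open Classical in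
/-- An episode is at most one step longer than the previous one. -/
theorem sum_le_sum_prevLength {f : ℕ → ℝ} (hf0 : ∀ t, 0 ≤ f t)
    (hf : ∀ t, 1 ≤ t → ¬ EpisodeStart s a (t + 1) → f (t + 1) = f t) (T : ℕ) :
    ∑ t ∈ Icc 1 T, f t ≤
      ∑ t ∈ Icc 1 T, (if EpisodeStart s a t then ((schedule s a t).2 + 1 : ℝ) * f t else 0) := by
  suffices h : ∑ t ∈ Icc 1 T, f t + ((schedule s a T).1 + (schedule s a T).2 - T : ℝ) * f T ≤
      ∑ t ∈ Icc 1 T, (if EpisodeStart s a t then ((schedule s a t).2 + 1 : ℝ) * f t else 0) by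
    have h1 : (T : ℝ) ≤ (schedule s a T).1 + (schedule s a T).2 := by
      exact_mod_cast le_schedule_add s a T
    nlinarith [mul_nonneg (sub_nonneg.2 h1) (hf0 T)]
  induction T with
  | zero => simp [schedule]
  | succ T ih =>
    rw [sum_Icc_succ_top (by omega), sum_Icc_succ_top (by omega)]
    by_cases h : EpisodeStart s a (T + 1)
    · have h1 : (T : ℝ) ≤ (schedule s a T).1 + (schedule s a T).2 := by
        exact_mod_cast le_schedule_add s a T
      have h2 := mul_nonneg (sub_nonneg.2 h1) (hf0 T)
      have h3 : ((schedule s a (T + 1)).1 : ℝ) = ((T + 1 : ℕ) : ℝ) := by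
        exact_mod_cast (show (schedule s a (T + 1)).1 = T + 1 from h)
      rw [if_pos h, h3]
      linarith
    · have hT : 1 ≤ T := by
        by_contra h0
        obtain rfl : T = 0 := by omega
        exact h episodeStart_one
      rw [if_neg h, schedule_succ_of_not_start h, hf T hT h]
      push_cast
      linarith

/-- Telescoping within each episode. -/
theorem sum_sub_le_mul_numEpisodes {Y : Type*} {v : ℕ → Y → ℝ} (x : ℕ → Y) {B : ℝ}
    (hv0 : ∀ t y, 0 ≤ v t y) (hvB : ∀ t y, v t y ≤ B)
    (hv : ∀ t, 1 ≤ t → ¬ EpisodeStart s a (t + 1) → v (t + 1) = v t) {T : ℕ} (hT : 1 ≤ T) :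
    ∑ t ∈ Icc 1 T, (v t (x (t + 1)) - v t (x t)) ≤ B * numEpisodes s a T := by
  suffices h : ∑ t ∈ Icc 1 T, (v t (x (t + 1)) - v t (x t)) ≤
      B * numEpisodes s a T + (v T (x (T + 1)) - B) by
    linarith [hvB T (x (T + 1))]
  induction T, hT using Nat.le_induction with
  | base =>
    have : numEpisodes s a 1 = 1 := by
      rw [numEpisodes_succ, if_pos episodeStart_one]; simp [numEpisodes]
    rw [this]
    simp only [Icc_self, sum_singleton]
    push_cast
    linarith [hv0 1 (x 1)]
  | succ T hT ih =>
    rw [sum_Icc_succ_top (by omega), numEpisodes_succ]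
    by_cases h : EpisodeStart s a (T + 1)
    · rw [if_pos h]
      push_cast
      linarith [hv0 (T + 1) (x (T + 1)), hvB T (x (T + 1))]
    · rw [if_neg h, hv T hT h]
      push_cast
      linarith

theorem numEpisodes_le_self (T : ℕ) : numEpisodes s a T ≤ T := by
  classical
  exact (card_filter_le _ _).trans (by simp)

variable [∀ i, Fintype (S i)]

/-- Sum over all arms, states and actions of the logarithm of the visit counts; it grows at every
episode that is started by a doubling. -/
def logVisits (t : ℕ) : ℕ :=
  ∑ z : (i : Fin n) × (S i × Bool),
    Nat.log 2 (visits (fun τ => s τ z.1) (fun τ => a τ z.1) t z.2.1 z.2.2 + 1)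

theorem logVisits_mono {t t' : ℕ} (h : t ≤ t') : logVisits s a t ≤ logVisits s a t' :=
  sum_le_sum fun _ _ => Nat.log_mono_right (Nat.succ_le_succ (visits_mono _ _ h _ _))

theorem logVisits_lt {t t' : ℕ} (h : t ≤ t') {i : Fin n} {x : S i} {u : Bool}
    (hd : 2 * visits (fun τ => s τ i) (fun τ => a τ i) t x u <
      visits (fun τ => s τ i) (fun τ => a τ i) t' x u) :
    logVisits s a t < logVisits s a t' := by
  refine sum_lt_sum
    (fun _ _ => Nat.log_mono_right (Nat.succ_le_succ (visits_mono _ _ h _ _)))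
    ⟨⟨i, x, u⟩, mem_univ _, ?_⟩
  rw [← Nat.succ_le_iff, Nat.succ_eq_add_one, ← Nat.log_mul_base (by norm_num) (by omega)]
  exact Nat.log_mono_right (by simp only; omega)

theorem logVisits_le {t : ℕ} (ht : 1 ≤ t) :
    logVisits s a t ≤ 2 * (∑ i, Fintype.card (S i)) * Nat.log 2 t := by
  unfold logVisits
  refine (sum_le_card_nsmul _ _ (Nat.log 2 t) fun z _ => Nat.log_mono_right ?_).trans ?_
  · have := visits_le (fun τ => s τ z.1) (fun τ => a τ z.1) t z.2.1 z.2.2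
    omega
  · rw [card_univ, Fintype.card_sigma, smul_eq_mul]
    simp only [Fintype.card_prod, Fintype.card_bool]
    rw [← sum_mul, mul_comm (∑ i, Fintype.card (S i))]

/-- In a run of episodes without doubling, the lengths increase by one. With a cut-off `l`,
episodes of length at least `l` are at most `T / l`, and there are at most `l` shorter ones in each
run. -/
theorem mul_numEpisodes_le (l t : ℕ) :
    l * numEpisodes s a t ≤ l * (l + 1) * logVisits s a (schedule s a t).1 +
      (schedule s a t).1 + l * min (schedule s a t).2 l := by
  induction t with
  | zero => simp [numEpisodes]
  | succ t ih =>
    rw [numEpisodes_succ]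
    by_cases h : EpisodeStart s a (t + 1)
    · have hle := schedule_fst_le s a t
      have hadd := le_schedule_add s a t
      rw [if_pos h, schedule_succ_of_start h]
      simp only
      rcases (episodeStart_succ_iff s a t).1 h with h1 | ⟨i, x, u, h2⟩
      · have hp : t + 1 - (schedule s a t).1 = (schedule s a t).2 + 1 := by omega
        rw [hp]
        have hm := Nat.mul_le_mul_left (l * (l + 1))
          (logVisits_mono s a (show (schedule s a t).1 ≤ t + 1 by omega))
        rcases Nat.lt_or_ge (schedule s a t).2 l with hl | hl
        · rw [min_eq_left hl.le] at ih
          rw [min_eq_left (by omega)]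
          nlinarith
        · rw [min_eq_right hl] at ih
          rw [min_eq_right (by omega)]
          nlinarith
      · have hm := Nat.mul_le_mul_left (l * (l + 1))
          (logVisits_lt s a (show (schedule s a t).1 ≤ t + 1 by omega) h2)
        have hmin := Nat.mul_le_mul_left l (min_le_right (schedule s a t).2 l)
        have h0 : 0 ≤ l * min (t + 1 - (schedule s a t).1) l := Nat.zero_le _
        simp only [Nat.succ_eq_add_one] at hm
        nlinarith
    · rw [if_neg h, schedule_succ_of_not_start h, add_zero]
      exact ih

/-- There are `O(√(S T log T))` episodes up to time `T`, where `S` is the total number of states of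
the arms. -/
theorem numEpisodes_le {T : ℕ} (hT : 2 ≤ T) (hS : 1 ≤ ∑ i, Fintype.card (S i)) :
    (numEpisodes s a T : ℝ) ≤
      42 / 5 * (∑ i, (Fintype.card (S i) : ℝ)) * √(T * Real.log T) := by
  set c : ℝ := ∑ i, (Fintype.card (S i) : ℝ) with hc
  have hc1 : 1 ≤ c := by rw [hc]; exact_mod_cast hS
  have hT' : (2 : ℝ) ≤ T := by exact_mod_cast hT
  have hlog2 : (0.6931471803 : ℝ) < Real.log 2 := Real.log_two_gt_d9
  have hlogT : Real.log 2 ≤ Real.log T := Real.log_le_log (by norm_num) hT'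
  -- `d` bounds the number of runs of episodes without doubling
  set d : ℝ := (21 / 10) ^ 2 * c * Real.log T with hd
  have hlog0 : 0 < Real.log T := by linarith
  have hd0 : 0 < d := by positivity
  have hruns : (logVisits s a T : ℝ) + 1 ≤ d := by
    have h1 : (logVisits s a T : ℝ) ≤ 2 * c * (Nat.log 2 T : ℝ) := by
      rw [hc]; exact_mod_cast logVisits_le s a (by omega)
    have h2 : (Nat.log 2 T : ℝ) * Real.log 2 ≤ Real.log T := by
      rw [← Real.log_pow]
      exact Real.log_le_log (by positivity) (by exact_mod_cast Nat.pow_log_le_self 2 (by omega))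
    have h3 : (Nat.log 2 T : ℝ) ≤ (147 / 100) * Real.log T := by nlinarith
    have h4 : (1 : ℝ) ≤ 147 / 100 * Real.log T := by nlinarith
    have h5 : 2 * c * (Nat.log 2 T : ℝ) ≤ 2 * c * ((147 / 100) * Real.log T) :=
      mul_le_mul_of_nonneg_left h3 (by linarith)
    have h6 : (1 : ℝ) ≤ c * (147 / 100 * Real.log T) := by nlinarith
    rw [hd]; nlinarith
  have hmain : (numEpisodes s a T : ℝ) ≤ 4 * √(T * d) := by
    rcases le_or_gt (T : ℝ) d with h | h
    · have h1 : (numEpisodes s a T : ℝ) ≤ T := by exact_mod_cast numEpisodes_le_self s a T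
      have h2 : (T : ℝ) ≤ √(T * d) := Real.le_sqrt_of_sq_le (by nlinarith)
      linarith [Real.sqrt_nonneg (T * d)]
    · -- the cut-off balances `T / l` and `l d`
      set x : ℝ := √(T / d) with hx
      have hx1 : 1 ≤ x := Real.one_le_sqrt.2 ((one_le_div hd0).2 h.le)
      have hxd : x * d = √(T * d) := by
        rw [hx, show (T : ℝ) * d = T / d * (d * d) by field_simp,
          Real.sqrt_mul (by positivity), Real.sqrt_mul_self hd0.le]
      have hxT : x * √(T * d) = T := by
        rw [← hxd, ← mul_assoc, hx, Real.mul_self_sqrt (by positivity)]; field_simp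
      set l : ℕ := ⌈x⌉₊ with hl
      have hlx : x ≤ l := Nat.le_ceil x
      have hlx' : (l : ℝ) < x + 1 := Nat.ceil_lt_add_one (by linarith)
      have h1 : (l : ℝ) * numEpisodes s a T ≤ l * (l + 1) * logVisits s a T + T + l * l := by
        have h2 := mul_numEpisodes_le s a l T
        have h3 := schedule_fst_le s a T
        have h4 := Nat.mul_le_mul_left (l * (l + 1)) (logVisits_mono s a h3)
        have h5 := Nat.mul_le_mul_left l (min_le_right (schedule s a T).2 l)
        have h6 : l * numEpisodes s a T ≤ l * (l + 1) * logVisits s a T + T + l * l := by omega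
        exact_mod_cast h6
      have hl0 : (0 : ℝ) < l := by linarith
      have h7 : (l : ℝ) * (l + 1) * logVisits s a T + l * l ≤ l * ((x + 2) * d) := by
        have e1 : ((l : ℝ) + 1) * (logVisits s a T + 1) ≤ (x + 2) * d :=
          mul_le_mul (by linarith) hruns (by positivity) (by linarith)
        nlinarith
      have h8 : (T : ℝ) ≤ l * √(T * d) := by
        calc (T : ℝ) = x * √(T * d) := hxT.symm
          _ ≤ _ := mul_le_mul_of_nonneg_right hlx (Real.sqrt_nonneg _)
      have h9 : (l : ℝ) * numEpisodes s a T ≤ l * (4 * √(T * d)) := by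
        have : (x + 2) * d ≤ 3 * √(T * d) := by rw [← hxd]; nlinarith
        nlinarith
      exact le_of_mul_le_mul_left h9 hl0
  refine hmain.trans ?_
  have h1 : √(T * d) = 21 / 10 * (√c * √(T * Real.log T)) := by
    rw [hd, show (T : ℝ) * ((21 / 10) ^ 2 * c * Real.log T) =
      (21 / 10) ^ 2 * (c * (T * Real.log T)) by ring, Real.sqrt_mul (by positivity),
      Real.sqrt_sq (by norm_num), Real.sqrt_mul (by linarith)]
  have h2 : √c ≤ c := Real.sqrt_le_iff.2 ⟨by linarith, by nlinarith⟩
  rw [h1]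
  have := mul_le_mul_of_nonneg_right h2 (Real.sqrt_nonneg (T * Real.log T))
  linarith

/-- Each arm is at a well-explored state-action pair most of the time, even when the visits are
counted at the beginning of the episodes. -/
theorem sum_inv_sqrt_visits_schedule_le (i : Fin n) (T : ℕ) :
    ∑ t ∈ Icc 1 T, 1 / √(max 1 (visits (fun τ => s τ i) (fun τ => a τ i)
        (schedule s a t).1 (s t i) (a t i) : ℝ)) ≤ 5 * √(Fintype.card (S i) * T) := by
  calc _ ≤ ∑ t ∈ Icc 1 T, √2 * (1 / √(max 1 (visits (fun τ => s τ i) (fun τ => a τ i)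
        t (s t i) (a t i) : ℝ))) := by
        refine sum_le_sum fun t _ => ?_
        have h : (visits (fun τ => s τ i) (fun τ => a τ i) t (s t i) (a t i) : ℝ) ≤
            2 * visits (fun τ => s τ i) (fun τ => a τ i) (schedule s a t).1 (s t i) (a t i) := by
          exact_mod_cast visits_le_two_mul t i _ _
        set p : ℝ := (visits (fun τ => s τ i) (fun τ => a τ i) t (s t i) (a t i) : ℝ)
        set q : ℝ := (visits (fun τ => s τ i) (fun τ => a τ i) (schedule s a t).1 (s t i) (a t i)
          : ℝ)
        have hp : 0 < √(max 1 p) := Real.sqrt_pos.2 (by positivity)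
        have hq : 0 < √(max 1 q) := Real.sqrt_pos.2 (by positivity)
        rw [mul_one_div, div_le_div_iff₀ hq hp, one_mul, ← Real.sqrt_mul (by norm_num)]
        refine Real.sqrt_le_sqrt (max_le ?_ ?_)
        · linarith [le_max_left 1 q]
        · linarith [le_max_right 1 q]
    _ ≤ √2 * (5 / 2 * √(2 * (Fintype.card (S i) * T))) := by
        rw [← mul_sum]
        refine mul_le_mul_of_nonneg_left ?_ (Real.sqrt_nonneg 2)
        refine (sum_inv_sqrt_visits_le (fun τ => s τ i) (fun τ => a τ i) T).trans ?_
        exact mul_le_mul_of_nonneg_left (sum_sqrt_visits_le _ _ T) (by norm_num)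
    _ = 5 * √(Fintype.card (S i) * T) := by
        rw [Real.sqrt_mul (by norm_num)]
        have : √2 * √2 = (2 : ℝ) := Real.mul_self_sqrt (by norm_num)
        linear_combination (5 / 2 * √((Fintype.card (S i) : ℝ) * T)) * this

end Schedule

/-! ### Products of Bayesian updates -/

theorem pi_withDensity_ofReal {n : ℕ} {Θ : Fin n → Type*} [∀ i, MeasurableSpace (Θ i)]
    (φ : ∀ i, Measure (Θ i)) [∀ i, IsFiniteMeasure (φ i)] {f : ∀ i, Θ i → ℝ}
    (hf : ∀ i, Measurable (f i)) (hf0 : ∀ i θ, 0 ≤ f i θ) (hf1 : ∀ i θ, f i θ ≤ 1) :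
    Measure.pi (fun i => (φ i).withDensity fun θ => ENNReal.ofReal (f i θ)) =
      (Measure.pi φ).withDensity fun θ => ENNReal.ofReal (∏ i, f i (θ i)) := by
  have hint : ∀ i (ν : Measure (Θ i)) [IsFiniteMeasure ν], Integrable (f i) ν := fun i ν _ =>
    Integrable.of_bound (hf i).aestronglyMeasurable 1
      (ae_of_all _ fun θ => by rw [Real.norm_of_nonneg (hf0 i θ)]; exact hf1 i θ)
  have : ∀ i, IsFiniteMeasure ((φ i).withDensity fun θ => ENNReal.ofReal (f i θ)) := fun i =>
    isFiniteMeasure_withDensity_ofReal (hint i (φ i)).2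
  refine Measure.pi_eq fun s hs => ?_
  have hprod : Measurable fun θ : ∀ i, Θ i => ∏ i, f i (θ i) :=
    Finset.measurable_prod _ fun i _ => (hf i).comp (measurable_pi_apply i)
  rw [withDensity_apply _ (MeasurableSet.univ_pi hs), Measure.restrict_pi_pi,
    ← ofReal_integral_eq_lintegral_ofReal, integral_fintype_prod_eq_prod,
    ENNReal.ofReal_prod_of_nonneg fun i _ => integral_nonneg (hf0 i)]
  · refine prod_congr rfl fun i _ => ?_
    rw [withDensity_apply _ (hs i), ofReal_integral_eq_lintegral_ofReal (hint i _)
      (ae_of_all _ (hf0 i))]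
  · refine Integrable.of_bound hprod.aestronglyMeasurable 1 (ae_of_all _ fun θ => ?_)
    rw [Real.norm_of_nonneg (prod_nonneg fun i _ => hf0 i _)]
    exact prod_le_one (fun i _ => hf0 i _) fun i _ => hf1 i _
  · exact ae_of_all _ fun θ => prod_nonneg fun i _ => hf0 i _

namespace Bandit

variable {n : ℕ} {S : Fin n → Type*} [∀ i, Fintype (S i)]
  {Θ : Fin n → Type*} [∀ i, MeasurableSpace (Θ i)] (M : Bandit S Θ)

theorem P_le_one (i : Fin n) (θ : Θ i) (s : S i) (a : Bool) (s' : S i) : M.P i θ s a s' ≤ 1 := by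
  rw [← M.P_sum i θ s a]
  exact single_le_sum (fun y _ => M.P_nonneg i θ s a y) (mem_univ s')

theorem jointP_nonneg (θ : ∀ i, Θ i) (s : ∀ i, S i) (a : Fin n → Bool) (s' : ∀ i, S i) :
    0 ≤ M.jointP θ s a s' := prod_nonneg fun _ _ => M.P_nonneg _ _ _ _ _

theorem jointP_le_one (θ : ∀ i, Θ i) (s : ∀ i, S i) (a : Fin n → Bool) (s' : ∀ i, S i) :
    M.jointP θ s a s' ≤ 1 :=
  prod_le_one (fun _ _ => M.P_nonneg _ _ _ _ _) fun _ _ => M.P_le_one _ _ _ _ _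

theorem sum_jointP (θ : ∀ i, Θ i) (s : ∀ i, S i) (a : Fin n → Bool) :
    ∑ s' : ∀ i, S i, M.jointP θ s a s' = 1 := by
  unfold jointP
  rw [sum_prod_eq_prod_sum (fun i y => M.P i (θ i) (s i) (a i) y)]
  exact prod_eq_one fun i _ => M.P_sum _ _ _ _

theorem measurable_jointP (s : ∀ i, S i) (a : Fin n → Bool) (s' : ∀ i, S i) :
    Measurable fun θ => M.jointP θ s a s' :=
  Finset.measurable_prod _ fun i _ => (M.P_measurable i _ _ _).comp (measurable_pi_apply i)

theorem bayesUpdate_univ_le_one (i : Fin n) (φ : Measure (Θ i)) (s : S i) (a : Bool) (s' : S i) :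
    M.bayesUpdate i φ s a s' Set.univ ≤ 1 := by
  rw [bayesUpdate, Measure.smul_apply, smul_eq_mul, withDensity_apply _ MeasurableSet.univ,
    Measure.restrict_univ]
  exact ENNReal.inv_mul_le_one _

instance isFiniteMeasure_bayesUpdate (i : Fin n) (φ : Measure (Θ i)) (s : S i) (a : Bool)
    (s' : S i) : IsFiniteMeasure (M.bayesUpdate i φ s a s') :=
  ⟨(M.bayesUpdate_univ_le_one i φ s a s').trans_lt ENNReal.one_lt_top⟩

instance isFiniteMeasure_posterior (i : Fin n) (s : ℕ → S i) (a : ℕ → Bool) (t : ℕ) :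
    IsFiniteMeasure (M.posterior i s a t) := by
  have := M.prior_prob i
  match t with
  | 0 => rw [posterior]; infer_instance
  | 1 => rw [posterior]; infer_instance
  | t + 2 => rw [posterior]; infer_instance

/-- The product of the Bayesian updates of the arms is the Bayesian update of the product. The
normalizing constant is kept on the left, so that observations of likelihood zero need no special
treatment. -/
theorem smul_pi_bayesUpdate (φ : ∀ i, Measure (Θ i)) [∀ i, IsFiniteMeasure (φ i)]
    (s : ∀ i, S i) (a : Fin n → Bool) (s' : ∀ i, S i) :
    (∫⁻ θ, ENNReal.ofReal (M.jointP θ s a s') ∂Measure.pi φ) •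
      Measure.pi (fun i => M.bayesUpdate i (φ i) (s i) (a i) (s' i)) =
    (Measure.pi φ).withDensity fun θ => ENNReal.ofReal (M.jointP θ s a s') := by
  have key := pi_withDensity_ofReal φ (f := fun i θ => M.P i θ (s i) (a i) (s' i))
    (fun i => M.P_measurable i _ _ _) (fun i θ => M.P_nonneg i θ _ _ _)
    (fun i θ => M.P_le_one i θ _ _ _)
  have hfin : ∀ i, IsFiniteMeasure ((φ i).withDensity fun θ =>
      ENNReal.ofReal (M.P i θ (s i) (a i) (s' i))) := fun i =>
    isFiniteMeasure_withDensity_ofReal (Integrable.of_bound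
      (M.P_measurable i _ _ _).aestronglyMeasurable 1 (ae_of_all _ fun θ => by
        rw [Real.norm_of_nonneg (M.P_nonneg i θ _ _ _)]; exact M.P_le_one i θ _ _ _)).2
  have hZ : (∫⁻ θ, ENNReal.ofReal (M.jointP θ s a s') ∂Measure.pi φ) =
      ∏ i, ∫⁻ θ, ENNReal.ofReal (M.P i θ (s i) (a i) (s' i)) ∂φ i := by
    have h := congrArg (fun ν => ν Set.univ) key
    simp only [Measure.pi_univ, withDensity_apply _ MeasurableSet.univ,
      Measure.restrict_univ] at h
    exact h.symm
  refine Eq.trans (Measure.pi_eq fun B hB => ?_).symm key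
  rw [Measure.smul_apply, Measure.pi_pi, smul_eq_mul, hZ, ← prod_mul_distrib]
  refine prod_congr rfl fun i _ => ?_
  rw [bayesUpdate, Measure.smul_apply, smul_eq_mul]
  set Z := ∫⁻ θ, ENNReal.ofReal (M.P i θ (s i) (a i) (s' i)) ∂φ i with hZi
  have hle : (φ i).withDensity (fun θ => ENNReal.ofReal (M.P i θ (s i) (a i) (s' i))) (B i) ≤ Z :=
    (measure_mono (Set.subset_univ _)).trans_eq (by
      rw [withDensity_apply _ MeasurableSet.univ, Measure.restrict_univ])
  have hZtop : Z ≠ ⊤ := by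
    have := (hfin i).measure_univ_lt_top
    rw [withDensity_apply _ MeasurableSet.univ, Measure.restrict_univ] at this
    exact this.ne
  rcases eq_or_ne Z 0 with h0 | h0
  · rw [h0] at hle
    rw [h0, zero_mul, le_antisymm hle bot_le]
  · rw [← mul_assoc, ENNReal.mul_inv_cancel h0 hZtop, one_mul]

theorem posterior_congr (i : Fin n) {s s' : ℕ → S i} {a a' : ℕ → Bool} {t : ℕ}
    (hs : ∀ τ, 1 ≤ τ → τ ≤ t → s τ = s' τ) (ha : ∀ τ, 1 ≤ τ → τ < t → a τ = a' τ) :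
    M.posterior i s a t = M.posterior i s' a' t := by
  match t with
  | 0 => simp only [posterior]
  | 1 => simp only [posterior]
  | t + 2 =>
    rw [posterior, posterior, posterior_congr i (t := t + 1) (fun τ h1 h2 => hs τ h1 (by omega))
      (fun τ h1 h2 => ha τ h1 (by omega)), hs (t + 1) (by omega) (by omega),
      hs (t + 2) (by omega) (by omega), ha (t + 1) (by omega) (by omega)]

end Bandit

/-! ### Histories -/

theorem measurable_apply_of_countable {Ω β ι : Type*} [Countable ι] {mΩ : MeasurableSpace Ω}
    [MeasurableSpace β] {Y : Ω → ι} (hY : ∀ y, MeasurableSet (Y ⁻¹' {y})) {F : ι → Ω → β}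
    (hF : ∀ y, Measurable (F y)) : Measurable fun ω => F (Y ω) ω := by
  intro U hU
  have : (fun ω => F (Y ω) ω) ⁻¹' U = ⋃ y, Y ⁻¹' {y} ∩ F y ⁻¹' U := by
    ext ω; simp
  rw [this]
  exact MeasurableSet.iUnion fun y => (hY y).inter (hF y hU)

section Past

variable {n : ℕ} {S : Fin n → Type*} {Θ : Fin n → Type*} [∀ i, MeasurableSpace (Θ i)] {Ω : Type*}
  (θs : Ω → ∀ i, Θ i) (X : ℕ → Ω → ∀ i, S i) (A : ℕ → Ω → Fin n → Bool) (θh : ℕ → Ω → ∀ i, Θ i)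

theorem pastSigma_mono {t t' : ℕ} (h : t ≤ t') :
    pastSigma θs X A θh t ≤ pastSigma θs X A θh t' :=
  sup_le_sup_left (biSup_mono fun _ hτ => ⟨hτ.1, hτ.2.trans_le h⟩) _

theorem measurable_param_pastSigma (t : ℕ) : Measurable[pastSigma θs X A θh t] θs :=
  (comap_measurable θs).mono le_sup_left le_rfl

theorem comap_le_pastSigma {t τ : ℕ} (h1 : 1 ≤ τ) (h2 : τ < t) :
    MeasurableSpace.comap (X τ) ⊤ ⊔ MeasurableSpace.comap (A τ) ⊤ ⊔
      MeasurableSpace.comap (θh τ) inferInstance ≤ pastSigma θs X A θh t :=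
  le_sup_of_le_right (le_biSup (fun τ => MeasurableSpace.comap (X τ) ⊤ ⊔
    MeasurableSpace.comap (A τ) ⊤ ⊔ MeasurableSpace.comap (θh τ) inferInstance)
    (show τ ∈ Set.Ico 1 t from ⟨h1, h2⟩))

theorem measurableSet_state_pastSigma {t τ : ℕ} (h1 : 1 ≤ τ) (h2 : τ < t) (U : Set (∀ i, S i)) :
    MeasurableSet[pastSigma θs X A θh t] (X τ ⁻¹' U) :=
  comap_le_pastSigma θs X A θh h1 h2 _
    ((le_sup_left.trans le_sup_left : MeasurableSpace.comap (X τ) ⊤ ≤ _) _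
      ⟨U, MeasurableSpace.measurableSet_top, rfl⟩)

theorem measurableSet_action_pastSigma {t τ : ℕ} (h1 : 1 ≤ τ) (h2 : τ < t)
    (U : Set (Fin n → Bool)) : MeasurableSet[pastSigma θs X A θh t] (A τ ⁻¹' U) :=
  comap_le_pastSigma θs X A θh h1 h2 _
    ((le_sup_right.trans le_sup_left : MeasurableSpace.comap (A τ) ⊤ ≤ _) _
      ⟨U, MeasurableSpace.measurableSet_top, rfl⟩)

theorem measurable_sample_pastSigma {t τ : ℕ} (h1 : 1 ≤ τ) (h2 : τ < t) :
    Measurable[pastSigma θs X A θh t] (θh τ) :=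
  (comap_measurable (θh τ)).mono (le_sup_right.trans (comap_le_pastSigma θs X A θh h1 h2)) le_rfl

/-- The event that the states up to time `t` and the actions before time `t` are those of the paths
`x` and `a`. -/
def historyEvent (t : ℕ) (x : ℕ → ∀ i, S i) (a : ℕ → Fin n → Bool) : Set Ω :=
  {ω | (∀ τ, 1 ≤ τ → τ ≤ t → X τ ω = x τ) ∧ ∀ τ, 1 ≤ τ → τ < t → A τ ω = a τ}

variable {X A} in
theorem historyEvent_succ {t : ℕ} (ht : 1 ≤ t) (x : ℕ → ∀ i, S i) (a : ℕ → Fin n → Bool) :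
    historyEvent X A (t + 1) x a =
      historyEvent X A t x a ∩ A t ⁻¹' {a t} ∩ X (t + 1) ⁻¹' {x (t + 1)} := by
  ext ω
  simp only [historyEvent, Set.mem_ofPred_eq, Set.mem_inter_iff, Set.mem_preimage,
    Set.mem_singleton_iff]
  constructor
  · rintro ⟨h1, h2⟩
    exact ⟨⟨⟨fun τ a b => h1 τ a (by omega), fun τ a b => h2 τ a (by omega)⟩,
      h2 t ht (by omega)⟩, h1 _ (by omega) le_rfl⟩
  · rintro ⟨⟨⟨h1, h2⟩, h3⟩, h4⟩
    refine ⟨fun τ a b => ?_, fun τ a b => ?_⟩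
    · rcases Nat.lt_or_ge t τ with h | h
      · obtain rfl : τ = t + 1 := by omega
        exact h4
      · exact h1 τ a h
    · rcases Nat.lt_or_ge τ t with h | h
      · exact h2 τ a h
      · obtain rfl : τ = t := by omega
        exact h3

theorem measurableSet_historyEvent (t : ℕ) (x : ℕ → ∀ i, S i) (a : ℕ → Fin n → Bool) :
    MeasurableSet[pastSigma θs X A θh t ⊔ MeasurableSpace.comap (X t) ⊤]
      (historyEvent X A t x a) := by
  have e : historyEvent X A t x a =
      (⋂ τ, ⋂ (_ : 1 ≤ τ), ⋂ (_ : τ ≤ t), X τ ⁻¹' {x τ}) ∩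
        ⋂ τ, ⋂ (_ : 1 ≤ τ), ⋂ (_ : τ < t), A τ ⁻¹' {a τ} := by
    ext ω; simp [historyEvent]
  rw [e]
  refine MeasurableSet.inter (MeasurableSet.iInter fun τ => MeasurableSet.iInter fun h1 =>
    MeasurableSet.iInter fun h2 => ?_) (MeasurableSet.iInter fun τ => MeasurableSet.iInter fun h1 =>
    MeasurableSet.iInter fun h2 => ?_)
  · rcases h2.lt_or_eq with h | rfl
    · exact (le_sup_left : pastSigma θs X A θh t ≤ _) _
        (measurableSet_state_pastSigma θs X A θh h1 h _)
    · exact (le_sup_right : MeasurableSpace.comap (X τ) ⊤ ≤ _) _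
        ⟨_, MeasurableSpace.measurableSet_top, rfl⟩
  · exact (le_sup_left : pastSigma θs X A θh t ≤ _) _
      (measurableSet_action_pastSigma θs X A θh h1 h2 _)

theorem sup_comap_le_pastSigma_succ {t : ℕ} (ht : 1 ≤ t) :
    pastSigma θs X A θh t ⊔ MeasurableSpace.comap (X t) ⊤ ≤ pastSigma θs X A θh (t + 1) :=
  sup_le (pastSigma_mono θs X A θh (Nat.le_succ t))
    ((le_sup_left.trans le_sup_left).trans (comap_le_pastSigma θs X A θh ht (Nat.lt_succ_self t)))

end Past

/-! ### One step of a run -/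

namespace IsRBTSDE

variable {n : ℕ} {S : Fin n → Type*} [∀ i, Fintype (S i)] [∀ i, DecidableEq (S i)]
  {Θ : Fin n → Type*} [∀ i, MeasurableSpace (Θ i)] {Ω : Type*} [mΩ : MeasurableSpace Ω]
  {M : Bandit S Θ} {μ : (∀ i, Θ i) → (∀ i, S i) → Fin n → Bool} {Pr : Measure Ω}
  {θs : Ω → ∀ i, Θ i} {X : ℕ → Ω → ∀ i, S i} {A : ℕ → Ω → Fin n → Bool} {θh : ℕ → Ω → ∀ i, Θ i}

theorem measurableSet_state (h : IsRBTSDE M μ Pr θs X A θh) {t : ℕ} (ht : 1 ≤ t)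
    (U : Set (∀ i, S i)) : MeasurableSet (X t ⁻¹' U) := by
  rw [← Set.biUnion_preimage_singleton]
  exact MeasurableSet.biUnion (Set.to_countable U) fun s _ => h.measurable_state t ht s

theorem measurableSet_action (h : IsRBTSDE M μ Pr θs X A θh)
    (hμ : ∀ s, Measurable fun θ => μ θ s) {t : ℕ} (ht : 1 ≤ t) (U : Set (Fin n → Bool)) :
    MeasurableSet (A t ⁻¹' U) := by
  have hA : A t = fun ω => μ (θh t ω) (X t ω) := funext fun ω => h.action t ht ω
  rw [hA]
  exact measurable_apply_of_countable (fun s => h.measurable_state t ht s)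
    (fun s => (hμ s).comp (h.measurable_sample t ht)) (Set.to_countable U).measurableSet

theorem comap_state_le (h : IsRBTSDE M μ Pr θs X A θh) {t : ℕ} (ht : 1 ≤ t) :
    MeasurableSpace.comap (X t) ⊤ ≤ mΩ := by
  rintro _ ⟨U, -, rfl⟩
  exact h.measurableSet_state ht U

theorem pastSigma_le (h : IsRBTSDE M μ Pr θs X A θh) (hμ : ∀ s, Measurable fun θ => μ θ s)
    (t : ℕ) : pastSigma θs X A θh t ≤ mΩ := by
  refine sup_le h.measurable_param.comap_le (iSup₂_le fun τ hτ => sup_le (sup_le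
    (h.comap_state_le hτ.1) ?_) (h.measurable_sample τ hτ.1).comap_le)
  rintro _ ⟨U, -, rfl⟩
  exact h.measurableSet_action hμ hτ.1 U

theorem measurableSet_historyEvent (h : IsRBTSDE M μ Pr θs X A θh)
    (hμ : ∀ s, Measurable fun θ => μ θ s) {t : ℕ} (ht : 1 ≤ t) (x : ℕ → ∀ i, S i)
    (a : ℕ → Fin n → Bool) : MeasurableSet (historyEvent X A t x a) :=
  sup_le (h.pastSigma_le hμ t) (h.comap_state_le ht) _
    (RestlessBandit.measurableSet_historyEvent θs X A θh t x a)

omit [∀ i, DecidableEq (S i)] mΩ in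
theorem measurable_likelihood (t : ℕ) (ht : 1 ≤ t) (s' : ∀ i, S i) :
    Measurable[pastSigma θs X A θh (t + 1)] fun ω => M.jointP (θs ω) (X t ω) (A t ω) s' :=
  measurable_apply_of_countable (mΩ := pastSigma θs X A θh (t + 1))
    (fun s => measurableSet_state_pastSigma θs X A θh ht (Nat.lt_succ_self t) {s})
    (F := fun s ω => M.jointP (θs ω) s (A t ω) s') fun s =>
      measurable_apply_of_countable (mΩ := pastSigma θs X A θh (t + 1))
        (fun b => measurableSet_action_pastSigma θs X A θh ht (Nat.lt_succ_self t) {b})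
        (F := fun b ω => M.jointP (θs ω) s b s') fun b =>
          (M.measurable_jointP s b s').comp (measurable_param_pastSigma θs X A θh (t + 1))

variable [IsProbabilityMeasure Pr]

theorem integrable_of_abs_le {f : Ω → ℝ} (hf : Measurable f) {B : ℝ} (hB : ∀ ω, |f ω| ≤ B) :
    Integrable f Pr :=
  Integrable.of_bound hf.aestronglyMeasurable B (ae_of_all _ hB)

/-- The next state can be integrated out, given the past. -/
theorem integral_next_state (h : IsRBTSDE M μ Pr θs X A θh) (hμ : ∀ s, Measurable fun θ => μ θ s)
    {t : ℕ} (ht : 1 ≤ t) {F : (∀ i, S i) → Ω → ℝ}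
    (hF : ∀ s', Measurable[pastSigma θs X A θh (t + 1)] (F s')) {B : ℝ}
    (hB : ∀ s' ω, |F s' ω| ≤ B) :
    ∫ ω, F (X (t + 1) ω) ω ∂Pr =
      ∫ ω, ∑ s', M.jointP (θs ω) (X t ω) (A t ω) s' * F s' ω ∂Pr := by
  have hm := h.pastSigma_le hμ (t + 1)
  have hind : ∀ s', Measurable ((X (t + 1) ⁻¹' {s'}).indicator fun _ => (1 : ℝ)) := fun s' =>
    measurable_const.indicator (h.measurable_state (t + 1) (by omega) s')
  have hi1 : ∀ s', Integrable ((X (t + 1) ⁻¹' {s'}).indicator fun _ => (1 : ℝ)) Pr := fun s' =>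
    (integrable_const (1 : ℝ)).indicator (h.measurable_state (t + 1) (by omega) s')
  have hi2 : ∀ s', Integrable (F s' * (X (t + 1) ⁻¹' {s'}).indicator fun _ => (1 : ℝ)) Pr :=
    fun s' => (hi1 s').bdd_mul ((hF s').mono hm le_rfl).aestronglyMeasurable
      (ae_of_all _ (hB s'))
  have hL : ∀ s', Measurable fun ω => M.jointP (θs ω) (X t ω) (A t ω) s' := fun s' =>
    (measurable_likelihood t ht s').mono hm le_rfl
  have hpt : (fun ω => F (X (t + 1) ω) ω) = fun ω =>
      ∑ s', (F s' * (X (t + 1) ⁻¹' {s'}).indicator fun _ => (1 : ℝ)) ω := by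
    ext ω
    rw [sum_eq_single (X (t + 1) ω)]
    · simp
    · intro s' _ hs'
      simp [Set.indicator, Ne.symm hs']
    · simp
  rw [hpt, integral_finsetSum _ fun s' _ => hi2 s', integral_finsetSum]
  · refine sum_congr rfl fun s' _ => ?_
    rw [← integral_condExp hm]
    refine integral_congr_ae ?_
    have h1 := condExp_mul_of_stronglyMeasurable_left (μ := Pr) (hF s').stronglyMeasurable
      (hi2 s') (hi1 s')
    filter_upwards [h1, h.dynamics t ht s'] with ω e1 e2
    rw [e1, Pi.mul_apply, e2, mul_comm]
  · intro s' _
    refine integrable_of_abs_le ((hL s').mul ((hF s').mono hm le_rfl)) (B := 1 * B) fun ω => ?_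
    rw [abs_mul]
    refine mul_le_mul ?_ (hB s' ω) (abs_nonneg _) zero_le_one
    rw [abs_of_nonneg (M.jointP_nonneg _ _ _ _)]
    exact M.jointP_le_one _ _ _ _

theorem measure_inter_next_state (h : IsRBTSDE M μ Pr θs X A θh)
    (hμ : ∀ s, Measurable fun θ => μ θ s) {t : ℕ} (ht : 1 ≤ t) {D : Set Ω}
    (hD : MeasurableSet[pastSigma θs X A θh (t + 1)] D) (s' : ∀ i, S i) :
    Pr (D ∩ X (t + 1) ⁻¹' {s'}) =
      ∫⁻ ω in D, ENNReal.ofReal (M.jointP (θs ω) (X t ω) (A t ω) s') ∂Pr := by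
  classical
  have hm := h.pastSigma_le hμ (t + 1)
  have hL : Measurable fun ω => M.jointP (θs ω) (X t ω) (A t ω) s' :=
    (measurable_likelihood t ht s').mono hm le_rfl
  have hbd : ∀ ω, |M.jointP (θs ω) (X t ω) (A t ω) s'| ≤ 1 := fun ω => by
    rw [abs_of_nonneg (M.jointP_nonneg _ _ _ _)]
    exact M.jointP_le_one _ _ _ _
  have key := h.integral_next_state hμ ht
    (F := fun y => if y = s' then D.indicator fun _ => (1 : ℝ) else fun _ => 0)
    (fun y => by
      split_ifs
      · exact measurable_const.indicator hD
      · exact measurable_const) (B := 1) (fun y ω => by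
      split_ifs
      · by_cases hω : ω ∈ D <;> simp [hω]
      · simp)
  have e1 : (fun ω => (if X (t + 1) ω = s' then D.indicator fun _ => (1 : ℝ) else fun _ => 0) ω) =
      (D ∩ X (t + 1) ⁻¹' {s'}).indicator fun _ => (1 : ℝ) := by
    ext ω
    by_cases h1 : X (t + 1) ω = s' <;> by_cases h2 : ω ∈ D <;> simp [Set.indicator, h1, h2]
  have e2 : (fun ω => ∑ y, M.jointP (θs ω) (X t ω) (A t ω) y *
      (if y = s' then D.indicator fun _ => (1 : ℝ) else fun _ => 0) ω) =
      D.indicator fun ω => M.jointP (θs ω) (X t ω) (A t ω) s' := by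
    ext ω
    rw [sum_eq_single s']
    · by_cases h2 : ω ∈ D <;> simp [Set.indicator, h2]
    · intro y _ hy; simp [hy]
    · simp
  rw [e1, e2, integral_indicator (hm _ hD), integral_indicator
    ((hm _ hD).inter (h.measurable_state (t + 1) (by omega) s')), setIntegral_const, smul_eq_mul,
    mul_one] at key
  rw [← ofReal_integral_eq_lintegral_ofReal (integrable_of_abs_le hL hbd).restrict
    (ae_of_all _ fun ω => M.jointP_nonneg _ _ _ _), ← key, ofReal_measureReal]

/-! ### Bayes' rule and posterior sampling -/

variable (M) in
/-- Product over the arms of the posteriors at time `t` along the paths `x` and `a`. -/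
noncomputable def jointPosterior (x : ℕ → ∀ i, S i) (a : ℕ → Fin n → Bool) (t : ℕ) :
    Measure (∀ i, Θ i) :=
  Measure.pi fun i => M.posterior i (fun τ => x τ i) (fun τ => a τ i) t

instance (x : ℕ → ∀ i, S i) (a : ℕ → Fin n → Bool) (t : ℕ) :
    IsFiniteMeasure (jointPosterior M x a t) := by
  unfold jointPosterior; infer_instance

omit [∀ i, DecidableEq (S i)] in
theorem jointPosterior_succ {t : ℕ} (ht : 1 ≤ t) (x : ℕ → ∀ i, S i) (a : ℕ → Fin n → Bool) :
    (∫⁻ θ, ENNReal.ofReal (M.jointP θ (x t) (a t) (x (t + 1))) ∂jointPosterior M x a t) •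
      jointPosterior M x a (t + 1) =
    (jointPosterior M x a t).withDensity fun θ =>
      ENNReal.ofReal (M.jointP θ (x t) (a t) (x (t + 1))) := by
  obtain ⟨t, rfl⟩ := Nat.exists_eq_add_of_le' ht
  unfold jointPosterior
  rw [← M.smul_pi_bayesUpdate]
  rfl

/-- If, given the history up to `t`, the true parameter is independent of the sample and has the
posterior as its distribution, then the same holds for the history up to `t + 1` (and the same
sample): the action is a function of the sample and of the history. -/
theorem bayes_step (h : IsRBTSDE M μ Pr θs X A θh) (hμ : ∀ s, Measurable fun θ => μ θ s)
    {t : ℕ} (ht : 1 ≤ t) {x : ℕ → ∀ i, S i} {a : ℕ → Fin n → Bool}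
    (ih : ∀ B C : Set (∀ i, Θ i), MeasurableSet B → MeasurableSet C →
      Pr (historyEvent X A t x a ∩ θh t ⁻¹' C ∩ θs ⁻¹' B) =
        Pr (historyEvent X A t x a ∩ θh t ⁻¹' C) * jointPosterior M x a t B)
    {B C : Set (∀ i, Θ i)} (hB : MeasurableSet B) (hC : MeasurableSet C) :
    Pr (historyEvent X A (t + 1) x a ∩ θh t ⁻¹' C ∩ θs ⁻¹' B) =
      Pr (historyEvent X A (t + 1) x a ∩ θh t ⁻¹' C) * jointPosterior M x a (t + 1) B := by
  set C' : Set (∀ i, Θ i) := C ∩ (fun θ => μ θ (x t)) ⁻¹' {a t} with hC'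
  have hC'm : MeasurableSet C' := hC.inter (hμ (x t) (Set.to_countable _).measurableSet)
  set E := historyEvent X A t x a ∩ θh t ⁻¹' C' with hE
  have hEA : E = historyEvent X A t x a ∩ A t ⁻¹' {a t} ∩ θh t ⁻¹' C := by
    ext ω
    simp only [hE, hC', Set.mem_inter_iff, Set.mem_preimage, Set.mem_singleton_iff,
      h.action t ht ω]
    constructor
    · rintro ⟨h1, h2, h3⟩
      exact ⟨⟨h1, by rw [h1.1 t ht le_rfl]; exact h3⟩, h2⟩
    · rintro ⟨⟨h1, h3⟩, h2⟩
      exact ⟨h1, h2, by rw [← h1.1 t ht le_rfl]; exact h3⟩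
  have hEm : MeasurableSet[pastSigma θs X A θh (t + 1)] E :=
    (sup_comap_le_pastSigma_succ θs X A θh ht _
      (RestlessBandit.measurableSet_historyEvent θs X A θh t x a)).inter
      (measurable_sample_pastSigma θs X A θh ht (Nat.lt_succ_self t) hC'm)
  have hm := h.pastSigma_le hμ (t + 1)
  set ℓ : (∀ i, Θ i) → ℝ≥0∞ := fun θ => ENNReal.ofReal (M.jointP θ (x t) (a t) (x (t + 1))) with hℓ
  have hℓm : Measurable ℓ := (M.measurable_jointP _ _ _).ennreal_ofReal
  -- on `E`, the law of the true parameter is a multiple of the posterior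
  have hmap : (Pr.restrict E).map θs = Pr E • jointPosterior M x a t := by
    ext U hU
    rw [Measure.map_apply h.measurable_param hU,
      Measure.restrict_apply (h.measurable_param hU), Measure.smul_apply, smul_eq_mul,
      Set.inter_comm]
    exact ih U C' hU hC'm
  have hstep : ∀ U : Set (∀ i, Θ i), MeasurableSet U →
      Pr (historyEvent X A (t + 1) x a ∩ θh t ⁻¹' C ∩ θs ⁻¹' U) =
        Pr E * ((∫⁻ θ, ℓ θ ∂jointPosterior M x a t) * jointPosterior M x a (t + 1) U) := by
    intro U hU
    have e : historyEvent X A (t + 1) x a ∩ θh t ⁻¹' C ∩ θs ⁻¹' U =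
        (E ∩ θs ⁻¹' U) ∩ X (t + 1) ⁻¹' {x (t + 1)} := by
      rw [historyEvent_succ ht, hEA]; ext ω; simp only [Set.mem_inter_iff]; tauto
    have hEU : MeasurableSet[pastSigma θs X A θh (t + 1)] (E ∩ θs ⁻¹' U) :=
      hEm.inter (measurable_param_pastSigma θs X A θh (t + 1) hU)
    rw [e, h.measure_inter_next_state hμ ht hEU]
    have e2 : ∫⁻ ω in E ∩ θs ⁻¹' U, ENNReal.ofReal (M.jointP (θs ω) (X t ω) (A t ω) (x (t + 1)))
        ∂Pr = ∫⁻ ω in E ∩ θs ⁻¹' U, ℓ (θs ω) ∂Pr := by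
      refine setLIntegral_congr_fun (hm _ hEU) fun ω hω => ?_
      have h1 := hω.1
      rw [hEA] at h1
      have h2 : X t ω = x t := h1.1.1.1 t ht le_rfl
      have h3 : A t ω = a t := h1.1.2
      simp only [hℓ, h2, h3]
    rw [e2, Set.inter_comm, ← Measure.restrict_restrict (h.measurable_param hU),
      ← setLIntegral_map hU hℓm h.measurable_param, hmap, Measure.restrict_smul,
      lintegral_smul_measure, smul_eq_mul, ← withDensity_apply _ hU,
      ← jointPosterior_succ ht, Measure.smul_apply, smul_eq_mul]
  have huniv : Pr (historyEvent X A (t + 1) x a ∩ θh t ⁻¹' C) =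
      Pr E * ∫⁻ θ, ℓ θ ∂jointPosterior M x a t := by
    have h1 := hstep Set.univ MeasurableSet.univ
    have h2 := congrArg (fun ν => ν Set.univ) (jointPosterior_succ (M := M) ht x a)
    simp only [Measure.smul_apply, smul_eq_mul, withDensity_apply _ MeasurableSet.univ,
      Measure.restrict_univ] at h2
    rw [Set.preimage_univ, Set.inter_univ, h2] at h1
    exact h1
  rw [hstep B hB, huniv, mul_assoc]

theorem measure_sample_inter (h : IsRBTSDE M μ Pr θs X A θh)
    (hμ : ∀ s, Measurable fun θ => μ θ s) {t : ℕ} (ht : 1 ≤ t) {x : ℕ → ∀ i, S i}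
    {a : ℕ → Fin n → Bool} (hstart : EpisodeStart x a t)
    {B C : Set (∀ i, Θ i)} (hB : MeasurableSet B) (hC : MeasurableSet C) :
    Pr (historyEvent X A t x a ∩ θh t ⁻¹' C ∩ θs ⁻¹' B) =
      Pr (historyEvent X A t x a ∩ θs ⁻¹' B) * jointPosterior M x a t C := by
  have hm : pastSigma θs X A θh t ⊔ MeasurableSpace.comap (X t) ⊤ ≤ mΩ :=
    sup_le (h.pastSigma_le hμ t) (h.comap_state_le ht)
  have hD : MeasurableSet[pastSigma θs X A θh t ⊔ MeasurableSpace.comap (X t) ⊤]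
      (historyEvent X A t x a ∩ θs ⁻¹' B) :=
    (RestlessBandit.measurableSet_historyEvent θs X A θh t x a).inter
      ((le_sup_left : pastSigma θs X A θh t ≤ _) _ (measurable_param_pastSigma θs X A θh t hB))
  have hCm : MeasurableSet (θh t ⁻¹' C) := h.measurable_sample t ht hC
  have h1 := setIntegral_condExp (μ := Pr) hm
    ((integrable_const (1 : ℝ)).indicator hCm) hD
  have h2 : ∫ ω in historyEvent X A t x a ∩ θs ⁻¹' B, (Pr[(θh t ⁻¹' C).indicator fun _ => (1 : ℝ) |
      pastSigma θs X A θh t ⊔ MeasurableSpace.comap (X t) ⊤]) ω ∂Pr =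
      ∫ ω in historyEvent X A t x a ∩ θs ⁻¹' B, (jointPosterior M x a t).real C ∂Pr := by
    refine setIntegral_congr_ae (hm _ hD) ?_
    filter_upwards [h.sample t ht C hC] with ω hω hωD
    have hs : schedule (fun τ => X τ ω) (fun τ => A τ ω) t = schedule x a t :=
      schedule_congr fun τ h1 h2 => ⟨hωD.1.1 τ h1 h2.le, hωD.1.2 τ h1 h2⟩
    rw [hω (by unfold EpisodeStart; rw [hs]; exact hstart)]
    unfold jointPosterior
    congr 2
    ext1 i
    exact M.posterior_congr i (fun τ h1 h2 => by rw [hωD.1.1 τ h1 h2])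
      (fun τ h1 h2 => by rw [hωD.1.2 τ h1 h2])
  rw [h2, setIntegral_const, setIntegral_indicator hCm, setIntegral_const, smul_eq_mul, smul_eq_mul,
    mul_one, measureReal_def, measureReal_def, measureReal_def, ← ENNReal.toReal_mul,
    ENNReal.toReal_eq_toReal_iff' (ENNReal.mul_ne_top (measure_ne_top _ _) (measure_ne_top _ _))
      (measure_ne_top _ _)] at h1
  rw [h1]
  congr 1
  ext ω; simp only [Set.mem_inter_iff]; tauto

/-- **Bayes' rule.** Given the history up to time `t`, the true parameter has the posterior as its
distribution and is independent of the parameter in use. -/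
theorem bayes (h : IsRBTSDE M μ Pr θs X A θh) (hμ : ∀ s, Measurable fun θ => μ θ s)
    {t : ℕ} (ht : 1 ≤ t) (x : ℕ → ∀ i, S i) (a : ℕ → Fin n → Bool)
    {B C : Set (∀ i, Θ i)} (hB : MeasurableSet B) (hC : MeasurableSet C) :
    Pr (historyEvent X A t x a ∩ θh t ⁻¹' C ∩ θs ⁻¹' B) =
      Pr (historyEvent X A t x a ∩ θh t ⁻¹' C) * jointPosterior M x a t B := by
  -- at the start of an episode, it suffices to know the law of the true parameter
  have start : ∀ t, 1 ≤ t → EpisodeStart x a t → (∀ B : Set (∀ i, Θ i), MeasurableSet B →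
      Pr (historyEvent X A t x a ∩ θs ⁻¹' B) =
        Pr (historyEvent X A t x a) * jointPosterior M x a t B) →
      ∀ B C : Set (∀ i, Θ i), MeasurableSet B → MeasurableSet C →
      Pr (historyEvent X A t x a ∩ θh t ⁻¹' C ∩ θs ⁻¹' B) =
        Pr (historyEvent X A t x a ∩ θh t ⁻¹' C) * jointPosterior M x a t B := by
    intro t ht hs hlaw B C hB hC
    have h1 := h.measure_sample_inter hμ ht hs MeasurableSet.univ hC
    rw [Set.preimage_univ, Set.inter_univ, Set.inter_univ] at h1
    rw [h.measure_sample_inter hμ ht hs hB hC, hlaw B hB, h1, mul_right_comm]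
  induction t, ht using Nat.le_induction generalizing B C with
  | base =>
    refine start 1 le_rfl episodeStart_one (fun B hB => ?_) B C hB hC
    have e : historyEvent X A 1 x a = X 1 ⁻¹' {x 1} := by
      ext ω
      simp only [historyEvent, Set.mem_ofPred_eq, Set.mem_preimage, Set.mem_singleton_iff]
      constructor
      · exact fun h => h.1 1 le_rfl le_rfl
      · refine fun h => ⟨fun τ h1 h2 => ?_, fun τ h1 h2 => absurd h2 (by omega)⟩
        obtain rfl : τ = 1 := le_antisymm h2 h1
        exact h
    have := M.prior_prob
    have h1 := h.init Set.univ MeasurableSet.univ (x 1)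
    rw [Set.preimage_univ, Set.univ_inter, measure_univ, one_mul] at h1
    rw [e, Set.inter_comm, h.init B hB, h1, mul_comm]
    rfl
  | succ t ht ih =>
    have step := fun (B C : Set (∀ i, Θ i)) (hB : MeasurableSet B) (hC : MeasurableSet C) =>
      h.bayes_step hμ ht (fun B C hB hC => ih hB hC) hB hC
    by_cases hs : EpisodeStart x a (t + 1)
    · refine start (t + 1) (by omega) hs (fun B hB => ?_) B C hB hC
      have := step B Set.univ hB MeasurableSet.univ
      rwa [Set.preimage_univ, Set.inter_univ] at this
    · have e : historyEvent X A (t + 1) x a ∩ θh (t + 1) ⁻¹' C =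
          historyEvent X A (t + 1) x a ∩ θh t ⁻¹' C := by
        ext ω
        simp only [Set.mem_inter_iff, Set.mem_preimage]
        refine and_congr_right fun hω => ?_
        have hsch : schedule (fun τ => X τ ω) (fun τ => A τ ω) (t + 1) = schedule x a (t + 1) :=
          schedule_congr fun τ h1 h2 => ⟨hω.1 τ h1 h2.le, hω.2 τ h1 h2⟩
        rw [h.keep (t + 1) (by omega) ω (by unfold EpisodeStart; rw [hsch]; exact hs),
          Nat.add_sub_cancel]
      rw [e]
      exact step B C hB hC

/-- At the start of an episode, given the history, the sampled parameter and the true one have the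
same distribution. -/
theorem map_sample_eq_map_param (h : IsRBTSDE M μ Pr θs X A θh)
    (hμ : ∀ s, Measurable fun θ => μ θ s) {t : ℕ} (ht : 1 ≤ t) {x : ℕ → ∀ i, S i}
    {a : ℕ → Fin n → Bool} (hstart : EpisodeStart x a t) :
    (Pr.restrict (historyEvent X A t x a)).map (θh t) =
      (Pr.restrict (historyEvent X A t x a)).map θs := by
  ext C hC
  rw [Measure.map_apply (h.measurable_sample t ht) hC, Measure.map_apply h.measurable_param hC,
    Measure.restrict_apply (h.measurable_sample t ht hC),
    Measure.restrict_apply (h.measurable_param hC), Set.inter_comm, Set.inter_comm (θs ⁻¹' C)]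
  have h1 := h.measure_sample_inter hμ ht hstart MeasurableSet.univ hC
  have h2 := h.bayes hμ ht x a hC MeasurableSet.univ
  simp only [Set.preimage_univ, Set.inter_univ] at h1 h2
  rw [h1, h2]

end IsRBTSDE

/-! ### Functions of the history -/

section DependsOnHistory

variable {n : ℕ} {S : Fin n → Type*} {β : Type*}

/-- `Φ x a` only depends on the states of the path `x` at the times `1, …, t` and on the actions of
the path `a` at the times `1, …, t - 1`. -/
def DependsOnHistory (t : ℕ) (Φ : (ℕ → ∀ i, S i) → (ℕ → Fin n → Bool) → β) : Prop :=
  ∀ x a x' a', (∀ τ, 1 ≤ τ → τ ≤ t → x τ = x' τ) → (∀ τ, 1 ≤ τ → τ < t → a τ = a' τ) →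
    Φ x a = Φ x' a'

/-- The restriction of a pair of paths to the history at time `t`, as an element of a finite type.
The entries with index `0`, and the last action, are not part of the history; they are filled with
redundant values. -/
def historyCode (t : ℕ) (x : ℕ → ∀ i, S i) (a : ℕ → Fin n → Bool) :
    (Fin (t + 1) → ∀ i, S i) × (Fin (t + 1) → Fin n → Bool) :=
  (fun τ => x (max τ 1), fun τ => if 1 ≤ (τ : ℕ) ∧ (τ : ℕ) < t then a τ else fun _ => false)

theorem historyCode_eq_iff {t : ℕ} (ht : 1 ≤ t) {x x' : ℕ → ∀ i, S i}
    {a a' : ℕ → Fin n → Bool} : historyCode t x a = historyCode t x' a' ↔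
      (∀ τ, 1 ≤ τ → τ ≤ t → x τ = x' τ) ∧ ∀ τ, 1 ≤ τ → τ < t → a τ = a' τ := by
  rw [historyCode, historyCode, Prod.mk_inj, funext_iff, funext_iff]
  constructor
  · rintro ⟨h1, h2⟩
    refine ⟨fun τ a b => ?_, fun τ a b => ?_⟩
    · simpa [max_eq_left a] using h1 ⟨τ, by omega⟩
    · simpa [a, b] using h2 ⟨τ, by omega⟩
  · rintro ⟨h1, h2⟩
    refine ⟨fun τ => h1 _ (le_max_right _ _) (max_le (by omega) ht), fun τ => ?_⟩
    split_ifs with h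
    · exact h2 τ h.1 h.2
    · rfl

theorem historyCode_preimage {Ω : Type*} (X : ℕ → Ω → ∀ i, S i) (A : ℕ → Ω → Fin n → Bool)
    {t : ℕ} (ht : 1 ≤ t) (x : ℕ → ∀ i, S i) (a : ℕ → Fin n → Bool) :
    (fun ω => historyCode t (fun τ => X τ ω) (fun τ => A τ ω)) ⁻¹' {historyCode t x a} =
      historyEvent X A t x a := by
  ext ω
  simp only [Set.mem_preimage, Set.mem_singleton_iff, historyCode_eq_iff ht, historyEvent,
    Set.mem_ofPred_eq]

theorem DependsOnHistory.measurable [∀ i, Finite (S i)] {Ω : Type*} {mΩ : MeasurableSpace Ω}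
    [MeasurableSpace β] {X : ℕ → Ω → ∀ i, S i} {A : ℕ → Ω → Fin n → Bool} {t : ℕ} (ht : 1 ≤ t)
    (hE : ∀ x a, MeasurableSet (historyEvent X A t x a))
    {Φ : (ℕ → ∀ i, S i) → (ℕ → Fin n → Bool) → Ω → β} (hΦ : DependsOnHistory t Φ)
    (hm : ∀ x a, Measurable (Φ x a)) :
    Measurable fun ω => Φ (fun τ => X τ ω) (fun τ => A τ ω) ω := by
  intro U hU
  -- the fibre over a code is a history event or empty
  have : (fun ω => Φ (fun τ => X τ ω) (fun τ => A τ ω) ω) ⁻¹' U =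
      ⋃ k ∈ Set.range (fun ω => historyCode t (fun τ => X τ ω) (fun τ => A τ ω)),
        (fun ω => Φ (fun τ => X τ ω) (fun τ => A τ ω) ω) ⁻¹' U ∩
          (fun ω => historyCode t (fun τ => X τ ω) (fun τ => A τ ω)) ⁻¹' {k} := by
    ext ω
    simp only [Set.mem_preimage, Set.mem_iUnion, Set.mem_inter_iff, Set.mem_singleton_iff]
    exact ⟨fun h => ⟨_, ⟨ω, rfl⟩, h, rfl⟩, fun ⟨_, _, h, _⟩ => h⟩
  rw [this]
  refine MeasurableSet.biUnion (Set.to_countable _) ?_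
  rintro _ ⟨ω₀, rfl⟩
  rw [historyCode_preimage X A ht]
  have e : (fun ω => Φ (fun τ => X τ ω) (fun τ => A τ ω) ω) ⁻¹' U ∩
      historyEvent X A t (fun τ => X τ ω₀) (fun τ => A τ ω₀) =
      Φ (fun τ => X τ ω₀) (fun τ => A τ ω₀) ⁻¹' U ∩
        historyEvent X A t (fun τ => X τ ω₀) (fun τ => A τ ω₀) := by
    ext ω
    simp only [Set.mem_inter_iff, Set.mem_preimage]
    refine and_congr_left fun hω => ?_
    rw [hΦ _ _ _ _ hω.1 hω.2]
  rw [e]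
  exact (hm _ _ hU).inter (hE _ _)

variable [∀ i, DecidableEq (S i)]

theorem dependsOnHistory_schedule (t : ℕ) :
    DependsOnHistory t fun (x : ℕ → ∀ i, S i) a => schedule x a t :=
  fun _ _ _ _ h1 h2 => schedule_congr fun τ a b => ⟨h1 τ a b.le, h2 τ a b⟩

theorem dependsOnHistory_episodeStart (t : ℕ) :
    DependsOnHistory t fun (x : ℕ → ∀ i, S i) a => EpisodeStart x a t := by
  intro x a x' a' h1 h2
  have e : schedule x a t = schedule x' a' t := dependsOnHistory_schedule t x a x' a' h1 h2
  simp only [EpisodeStart, e]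

end DependsOnHistory

namespace IsRBTSDE

variable {n : ℕ} {S : Fin n → Type*} [∀ i, Fintype (S i)] [∀ i, DecidableEq (S i)]
  {Θ : Fin n → Type*} [∀ i, MeasurableSpace (Θ i)] {Ω : Type*} [mΩ : MeasurableSpace Ω]
  {M : Bandit S Θ} {μ : (∀ i, Θ i) → (∀ i, S i) → Fin n → Bool} {Pr : Measure Ω}
  {θs : Ω → ∀ i, Θ i} {X : ℕ → Ω → ∀ i, S i} {A : ℕ → Ω → Fin n → Bool} {θh : ℕ → Ω → ∀ i, Θ i}

theorem measurable_of_history (h : IsRBTSDE M μ Pr θs X A θh)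
    (hμ : ∀ s, Measurable fun θ => μ θ s) {t : ℕ} (ht : 1 ≤ t)
    {Φ : (ℕ → ∀ i, S i) → (ℕ → Fin n → Bool) → (∀ i, Θ i) → ℝ} (hΦ : DependsOnHistory t Φ)
    (hm : ∀ x a, Measurable (Φ x a)) {ϑ : Ω → ∀ i, Θ i} (hϑ : Measurable ϑ) :
    Measurable fun ω => Φ (fun τ => X τ ω) (fun τ => A τ ω) (ϑ ω) :=
  DependsOnHistory.measurable ht (fun x a => h.measurableSet_historyEvent hμ ht x a)
    (Φ := fun x a ω => Φ x a (ϑ ω))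
    (fun x a x' a' h1 h2 => by
      funext ω
      exact congrFun (hΦ x a x' a' h1 h2) (ϑ ω)) fun x a => (hm x a).comp hϑ

variable [IsProbabilityMeasure Pr]

/-- **The posterior sampling identity**: in the expectation of a function of the history at the
start of an episode, the sampled parameter can be replaced by the true one. -/
theorem integral_sample_eq (h : IsRBTSDE M μ Pr θs X A θh) (hμ : ∀ s, Measurable fun θ => μ θ s)
    {t : ℕ} (ht : 1 ≤ t) {Φ : (ℕ → ∀ i, S i) → (ℕ → Fin n → Bool) → (∀ i, Θ i) → ℝ}
    (hΦ : DependsOnHistory t Φ) (hm : ∀ x a, Measurable (Φ x a))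
    (hstart : ∀ x a θ, ¬ EpisodeStart x a t → Φ x a θ = 0) {B : ℝ} (hB : ∀ x a θ, |Φ x a θ| ≤ B) :
    ∫ ω, Φ (fun τ => X τ ω) (fun τ => A τ ω) (θh t ω) ∂Pr =
      ∫ ω, Φ (fun τ => X τ ω) (fun τ => A τ ω) (θs ω) ∂Pr := by
  classical
  set H := fun ω => historyCode t (fun τ => X τ ω) (fun τ => A τ ω) with hH
  have hfib : ∀ k, MeasurableSet (H ⁻¹' {k}) := by
    intro k
    by_cases hk : ∃ ω₀, H ω₀ = k
    · obtain ⟨ω₀, rfl⟩ := hk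
      rw [hH, historyCode_preimage X A ht]
      exact h.measurableSet_historyEvent hμ ht _ _
    · rw [Set.preimage_singleton_eq_empty.2 fun ⟨ω₀, h0⟩ => hk ⟨ω₀, h0⟩]
      exact MeasurableSet.empty
  have hdec : ∀ {ϑ : Ω → ∀ i, Θ i}, Measurable ϑ →
      ∫ ω, Φ (fun τ => X τ ω) (fun τ => A τ ω) (ϑ ω) ∂Pr =
        ∑ k, ∫ ω in H ⁻¹' {k}, Φ (fun τ => X τ ω) (fun τ => A τ ω) (ϑ ω) ∂Pr := by
    intro ϑ hϑ
    have hint : Integrable (fun ω => Φ (fun τ => X τ ω) (fun τ => A τ ω) (ϑ ω)) Pr :=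
      integrable_of_abs_le (h.measurable_of_history hμ ht hΦ hm hϑ) fun ω => hB _ _ _
    simp_rw [← integral_indicator (hfib _)]
    rw [← integral_finsetSum _ fun k _ => hint.indicator (hfib k)]
    congr 1
    ext ω
    rw [sum_eq_single (H ω)]
    · rw [Set.indicator_of_mem (by simp)]
    · intro k _ hk
      exact Set.indicator_of_notMem (fun hω : ω ∈ H ⁻¹' {k} => hk (Eq.symm hω)) _
    · simp
  rw [hdec (h.measurable_sample t ht), hdec h.measurable_param]
  refine sum_congr rfl fun k _ => ?_
  by_cases hk : ∃ ω₀, H ω₀ = k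
  swap
  · rw [Set.preimage_singleton_eq_empty.2 fun ⟨ω₀, h0⟩ => hk ⟨ω₀, h0⟩]
    simp
  obtain ⟨ω₀, rfl⟩ := hk
  have hE := historyCode_preimage X A ht (fun τ => X τ ω₀) (fun τ => A τ ω₀)
  rw [hH, hE]
  have hEm := h.measurableSet_historyEvent hμ ht (fun τ => X τ ω₀) (fun τ => A τ ω₀)
  have hconst : ∀ ϑ : Ω → ∀ i, Θ i,
      ∫ ω in historyEvent X A t (fun τ => X τ ω₀) (fun τ => A τ ω₀),
        Φ (fun τ => X τ ω) (fun τ => A τ ω) (ϑ ω) ∂Pr =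
      ∫ ω in historyEvent X A t (fun τ => X τ ω₀) (fun τ => A τ ω₀),
        Φ (fun τ => X τ ω₀) (fun τ => A τ ω₀) (ϑ ω) ∂Pr := fun ϑ =>
    setIntegral_congr_fun hEm fun ω hω => congrFun (hΦ _ _ _ _ hω.1 hω.2) (ϑ ω)
  rw [hconst, hconst]
  by_cases hs : EpisodeStart (fun τ => X τ ω₀) (fun τ => A τ ω₀) t
  · have hm0 := hm (fun τ => X τ ω₀) (fun τ => A τ ω₀)
    rw [← integral_map (h.measurable_sample t ht).aemeasurable hm0.aestronglyMeasurable,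
      ← integral_map h.measurable_param.aemeasurable hm0.aestronglyMeasurable,
      h.map_sample_eq_map_param hμ ht hs]
  · simp [hstart _ _ _ hs]

end IsRBTSDE

/-! ### A measurable choice of the bias -/

section MeasurableBias

variable {X Θ : Type*} [Fintype X] [DecidableEq X] [MeasurableSpace Θ] {K : Θ → Matrix X X ℝ}
  {ρ : Θ → X → ℝ}

theorem measurable_pow_mulVec (hKm : ∀ x y, Measurable fun θ => K θ x y)
    (hρm : ∀ x, Measurable fun θ => ρ θ x) (t : ℕ) (x : X) :
    Measurable fun θ => ((K θ) ^ t).mulVec (ρ θ) x := by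
  induction t generalizing x with
  | zero => simpa using hρm x
  | succ t ih =>
    simp only [pow_succ', ← Matrix.mulVec_mulVec]
    exact Finset.measurable_sum _ fun y _ => (hKm x y).mul (ih y)

theorem measurable_averageReward (hKm : ∀ x y, Measurable fun θ => K θ x y)
    (hρm : ∀ x, Measurable fun θ => ρ θ x) (x : X) :
    Measurable fun θ => averageReward (K θ) (ρ θ) x :=
  Measurable.liminf fun _ =>
    (Finset.measurable_sum _ fun t _ => measurable_pow_mulVec hKm hρm t x).div_const _

/-- Solutions of the Bellman equations can be normalized to have minimum `0`; they are then unique,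
hence measurable in the parameter. -/
theorem exists_measurable_bias [Nonempty X] {J : Θ → ℝ} {C l : ℝ}
    (hKm : ∀ x y, Measurable fun θ => K θ x y) (hρm : ∀ x, Measurable fun θ => ρ θ x)
    (hK : ∀ θ x, ∑ z, K θ x z = 1) (hρ0 : ∀ θ x, 0 ≤ ρ θ x) (hρ : ∀ θ x, ρ θ x ≤ C)
    (hl : l < 1) (hKl : ∀ θ, ergodicityCoeff (K θ) ≤ l)
    (hV : ∀ θ, ∃ V : X → ℝ, ∀ x, J θ + V x = ρ θ x + (K θ).mulVec V x) :
    ∃ V : Θ → X → ℝ, (∀ x, Measurable fun θ => V θ x) ∧ (∀ θ x, 0 ≤ V θ x) ∧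
      (∀ θ x, V θ x ≤ C / (1 - l)) ∧
      ∀ θ x, J θ + V θ x = ρ θ x + (K θ).mulVec (V θ) x := by
  choose V hV using hV
  obtain ⟨x₀⟩ := ‹Nonempty X›
  have : Nonempty X := ⟨x₀⟩
  have hmin : ∀ θ, ∃ y, ⨅ z, (V θ z - V θ x₀) = V θ y - V θ x₀ ∧ ∀ z, V θ y ≤ V θ z := by
    intro θ
    obtain ⟨y, hy⟩ := Finite.exists_min (V θ)
    refine ⟨y, le_antisymm (ciInf_le (Set.finite_range _).bddBelow y) (le_ciInf fun z => ?_), hy⟩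
    linarith [hy z]
  have hdiff : ∀ x, Measurable fun θ => V θ x - V θ x₀ := fun x =>
    measurable_of_tendsto_metrizable (f := fun N θ =>
      ∑ t ∈ range N, ((K θ) ^ t).mulVec (ρ θ) x - ∑ t ∈ range N, ((K θ) ^ t).mulVec (ρ θ) x₀)
      (fun N => (Finset.measurable_sum _ fun t _ => measurable_pow_mulVec hKm hρm t x).sub
        (Finset.measurable_sum _ fun t _ => measurable_pow_mulVec hKm hρm t x₀))
      (tendsto_pi_nhds.2 fun θ => tendsto_sum_pow_sub (hK θ) (hV θ) hl (hKl θ) x x₀)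
  refine ⟨fun θ x => (V θ x - V θ x₀) - ⨅ z, (V θ z - V θ x₀),
    fun x => (hdiff x).sub (Measurable.iInf hdiff), fun θ x => ?_, fun θ x => ?_, fun θ x => ?_⟩
  · obtain ⟨y, h1, h2⟩ := hmin θ
    linarith [h2 x]
  · obtain ⟨y, h1, -⟩ := hmin θ
    have := bellman_span_le (hK θ) (hV θ) (hρ0 θ) (hρ θ) hl (hKl θ) x y
    linarith
  · obtain ⟨y, h1, -⟩ := hmin θ
    have e : (fun x => (V θ x - V θ x₀) - ⨅ z, (V θ z - V θ x₀)) =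
        V θ - fun _ => V θ y := by
      ext z; rw [h1]; simp
    have e2 : (K θ).mulVec (fun _ => V θ y) x = V θ y := by
      simp only [Matrix.mulVec, dotProduct, ← sum_mul, hK, one_mul]
    show J θ + ((V θ x - V θ x₀) - ⨅ z, (V θ z - V θ x₀)) = ρ θ x +
      (K θ).mulVec (fun x => (V θ x - V θ x₀) - ⨅ z, (V θ z - V θ x₀)) x
    rw [e, Matrix.mulVec_sub, Pi.sub_apply, e2, h1]
    linarith [hV θ x]

end MeasurableBias

/-! ### Concentration of the empirical transition probabilities -/

/-- Hoeffding's lemma for a probability vector and a function with values in `[-1, 1]`. -/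
theorem sum_mul_exp_sub_mean_le {Y : Type*} [Fintype Y] {p e : Y → ℝ} (hp0 : ∀ y, 0 ≤ p y)
    (hp : ∑ y, p y = 1) (he : ∀ y, |e y| ≤ 1) (η : ℝ) :
    ∑ y, p y * Real.exp (η * (e y - ∑ z, p z * e z)) ≤ Real.exp (η ^ 2 / 2) := by
  let _ : MeasurableSpace Y := ⊤
  let q : PMF Y := PMF.ofFintype (fun y => ENNReal.ofReal (p y)) (by
    rw [← ENNReal.ofReal_sum_of_nonneg fun y _ => hp0 y, hp, ENNReal.ofReal_one])
  have hint : ∀ f : Y → ℝ, ∫ y, f y ∂q.toMeasure = ∑ y, p y * f y := fun f => by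
    rw [PMF.integral_eq_sum]
    refine sum_congr rfl fun y _ => ?_
    rw [smul_eq_mul, PMF.ofFintype_apply, ENNReal.toReal_ofReal (hp0 y)]
  have h := (hasSubgaussianMGF_of_mem_Icc (μ := q.toMeasure) (X := e) (a := -1) (b := 1)
    (measurable_from_top).aemeasurable (ae_of_all _ fun y => abs_le.1 (he y))).mgf_le η
  rw [mgf, hint, hint] at h
  refine h.trans (Real.exp_le_exp.2 (le_of_eq ?_))
  norm_num

section Transitions

variable {Y : Type*} [DecidableEq Y]

/-- Number of transitions to `y` from the state-action pair `(x, u)` that were observed up to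
time `t`, the transition from time `t - 1` to time `t` included. -/
def transitions (s : ℕ → Y) (a : ℕ → Bool) (t : ℕ) (x : Y) (u : Bool) (y : Y) : ℕ :=
  #{τ ∈ Ico 1 t | (s τ = x ∧ a τ = u) ∧ s (τ + 1) = y}

variable (s : ℕ → Y) (a : ℕ → Bool)

theorem transitions_succ {t : ℕ} (ht : 1 ≤ t) (x : Y) (u : Bool) (y : Y) :
    transitions s a (t + 1) x u y =
      transitions s a t x u y + if (s t = x ∧ a t = u) ∧ s (t + 1) = y then 1 else 0 := by
  unfold transitions
  rw [Nat.Ico_succ_right_eq_insert_Ico ht, filter_insert]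
  split_ifs
  · rw [card_insert_of_notMem (by simp)]
  · rfl

theorem transitions_le (t : ℕ) (x : Y) (u : Bool) (y : Y) : transitions s a t x u y ≤ t :=
  (card_filter_le _ _).trans (by simp)

variable {s a} in
theorem transitions_congr {s' : ℕ → Y} {a' : ℕ → Bool} {t : ℕ}
    (hs : ∀ τ, 1 ≤ τ → τ ≤ t → s τ = s' τ) (ha : ∀ τ, 1 ≤ τ → τ < t → a τ = a' τ)
    (x : Y) (u : Bool) (y : Y) : transitions s a t x u y = transitions s' a' t x u y := by
  unfold transitions
  refine congrArg card (filter_congr fun τ hτ => ?_)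
  rw [mem_Ico] at hτ
  rw [hs τ hτ.1 hτ.2.le, ha τ hτ.1 hτ.2, hs (τ + 1) (by omega) hτ.2]

end Transitions

namespace Bandit

variable {n : ℕ} {S : Fin n → Type*} [∀ i, Fintype (S i)] [∀ i, DecidableEq (S i)]
  {Θ : Fin n → Type*} [∀ i, MeasurableSpace (Θ i)] (M : Bandit S Θ)

/-- Difference between the number of observed transitions from `(x, u)` to `y` and the number
expected in the model `θ`. -/
def deviation (i : Fin n) (s : ℕ → S i) (a : ℕ → Bool) (t : ℕ) (x : S i) (u : Bool) (θ : Θ i)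
    (y : S i) : ℝ :=
  transitions s a t x u y - visits s a t x u * M.P i θ x u y

/-- The parameter `θ` is outside the confidence set at level `L`: for some state-action pair, the
`ℓ¹` distance between its transition probabilities and the empirical ones at time `t` is more than
`√(2 L / N)`, where `N` is the number of visits. -/
def Implausible (i : Fin n) (L : ℝ) (s : ℕ → S i) (a : ℕ → Bool) (t : ℕ) (θ : Θ i) : Prop :=
  ∃ (x : S i) (u : Bool), √(2 * L * visits s a t x u) < ∑ y, |M.deviation i s a t x u θ y|

variable (i : Fin n) (s : ℕ → S i) (a : ℕ → Bool) (t : ℕ) (x : S i) (u : Bool)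

theorem abs_deviation_le (θ : Θ i) (y : S i) : |M.deviation i s a t x u θ y| ≤ t := by
  have h1 : (transitions s a t x u y : ℝ) ≤ t := by exact_mod_cast transitions_le s a t x u y
  have h2 : (visits s a t x u : ℝ) ≤ t := by
    exact_mod_cast (visits_le s a t x u).trans (Nat.sub_le t 1)
  have h3 := M.P_nonneg i θ x u y
  have h4 := M.P_le_one i θ x u y
  have h5 : (visits s a t x u : ℝ) * M.P i θ x u y ≤ t := by
    nlinarith [Nat.cast_nonneg (α := ℝ) (visits s a t x u)]
  have h6 : 0 ≤ (visits s a t x u : ℝ) * M.P i θ x u y := by positivity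
  have h7 : (0 : ℝ) ≤ transitions s a t x u y := Nat.cast_nonneg _
  unfold deviation
  rw [abs_le]
  constructor <;> linarith

theorem measurable_deviation (y : S i) : Measurable fun θ => M.deviation i s a t x u θ y :=
  measurable_const.sub (measurable_const.mul (M.P_measurable i x u y))

variable {i s a t} in
theorem deviation_congr {s' : ℕ → S i} {a' : ℕ → Bool}
    (hs : ∀ τ, 1 ≤ τ → τ ≤ t → s τ = s' τ) (ha : ∀ τ, 1 ≤ τ → τ < t → a τ = a' τ) (θ : Θ i)
    (y : S i) : M.deviation i s a t x u θ y = M.deviation i s' a' t x u θ y := by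
  unfold deviation
  rw [transitions_congr hs ha, visits_congr fun τ h1 h2 => ⟨hs τ h1 h2.le, ha τ h1 h2⟩]

theorem measurableSet_implausible (L : ℝ) : MeasurableSet {θ | M.Implausible i L s a t θ} := by
  have : {θ | M.Implausible i L s a t θ} = ⋃ x, ⋃ u,
      {θ | √(2 * L * visits s a t x u) < ∑ y, |M.deviation i s a t x u θ y|} := by
    ext θ; simp [Implausible]
  rw [this]
  refine MeasurableSet.iUnion fun x => MeasurableSet.iUnion fun u => ?_
  exact measurableSet_lt measurable_const
    (Finset.measurable_sum _ fun y _ => (M.measurable_deviation i s a t x u y).abs)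

variable {i s a t} in
theorem implausible_congr {s' : ℕ → S i} {a' : ℕ → Bool} (L : ℝ)
    (hs : ∀ τ, 1 ≤ τ → τ ≤ t → s τ = s' τ) (ha : ∀ τ, 1 ≤ τ → τ < t → a τ = a' τ) (θ : Θ i) :
    M.Implausible i L s a t θ ↔ M.Implausible i L s' a' t θ := by
  unfold Implausible
  simp only [M.deviation_congr _ _ hs ha,
    visits_congr fun τ h1 h2 => ⟨hs τ h1 (le_of_lt h2), ha τ h1 h2⟩]

omit [∀ i, DecidableEq (S i)] in
theorem sum_abs_P_sub_le_two (θ θ' : Θ i) : ∑ y, |M.P i θ x u y - M.P i θ' x u y| ≤ 2 := by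
  calc ∑ y, |M.P i θ x u y - M.P i θ' x u y| ≤ ∑ y, (M.P i θ x u y + M.P i θ' x u y) :=
        sum_le_sum fun y _ => by
          rw [abs_le]
          have := M.P_nonneg i θ x u y
          have := M.P_nonneg i θ' x u y
          constructor <;> linarith
    _ = 2 := by rw [sum_add_distrib, M.P_sum, M.P_sum]; norm_num

theorem sum_abs_P_sub_le {L : ℝ} (hL : 1 ≤ 2 * L) {θ θ' : Θ i}
    (h : ¬ M.Implausible i L s a t θ) (h' : ¬ M.Implausible i L s a t θ') :
    ∑ y, |M.P i θ x u y - M.P i θ' x u y| ≤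
      2 * √(2 * L) * (1 / √(max 1 (visits s a t x u : ℝ))) := by
  rcases Nat.eq_zero_or_pos (visits s a t x u) with h0 | h0
  · have h1 : (1 : ℝ) ≤ √(2 * L) := Real.one_le_sqrt.2 hL
    rw [h0, Nat.cast_zero, max_eq_left zero_le_one, Real.sqrt_one]
    linarith [M.sum_abs_P_sub_le_two i x u θ θ']
  · unfold Implausible at h h'
    push Not at h h'
    have h1 := h x u
    have h2 := h' x u
    set N : ℝ := (visits s a t x u : ℝ) with hN
    have hN1 : 1 ≤ N := by rw [hN]; exact_mod_cast h0
    have hsq : 0 < √N := Real.sqrt_pos.2 (by linarith)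
    have hNN : √N * √N = N := Real.mul_self_sqrt (by linarith)
    have h3 : N * ∑ y, |M.P i θ x u y - M.P i θ' x u y| ≤ 2 * √(2 * L * N) := by
      calc N * ∑ y, |M.P i θ x u y - M.P i θ' x u y|
          = ∑ y, |M.deviation i s a t x u θ' y - M.deviation i s a t x u θ y| := by
            rw [mul_sum]
            refine sum_congr rfl fun y _ => ?_
            unfold deviation
            rw [← hN, ← abs_of_nonneg (show 0 ≤ N by linarith), ← abs_mul,
              abs_of_nonneg (show 0 ≤ N by linarith)]
            congr 1; ring
        _ ≤ ∑ y, (|M.deviation i s a t x u θ' y| + |M.deviation i s a t x u θ y|) :=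
            sum_le_sum fun y _ => abs_sub _ _
        _ ≤ 2 * √(2 * L * N) := by rw [sum_add_distrib]; linarith
    rw [Real.sqrt_mul (by linarith)] at h3
    rw [max_eq_right hN1, mul_one_div, le_div_iff₀ hsq]
    have h4 : √N * ((∑ y, |M.P i θ x u y - M.P i θ' x u y|) * √N) ≤ √N * (2 * √(2 * L)) := by
      rw [mul_left_comm, hNN, mul_comm]
      linarith
    exact le_of_mul_le_mul_left h4 hsq

/-- Exponent of the exponential supermartingale that controls the deviations in the direction `e`
of the transitions from `(x, u)`. -/
noncomputable def logWeight (e : S i → ℝ) (η : ℝ) (θ : Θ i) : ℝ :=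
  η * ∑ y, e y * M.deviation i s a t x u θ y - η ^ 2 / 2 * visits s a t x u

theorem logWeight_succ (ht : 1 ≤ t) (e : S i → ℝ) (η : ℝ) (θ : Θ i) :
    M.logWeight i s a (t + 1) x u e η θ = M.logWeight i s a t x u e η θ +
      if s t = x ∧ a t = u then
        η * (e (s (t + 1)) - ∑ y, M.P i θ x u y * e y) - η ^ 2 / 2 else 0 := by
  have h : ∑ y, e y * M.deviation i s a (t + 1) x u θ y =
      ∑ y, e y * M.deviation i s a t x u θ y +
        if s t = x ∧ a t = u then e (s (t + 1)) - ∑ y, M.P i θ x u y * e y else 0 := by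
    unfold deviation
    simp only [transitions_succ s a ht, visits_succ s a ht]
    by_cases hv : s t = x ∧ a t = u
    · have e1 : e (s (t + 1)) = ∑ y, e y * if s (t + 1) = y then 1 else 0 := by simp
      simp only [hv, and_self, true_and, if_true]
      rw [e1, ← sum_sub_distrib, ← sum_add_distrib]
      refine sum_congr rfl fun y _ => ?_
      split_ifs <;> push_cast <;> ring
    · simp [hv]
  unfold logWeight
  rw [h, visits_succ s a ht]
  split_ifs <;> push_cast <;> ring

theorem logWeight_one (e : S i → ℝ) (η : ℝ) (θ : Θ i) : M.logWeight i s a 1 x u e η θ = 0 := by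
  simp [logWeight, deviation, transitions, visits]

theorem logWeight_le {e : S i → ℝ} (he : ∀ y, |e y| ≤ 1) (η : ℝ) (θ : Θ i) :
    M.logWeight i s a t x u e η θ ≤ |η| * (Fintype.card (S i) * t) := by
  have h1 : |∑ y, e y * M.deviation i s a t x u θ y| ≤ Fintype.card (S i) * t := by
    refine (abs_sum_le_sum_abs _ _).trans ((sum_le_card_nsmul _ _ (t : ℝ) fun y _ => ?_).trans_eq
      (by rw [nsmul_eq_mul, card_univ]))
    rw [abs_mul]
    calc |e y| * |M.deviation i s a t x u θ y| ≤ 1 * t :=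
          mul_le_mul (he y) (M.abs_deviation_le i s a t x u θ y) (abs_nonneg _) zero_le_one
      _ = t := one_mul _
  have h2 : η * ∑ y, e y * M.deviation i s a t x u θ y ≤ |η| * (Fintype.card (S i) * t) :=
    (le_abs_self _).trans (by
      rw [abs_mul]; exact mul_le_mul_of_nonneg_left h1 (abs_nonneg η))
  have h3 : 0 ≤ η ^ 2 / 2 * (visits s a t x u : ℝ) := by positivity
  unfold logWeight
  linarith

end Bandit

namespace IsRBTSDE

variable {n : ℕ} {S : Fin n → Type*} [∀ i, Fintype (S i)] [∀ i, DecidableEq (S i)]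
  {Θ : Fin n → Type*} [∀ i, MeasurableSpace (Θ i)] {Ω : Type*} [mΩ : MeasurableSpace Ω]
  {M : Bandit S Θ} {μ : (∀ i, Θ i) → (∀ i, S i) → Fin n → Bool} {Pr : Measure Ω}
  {θs : Ω → ∀ i, Θ i} {X : ℕ → Ω → ∀ i, S i} {A : ℕ → Ω → Fin n → Bool} {θh : ℕ → Ω → ∀ i, Θ i}

omit mΩ in
theorem measurable_logWeight (i : Fin n) (x : S i) (u : Bool) (e : S i → ℝ) (η : ℝ) {t : ℕ}
    (ht : 1 ≤ t) : Measurable[pastSigma θs X A θh (t + 1)] fun ω =>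
      M.logWeight i (fun τ => X τ ω i) (fun τ => A τ ω i) t x u e η (θs ω i) := by
  refine DependsOnHistory.measurable (mΩ := pastSigma θs X A θh (t + 1)) ht
    (fun x a => sup_comap_le_pastSigma_succ θs X A θh ht _
      (RestlessBandit.measurableSet_historyEvent θs X A θh t x a))
    (Φ := fun p a ω => M.logWeight i (fun τ => p τ i) (fun τ => a τ i) t x u e η (θs ω i))
    (fun p a p' a' h1 h2 => ?_) fun p a => ?_
  · funext ω
    have h1' : ∀ τ, 1 ≤ τ → τ ≤ t → p τ i = p' τ i := fun τ b c => by rw [h1 τ b c]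
    have h2' : ∀ τ, 1 ≤ τ → τ < t → a τ i = a' τ i := fun τ b c => by rw [h2 τ b c]
    unfold Bandit.logWeight
    simp only [M.deviation_congr (s := fun τ => p τ i) (a := fun τ => a τ i) _ _ h1' h2',
      visits_congr (s := fun τ => p τ i) (a := fun τ => a τ i)
        fun τ b c => ⟨h1' τ b (le_of_lt c), h2' τ b c⟩]
  · have hm : Measurable fun θ : Θ i =>
        M.logWeight i (fun τ => p τ i) (fun τ => a τ i) t x u e η θ :=
      (measurable_const.mul (Finset.measurable_sum _ fun y _ =>
        measurable_const.mul (M.measurable_deviation i _ _ t x u y))).sub measurable_const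
    exact (hm.comp (measurable_pi_apply i)).comp (measurable_param_pastSigma θs X A θh (t + 1))

variable [IsProbabilityMeasure Pr]

/-- `exp (logWeight t)` is a supermartingale, by Hoeffding's lemma. -/
theorem integral_exp_logWeight_le_one (h : IsRBTSDE M μ Pr θs X A θh)
    (hμ : ∀ s, Measurable fun θ => μ θ s) (i : Fin n) (x : S i) (u : Bool) {e : S i → ℝ}
    (he : ∀ y, |e y| ≤ 1) (η : ℝ) {t : ℕ} (ht : 1 ≤ t) :
    ∫ ω, Real.exp (M.logWeight i (fun τ => X τ ω i) (fun τ => A τ ω i) t x u e η (θs ω i)) ∂Pr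
      ≤ 1 := by
  induction t, ht using Nat.le_induction with
  | base => simp [M.logWeight_one]
  | succ t ht ih =>
    refine le_trans ?_ ih
    have hm := h.pastSigma_le hμ (t + 1)
    set W : Ω → ℝ := fun ω =>
      M.logWeight i (fun τ => X τ ω i) (fun τ => A τ ω i) t x u e η (θs ω i) with hW
    have hWm : Measurable[pastSigma θs X A θh (t + 1)] W := measurable_logWeight i x u e η ht
    let D : Set Ω := X t ⁻¹' {s | s i = x} ∩ A t ⁻¹' {a | a i = u}
    have hD : MeasurableSet[pastSigma θs X A θh (t + 1)] D :=
      (measurableSet_state_pastSigma θs X A θh ht (Nat.lt_succ_self t) _).inter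
        (measurableSet_action_pastSigma θs X A θh ht (Nat.lt_succ_self t) _)
    let g : S i → Ω → ℝ := fun y => D.indicator fun ω =>
      η * (e y - ∑ z, M.P i (θs ω i) x u z * e z) - η ^ 2 / 2
    have hg : ∀ y ω, g y ω = if X t ω i = x ∧ A t ω i = u then
        η * (e y - ∑ z, M.P i (θs ω i) x u z * e z) - η ^ 2 / 2 else 0 := fun y ω => by
      simp only [g, D, Set.indicator, Set.mem_inter_iff, Set.mem_preimage, Set.mem_ofPred_eq]
    have hgm : ∀ y, Measurable[pastSigma θs X A θh (t + 1)] (g y) := fun y => by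
      refine Measurable.indicator ?_ hD
      have hP : Measurable fun θ : ∀ i, Θ i =>
          η * (e y - ∑ z, M.P i (θ i) x u z * e z) - η ^ 2 / 2 :=
        (measurable_const.mul (measurable_const.sub (Finset.measurable_sum _ fun z _ =>
          ((M.P_measurable i x u z).comp (measurable_pi_apply i)).mul_const _))).sub
          measurable_const
      exact hP.comp (measurable_param_pastSigma θs X A θh (t + 1))
    have hgb : ∀ y ω, g y ω ≤ |η| * 2 := fun y ω => by
      rw [hg]
      split_ifs
      · have h1 : |∑ z, M.P i (θs ω i) x u z * e z| ≤ 1 := by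
          refine (abs_sum_le_sum_abs _ _).trans ?_
          rw [← M.P_sum i (θs ω i) x u]
          refine sum_le_sum fun z _ => ?_
          rw [abs_mul, abs_of_nonneg (M.P_nonneg _ _ _ _ _)]
          exact mul_le_of_le_one_right (M.P_nonneg _ _ _ _ _) (he z)
        have h2 : |e y - ∑ z, M.P i (θs ω i) x u z * e z| ≤ 2 :=
          (abs_sub _ _).trans (by linarith [he y])
        have h3 := (le_abs_self (η * (e y - ∑ z, M.P i (θs ω i) x u z * e z))).trans
          ((abs_mul _ _).trans_le (mul_le_mul_of_nonneg_left h2 (abs_nonneg η)))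
        linarith [sq_nonneg η]
      · positivity
    have hWb : ∀ ω, W ω ≤ |η| * (Fintype.card (S i) * t) := fun ω =>
      M.logWeight_le i _ _ t x u he η (θs ω i)
    have key := h.integral_next_state hμ ht (F := fun s' ω => Real.exp (W ω + g (s' i) ω))
      (fun s' => Real.measurable_exp.comp (hWm.add (hgm (s' i))))
      (B := Real.exp (|η| * (Fintype.card (S i) * t) + |η| * 2)) (fun s' ω => by
        rw [Real.abs_exp]
        exact Real.exp_le_exp.2 (add_le_add (hWb ω) (hgb _ ω)))
    have e1 : ∀ ω, M.logWeight i (fun τ => X τ ω i) (fun τ => A τ ω i) (t + 1) x u e η (θs ω i) =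
        W ω + g (X (t + 1) ω i) ω := fun ω => by
      rw [M.logWeight_succ i _ _ t x u ht, hg]
    simp only [e1]
    rw [key]
    have hstep : ∀ ω, ∑ s', M.jointP (θs ω) (X t ω) (A t ω) s' * Real.exp (W ω + g (s' i) ω) ≤
        Real.exp (W ω) := fun ω => by
      have e2 := sum_prod_mul_apply (p := fun j y => M.P j (θs ω j) (X t ω j) (A t ω j) y)
        (fun j => M.P_sum _ _ _ _) i (fun y => Real.exp (g y ω))
      have e3 : ∑ s', M.jointP (θs ω) (X t ω) (A t ω) s' * Real.exp (W ω + g (s' i) ω) =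
          Real.exp (W ω) *
            ∑ y, M.P i (θs ω i) (X t ω i) (A t ω i) y * Real.exp (g y ω) := by
        rw [← e2, mul_sum]
        refine sum_congr rfl fun s' _ => ?_
        rw [Real.exp_add, Bandit.jointP]; ring
      rw [e3]
      refine mul_le_of_le_one_right (Real.exp_pos _).le ?_
      simp only [hg]
      split_ifs with hv
      · rw [hv.1, hv.2]
        simp only [Real.exp_sub, ← mul_div_assoc, ← sum_div]
        rw [div_le_one (Real.exp_pos _)]
        exact sum_mul_exp_sub_mean_le (fun y => M.P_nonneg _ _ _ _ _) (M.P_sum _ _ _ _) he η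
      · simp [M.P_sum]
    refine integral_mono_of_nonneg (ae_of_all _ fun ω => sum_nonneg fun s' _ =>
      mul_nonneg (M.jointP_nonneg _ _ _ _) (Real.exp_pos _).le) ?_ (ae_of_all _ hstep)
    exact integrable_of_abs_le (Real.measurable_exp.comp (hWm.mono hm le_rfl)) fun ω => by
      simp only [Real.abs_exp]
      exact Real.exp_le_exp.2 (hWb ω)

/-- The true parameter is implausible with small probability: the union bound is over the
state-action pairs, the sign vectors (the `ℓ¹` norm is a maximum over these) and the number of
visits, for which the exponent `η = √(2 L / N)` is optimal. -/
theorem measureReal_implausible_le (h : IsRBTSDE M μ Pr θs X A θh)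
    (hμ : ∀ s, Measurable fun θ => μ θ s) (i : Fin n) {L : ℝ} (hL : 0 ≤ L) {t T : ℕ} (ht : 1 ≤ t)
    (htT : t ≤ T) :
    Pr.real {ω | M.Implausible i L (fun τ => X τ ω i) (fun τ => A τ ω i) t (θs ω i)} ≤
      (Fintype.card (S i) * 2 * 2 ^ Fintype.card (S i) * T : ℝ) * Real.exp (-L) := by
  let sg : (S i → Bool) → S i → ℝ := fun b y => if b y = true then 1 else -1
  have hsg : ∀ b y, |sg b y| ≤ 1 := fun b y => by
    simp only [sg]; split_ifs <;> simp
  let W : (S i × Bool × (S i → Bool)) × ℕ → Ω → ℝ := fun z ω =>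
    M.logWeight i (fun τ => X τ ω i) (fun τ => A τ ω i) t z.1.1 z.1.2.1 (sg z.1.2.2)
      (√(2 * L / z.2)) (θs ω i)
  let I : Finset ((S i × Bool × (S i → Bool)) × ℕ) := univ ×ˢ Icc 1 T
  have hsub : {ω | M.Implausible i L (fun τ => X τ ω i) (fun τ => A τ ω i) t (θs ω i)} ⊆
      ⋃ z ∈ I, {ω | Real.exp L ≤ Real.exp (W z ω)} := by
    rintro ω ⟨x, u, hxu⟩
    let b : S i → Bool := fun y =>
      decide (0 ≤ M.deviation i (fun τ => X τ ω i) (fun τ => A τ ω i) t x u (θs ω i) y)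
    let N := visits (fun τ => X τ ω i) (fun τ => A τ ω i) t x u
    have hNT : N ≤ T := (visits_le _ _ t x u).trans (by omega)
    have hN : 1 ≤ N := by
      by_contra h0
      have h0' : N = 0 := by omega
      have hv : ∀ τ ∈ Ico 1 t, ¬ (X τ ω i = x ∧ A τ ω i = u) := by
        have := filter_eq_empty_iff.1 (card_eq_zero.1 h0')
        exact fun τ hτ => this hτ
      have htr : ∀ y, transitions (fun τ => X τ ω i) (fun τ => A τ ω i) t x u y = 0 := fun y =>
        card_eq_zero.2 (filter_eq_empty_iff.2 fun τ hτ hh => hv τ hτ hh.1)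
      have hd : ∀ y, M.deviation i (fun τ => X τ ω i) (fun τ => A τ ω i) t x u (θs ω i) y = 0 := by
        intro y
        rw [Bandit.deviation, htr y, show visits (fun τ => X τ ω i) (fun τ => A τ ω i) t x u = 0
          from h0']
        simp
      simp only [hd, abs_zero, sum_const_zero] at hxu
      exact absurd hxu (not_lt.2 (Real.sqrt_nonneg _))
    have hN' : (1 : ℝ) ≤ N := by exact_mod_cast hN
    refine Set.mem_biUnion (x := ((x, u, b), N)) (by simp [I, hN, hNT]) ?_
    rw [Set.mem_ofPred_eq, Real.exp_le_exp]
    simp only [W, Bandit.logWeight]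
    have e1 : ∀ y, sg b y * M.deviation i (fun τ => X τ ω i) (fun τ => A τ ω i) t x u (θs ω i) y =
        |M.deviation i (fun τ => X τ ω i) (fun τ => A τ ω i) t x u (θs ω i) y| := fun y => by
      simp only [sg, b, decide_eq_true_eq]
      split_ifs with hy
      · rw [one_mul, abs_of_nonneg hy]
      · rw [abs_of_neg (not_le.1 hy)]; ring
    have e2 : √(2 * L / N) * √(2 * L * N) = 2 * L := by
      rw [← Real.sqrt_mul (by positivity), show 2 * L / N * (2 * L * N) = (2 * L) * (2 * L) by
        field_simp, Real.sqrt_mul_self (by linarith)]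
    have e3 : √(2 * L / N) ^ 2 = 2 * L / N := Real.sq_sqrt (by positivity)
    have e4 : 2 * L / (N : ℝ) / 2 * N = L := by field_simp
    have e5 := mul_le_mul_of_nonneg_left hxu.le (Real.sqrt_nonneg (2 * L / N))
    change √(2 * L / N) * √(2 * L * N) ≤ _ at e5
    rw [e2] at e5
    simp only [e1]
    change L ≤ √(2 * L / N) * _ - √(2 * L / N) ^ 2 / 2 * N
    rw [e3, e4]
    linarith
  have hz : ∀ z ∈ I, Pr.real {ω | Real.exp L ≤ Real.exp (W z ω)} ≤ Real.exp (-L) := by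
    intro z _
    have hWm : Measurable (W z) :=
      (measurable_logWeight i z.1.1 z.1.2.1 (sg z.1.2.2) (√(2 * L / z.2)) ht).mono
        (h.pastSigma_le hμ (t + 1)) le_rfl
    have h1 := mul_meas_ge_le_integral_of_nonneg (μ := Pr) (f := fun ω => Real.exp (W z ω))
      (ae_of_all _ fun ω => (Real.exp_pos _).le)
      (integrable_of_abs_le (Real.measurable_exp.comp hWm) fun ω => by
        simp only [Real.abs_exp]
        exact Real.exp_le_exp.2 (M.logWeight_le i _ _ t z.1.1 z.1.2.1 (hsg z.1.2.2) _ (θs ω i)))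
      (Real.exp L)
    have h2 := h1.trans (h.integral_exp_logWeight_le_one hμ i z.1.1 z.1.2.1 (hsg z.1.2.2) _ ht)
    rw [Real.exp_neg, ← one_div, le_div_iff₀ (Real.exp_pos _), mul_comm]
    exact h2
  calc _ ≤ Pr.real (⋃ z ∈ I, {ω | Real.exp L ≤ Real.exp (W z ω)}) := measureReal_mono hsub (measure_ne_top _ _)
    _ ≤ ∑ z ∈ I, Pr.real {ω | Real.exp L ≤ Real.exp (W z ω)} := measureReal_biUnion_finset_le _ _
    _ ≤ I.card • Real.exp (-L) := sum_le_card_nsmul _ _ _ hz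
    _ = _ := by
      rw [nsmul_eq_mul]
      simp only [I, card_product, card_univ, Fintype.card_prod, Fintype.card_bool, Fintype.card_fun,
        Nat.card_Icc, Nat.add_sub_cancel]
      push_cast; ring

end IsRBTSDE

/-! ### The regret -/

theorem schedule_snd_le {n : ℕ} {S : Fin n → Type*} [∀ i, DecidableEq (S i)]
    (s : ℕ → ∀ i, S i) (a : ℕ → Fin n → Bool) (t : ℕ) : (schedule s a t).2 ≤ t := by
  induction t with
  | zero => simp [schedule]
  | succ t ih =>
    rw [schedule]
    split_ifs
    · exact Nat.sub_le _ _
    · omega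

/-- Expectations of a function with values in `[0, B]` under two probability vectors. -/
theorem sum_mul_sub_sum_mul_le {Y : Type*} [Fintype Y] {p q V : Y → ℝ} {B : ℝ}
    (hpq : ∑ y, p y = ∑ y, q y) (hV0 : ∀ y, 0 ≤ V y) (hVB : ∀ y, V y ≤ B) :
    ∑ y, p y * V y - ∑ y, q y * V y ≤ B / 2 * ∑ y, |p y - q y| := by
  have e : ∑ y, p y * V y - ∑ y, q y * V y = ∑ y, (p y - q y) * (V y - B / 2) := by
    have h1 : ∑ y, (p y - q y) * (V y - B / 2) =
        ∑ y, p y * V y - ∑ y, q y * V y - (∑ y, p y - ∑ y, q y) * (B / 2) := by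
      rw [← sum_sub_distrib, ← sum_sub_distrib, sum_mul, ← sum_sub_distrib]
      exact sum_congr rfl fun y _ => by ring
    rw [h1, hpq]; ring
  rw [e, mul_sum]
  refine sum_le_sum fun y _ => (le_abs_self _).trans ?_
  rw [abs_mul, mul_comm]
  refine mul_le_mul_of_nonneg_right (abs_le.2 ⟨?_, ?_⟩) (abs_nonneg _)
  · linarith [hV0 y]
  · linarith [hVB y]

namespace Bandit

variable {n : ℕ} {S : Fin n → Type*} [∀ i, Fintype (S i)]
  {Θ : Fin n → Type*} [∀ i, MeasurableSpace (Θ i)] (M : Bandit S Θ)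

theorem nonempty_state (M : Bandit S Θ) (i : Fin n) : Nonempty (S i) := by
  by_contra h
  rw [not_nonempty_iff] at h
  have := M.init_sum i
  rw [univ_eq_empty, sum_empty] at this
  exact zero_ne_one this

theorem reward_nonneg (kind : RewardModel) (s : ∀ i, S i) (a : Fin n → Bool) :
    0 ≤ M.reward kind s a := by
  refine sum_nonneg fun i _ => ?_
  cases kind with
  | A => exact M.r_nonneg _ _ _
  | B =>
    simp only [armReward]
    split_ifs
    · exact M.r_nonneg _ _ _
    · exact le_rfl

/-- In Model B, only the `m` active arms yield a reward. -/
theorem reward_le (kind : RewardModel) (s : ∀ i, S i) {a : Fin n → Bool} {m : ℕ}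
    (ha : #{i | a i = true} = m) : M.reward kind s a ≤ kind.alpha n m * M.Rmax := by
  cases kind with
  | A =>
    refine (sum_le_card_nsmul _ _ M.Rmax fun i _ => M.r_le _ _ _).trans_eq ?_
    rw [card_univ, Fintype.card_fin, nsmul_eq_mul]; rfl
  | B =>
    simp only [reward, armReward, ← sum_filter]
    refine (sum_le_card_nsmul _ _ M.Rmax fun i _ => M.r_le _ _ _).trans_eq ?_
    rw [ha, nsmul_eq_mul]; rfl

end Bandit

namespace IsRBTSDE

variable {n : ℕ} {S : Fin n → Type*} [∀ i, Fintype (S i)] [∀ i, DecidableEq (S i)]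
  {Θ : Fin n → Type*} [∀ i, MeasurableSpace (Θ i)] {Ω : Type*} [mΩ : MeasurableSpace Ω]
  {M : Bandit S Θ} {μ : (∀ i, Θ i) → (∀ i, S i) → Fin n → Bool} {Pr : Measure Ω}
  {θs : Ω → ∀ i, Θ i} {X : ℕ → Ω → ∀ i, S i} {A : ℕ → Ω → Fin n → Bool} {θh : ℕ → Ω → ∀ i, Θ i}

theorem measurable_of_state_action (h : IsRBTSDE M μ Pr θs X A θh)
    (hμ : ∀ s, Measurable fun θ => μ θ s) {t : ℕ} (ht : 1 ≤ t)
    {F : (∀ i, S i) → (Fin n → Bool) → Ω → ℝ} (hF : ∀ s a, Measurable (F s a)) :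
    Measurable fun ω => F (X t ω) (A t ω) ω :=
  measurable_apply_of_countable (fun s => h.measurable_state t ht s)
    (F := fun s ω => F s (A t ω) ω) fun s =>
      measurable_apply_of_countable (fun a => h.measurableSet_action hμ ht {a})
        (F := fun a ω => F s a ω) fun a => hF s a

theorem sample_eq (h : IsRBTSDE M μ Pr θs X A θh) (ω : Ω) (t : ℕ) (_ : 1 ≤ t)
    (hs : ¬ EpisodeStart (fun τ => X τ ω) (fun τ => A τ ω) (t + 1)) : θh (t + 1) ω = θh t ω := by
  rw [h.keep (t + 1) (by omega) ω hs, Nat.add_sub_cancel]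

variable [IsProbabilityMeasure Pr]

theorem integrable_sum_abs_P_sub (h : IsRBTSDE M μ Pr θs X A θh)
    (hμ : ∀ s, Measurable fun θ => μ θ s) (i : Fin n) {t : ℕ} (ht : 1 ≤ t) :
    Integrable (fun ω => ∑ y, |M.P i (θh t ω i) (X t ω i) (A t ω i) y -
      M.P i (θs ω i) (X t ω i) (A t ω i) y|) Pr := by
  refine integrable_of_abs_le (h.measurable_of_state_action hμ ht (F := fun s a ω =>
    ∑ y, |M.P i (θh t ω i) (s i) (a i) y - M.P i (θs ω i) (s i) (a i) y|) fun s a =>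
      Finset.measurable_sum _ fun y _ => Measurable.abs (Measurable.sub ?_ ?_)) (B := 2)
    fun ω => ?_
  · exact (M.P_measurable i _ _ y).comp ((measurable_pi_apply i).comp (h.measurable_sample t ht))
  · exact (M.P_measurable i _ _ y).comp ((measurable_pi_apply i).comp h.measurable_param)
  · rw [abs_of_nonneg (sum_nonneg fun y _ => abs_nonneg _)]
    exact M.sum_abs_P_sub_le_two i _ _ _ _

/-- The expected cumulative distance, for one arm, between the transition probabilities of the
parameter in use and of the true one. Both lie in the confidence set of the current episode, except
with small probability; by posterior sampling, this probability is the same for both. -/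
theorem integral_sum_abs_P_sub_le (h : IsRBTSDE M μ Pr θs X A θh)
    (hμ : ∀ s, Measurable fun θ => μ θ s) (i : Fin n) {L : ℝ} (hL : 1 ≤ 2 * L) (T : ℕ) :
    ∫ ω, ∑ t ∈ Icc 1 T, ∑ y, |M.P i (θh t ω i) (X t ω i) (A t ω i) y -
      M.P i (θs ω i) (X t ω i) (A t ω i) y| ∂Pr ≤
    10 * √(2 * L) * √(Fintype.card (S i) * T) + 4 * (T : ℝ) ^ 2 *
      ((Fintype.card (S i) * 2 * 2 ^ Fintype.card (S i) * T : ℝ) * Real.exp (-L)) := by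
  classical
  set p : ℝ := (Fintype.card (S i) * 2 * 2 ^ Fintype.card (S i) * T : ℝ) * Real.exp (-L) with hp
  -- `Φ t`: an episode starts at `t` with an implausible parameter
  let Φ : ℕ → (ℕ → ∀ i, S i) → (ℕ → Fin n → Bool) → (∀ i, Θ i) → ℝ := fun t x a θ =>
    if EpisodeStart x a t ∧ M.Implausible i L (fun τ => x τ i) (fun τ => a τ i) t (θ i) then 1
    else 0
  have hΦ01 : ∀ t x a θ, 0 ≤ Φ t x a θ ∧ Φ t x a θ ≤ 1 := fun t x a θ => by
    simp only [Φ]; split_ifs <;> simp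
  have hΦabs : ∀ t x a θ, |Φ t x a θ| ≤ 1 := fun t x a θ => by
    rw [abs_of_nonneg (hΦ01 t x a θ).1]; exact (hΦ01 t x a θ).2
  have hΦdep : ∀ t, DependsOnHistory t (Φ t) := fun t x a x' a' h1 h2 => by
    funext θ
    have e1 : EpisodeStart x a t = EpisodeStart x' a' t :=
      dependsOnHistory_episodeStart t x a x' a' h1 h2
    have e2 := M.implausible_congr (i := i) (t := t) (s := fun τ => x τ i) (a := fun τ => a τ i)
      (s' := fun τ => x' τ i) (a' := fun τ => a' τ i) L (fun τ b c => by rw [h1 τ b c])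
      (fun τ b c => by rw [h2 τ b c]) (θ i)
    simp only [Φ, e1, e2]
  have hΦm : ∀ t x a, Measurable (Φ t x a) := fun t x a => by
    refine Measurable.ite ?_ measurable_const measurable_const
    exact (MeasurableSet.const _).inter (measurable_pi_apply i
      (M.measurableSet_implausible i (fun τ => x τ i) (fun τ => a τ i) t L))
  let Gh : ℕ → Ω → ℝ := fun t ω => Φ t (fun τ => X τ ω) (fun τ => A τ ω) (θh t ω)
  let Gs : ℕ → Ω → ℝ := fun t ω => Φ t (fun τ => X τ ω) (fun τ => A τ ω) (θs ω)
  have hGhm : ∀ t, 1 ≤ t → Measurable (Gh t) := fun t ht =>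
    h.measurable_of_history hμ ht (hΦdep t) (hΦm t) (h.measurable_sample t ht)
  have hGsm : ∀ t, 1 ≤ t → Measurable (Gs t) := fun t ht =>
    h.measurable_of_history hμ ht (hΦdep t) (hΦm t) h.measurable_param
  have hGhi : ∀ t, 1 ≤ t → Integrable (Gh t) Pr := fun t ht =>
    integrable_of_abs_le (hGhm t ht) fun ω => hΦabs _ _ _ _
  have hGsi : ∀ t, 1 ≤ t → Integrable (Gs t) Pr := fun t ht =>
    integrable_of_abs_le (hGsm t ht) fun ω => hΦabs _ _ _ _
  have hGs : ∀ t, 1 ≤ t → t ≤ T → ∫ ω, Gs t ω ∂Pr ≤ p := fun t ht htT => by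
    have e : Gs t = (Gs t ⁻¹' {1}).indicator fun _ => (1 : ℝ) := by
      ext ω
      by_cases hω : Gs t ω = 1
      · rw [Set.indicator_of_mem (by exact hω), hω]
      · rw [Set.indicator_of_notMem (by exact hω)]
        simp only [Gs, Φ] at hω ⊢
        split_ifs at hω ⊢ with hc
        · exact absurd rfl hω
        · rfl
    rw [e, integral_indicator (hGsm t ht (measurableSet_singleton 1)), setIntegral_const,
      smul_eq_mul, mul_one]
    refine (measureReal_mono (fun ω hω => ?_) (measure_ne_top _ _)).trans
      (h.measureReal_implausible_le hμ i (by linarith : 0 ≤ L) ht htT)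
    by_contra hc
    have h0 : Gs t ω = 0 := if_neg fun hh => hc hh.2
    have h1 : Gs t ω = 1 := hω
    rw [h0] at h1
    exact zero_ne_one h1
  have hGh : ∀ t, 1 ≤ t → t ≤ T → ∫ ω, Gh t ω ∂Pr ≤ p := fun t ht htT => by
    refine le_trans (le_of_eq ?_) (hGs t ht htT)
    exact h.integral_sample_eq hμ ht (hΦdep t) (hΦm t) (fun x a θ hs => if_neg fun hh => hs hh.1)
      (fun x a θ => hΦabs t x a θ)
  have hpt : ∀ ω, ∑ t ∈ Icc 1 T, ∑ y, |M.P i (θh t ω i) (X t ω i) (A t ω i) y -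
      M.P i (θs ω i) (X t ω i) (A t ω i) y| ≤
      10 * √(2 * L) * √(Fintype.card (S i) * T) +
        T * (2 * ∑ t ∈ Icc 1 T, (Gh t ω + Gs t ω)) := by
    intro ω
    have hstep : ∀ t ∈ Icc 1 T, ∑ y, |M.P i (θh t ω i) (X t ω i) (A t ω i) y -
        M.P i (θs ω i) (X t ω i) (A t ω i) y| ≤
        2 * √(2 * L) * (1 / √(max 1 (visits (fun τ => X τ ω i) (fun τ => A τ ω i)
          (schedule (fun τ => X τ ω) (fun τ => A τ ω) t).1 (X t ω i) (A t ω i) : ℝ))) +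
        2 * ∑ t ∈ Icc 1 T, (Gh t ω + Gs t ω) := by
      intro t ht
      rw [mem_Icc] at ht
      set t₀ := (schedule (fun τ => X τ ω) (fun τ => A τ ω) t).1 with ht₀
      have hst : EpisodeStart (fun τ => X τ ω) (fun τ => A τ ω) t₀ := episodeStart_schedule_fst t
      have hθ : θh t ω = θh t₀ ω :=
        eq_at_schedule_fst (f := fun t => θh t ω) (h.sample_eq ω) ht.1
      have ht₀T : t₀ ∈ Icc 1 T := by
        rw [mem_Icc]
        exact ⟨one_le_schedule_fst ht.1, (schedule_fst_le _ _ t).trans ht.2⟩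
      have hsingle : Gh t₀ ω + Gs t₀ ω ≤ ∑ t ∈ Icc 1 T, (Gh t ω + Gs t ω) :=
        single_le_sum (f := fun t => Gh t ω + Gs t ω)
          (fun t _ => add_nonneg (hΦ01 _ _ _ _).1 (hΦ01 _ _ _ _).1) ht₀T
      have hnn : 0 ≤ 2 * √(2 * L) * (1 / √(max 1 (visits (fun τ => X τ ω i) (fun τ => A τ ω i)
          t₀ (X t ω i) (A t ω i) : ℝ))) := by positivity
      have h2 := M.sum_abs_P_sub_le_two i (X t ω i) (A t ω i) (θh t ω i) (θs ω i)
      have hGh0 : 0 ≤ Gh t₀ ω := (hΦ01 _ _ _ _).1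
      have hGs0 : 0 ≤ Gs t₀ ω := (hΦ01 _ _ _ _).1
      by_cases h3 : M.Implausible i L (fun τ => X τ ω i) (fun τ => A τ ω i) t₀ (θh t ω i)
      · have : Gh t₀ ω = 1 := if_pos ⟨hst, by rw [← hθ]; exact h3⟩
        linarith
      by_cases h4 : M.Implausible i L (fun τ => X τ ω i) (fun τ => A τ ω i) t₀ (θs ω i)
      · have : Gs t₀ ω = 1 := if_pos ⟨hst, h4⟩
        linarith
      have h5 := M.sum_abs_P_sub_le i (fun τ => X τ ω i) (fun τ => A τ ω i) t₀ (X t ω i) (A t ω i)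
        hL h3 h4
      linarith
    refine (sum_le_sum hstep).trans ?_
    rw [sum_add_distrib, ← mul_sum, sum_const, Nat.card_Icc, Nat.add_sub_cancel, nsmul_eq_mul]
    have h6 := mul_le_mul_of_nonneg_left
      (sum_inv_sqrt_visits_schedule_le (fun τ => X τ ω) (fun τ => A τ ω) i T)
      (show 0 ≤ 2 * √(2 * L) by positivity)
    linarith
  have hGi : ∀ t ∈ Icc 1 T, Integrable (fun ω => Gh t ω + Gs t ω) Pr := fun t ht =>
    (hGhi t (mem_Icc.1 ht).1).add (hGsi t (mem_Icc.1 ht).1)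
  have hsumi : Integrable (fun ω => ∑ t ∈ Icc 1 T, (Gh t ω + Gs t ω)) Pr :=
    integrable_finsetSum _ hGi
  have hsum : ∫ ω, ∑ t ∈ Icc 1 T, (Gh t ω + Gs t ω) ∂Pr ≤ T * (2 * p) := by
    rw [integral_finsetSum _ hGi]
    refine (sum_le_card_nsmul _ _ (2 * p) fun t ht => ?_).trans_eq (by simp)
    rw [mem_Icc] at ht
    rw [integral_add (hGhi t ht.1) (hGsi t ht.1)]
    linarith [hGs t ht.1 ht.2, hGh t ht.1 ht.2]
  calc _ ≤ ∫ ω, (10 * √(2 * L) * √(Fintype.card (S i) * T) +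
        T * (2 * ∑ t ∈ Icc 1 T, (Gh t ω + Gs t ω))) ∂Pr :=
        integral_mono_of_nonneg (ae_of_all _ fun ω => sum_nonneg fun t _ =>
          sum_nonneg fun y _ => abs_nonneg _)
          ((integrable_const _).add ((hsumi.const_mul 2).const_mul _)) (ae_of_all _ hpt)
    _ = 10 * √(2 * L) * √(Fintype.card (S i) * T) +
        T * (2 * ∫ ω, ∑ t ∈ Icc 1 T, (Gh t ω + Gs t ω) ∂Pr) := by
        rw [integral_add (integrable_const _) ((hsumi.const_mul 2).const_mul _),
          integral_const_mul (T : ℝ), integral_const_mul (2 : ℝ), integral_const]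
        simp
    _ ≤ _ := by
        have := mul_le_mul_of_nonneg_left hsum (show (0 : ℝ) ≤ T * 2 by positivity)
        nlinarith

/-- Decomposition of the regret: on average, the model in use is worth less than the true one only
because the lengths of the episodes are not known when sampling (`C * N`), the bias telescopes within each episode (`B * N`), and the rest
is due to the distance between the sampled and the true transition probabilities. Here `N` bounds
the number of episodes, `C` the rewards and `B` the span of the bias. -/
theorem integral_regret_le (h : IsRBTSDE M μ Pr θs X A θh) (hμ : ∀ s, Measurable fun θ => μ θ s)
    (kind : RewardModel) {J : (∀ i, Θ i) → ℝ} (hJm : Measurable J) {C B : ℝ}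
    (hJ0 : ∀ θ, 0 ≤ J θ) (hJC : ∀ θ, J θ ≤ C) {V : (∀ i, Θ i) → (∀ i, S i) → ℝ}
    (hVm : ∀ s, Measurable fun θ => V θ s) (hV0 : ∀ θ s, 0 ≤ V θ s) (hVB : ∀ θ s, V θ s ≤ B)
    (hV : ∀ θ s, J θ + V θ s = M.reward kind s (μ θ s) +
      ∑ s', M.jointP θ s (μ θ s) s' * V θ s')
    {T : ℕ} (hT : 1 ≤ T) {N : ℝ}
    (hN : ∀ (x : ℕ → ∀ i, S i) (a : ℕ → Fin n → Bool), (numEpisodes x a T : ℝ) ≤ N) :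
    Integrable (fun ω => T * J (θs ω) - ∑ t ∈ Icc 1 T, M.reward kind (X t ω) (A t ω)) Pr ∧
    ∫ ω, (T * J (θs ω) - ∑ t ∈ Icc 1 T, M.reward kind (X t ω) (A t ω)) ∂Pr ≤
      (C + B) * N + B / 2 * ∑ i, ∫ ω, ∑ t ∈ Icc 1 T,
        ∑ y, |M.P i (θh t ω i) (X t ω i) (A t ω i) y -
          M.P i (θs ω i) (X t ω i) (A t ω i) y| ∂Pr := by
  classical
  have hB0 : 0 ≤ B := by
    obtain ⟨ω⟩ := nonempty_of_isProbabilityMeasure Pr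
    exact (hV0 (θs ω) (X 1 ω)).trans (hVB _ _)
  let U : ℕ → Ω → ℝ := fun t ω =>
    ∑ s', M.jointP (θh t ω) (X t ω) (A t ω) s' * V (θh t ω) s'
  let U' : ℕ → Ω → ℝ := fun t ω =>
    ∑ s', M.jointP (θs ω) (X t ω) (A t ω) s' * V (θh t ω) s'
  let d : Fin n → ℕ → Ω → ℝ := fun i t ω => ∑ y, |M.P i (θh t ω i) (X t ω i) (A t ω i) y -
    M.P i (θs ω i) (X t ω i) (A t ω i) y|
  have hmean : ∀ θ θ' s a, |∑ s', M.jointP θ s a s' * V θ' s'| ≤ B := fun θ θ' s a => by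
    rw [abs_of_nonneg (sum_nonneg fun s' _ => mul_nonneg (M.jointP_nonneg _ _ _ _) (hV0 _ _))]
    calc ∑ s', M.jointP θ s a s' * V θ' s' ≤ ∑ s', M.jointP θ s a s' * B :=
          sum_le_sum fun s' _ => mul_le_mul_of_nonneg_left (hVB _ _) (M.jointP_nonneg _ _ _ _)
      _ = B := by rw [← sum_mul, M.sum_jointP, one_mul]
  have hUi : ∀ t, 1 ≤ t → Integrable (U t) Pr := fun t ht =>
    integrable_of_abs_le (h.measurable_of_state_action hμ ht (F := fun s a ω =>
      ∑ s', M.jointP (θh t ω) s a s' * V (θh t ω) s') fun s a => Finset.measurable_sum _ fun s' _ =>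
        ((M.measurable_jointP s a s').mul (hVm s')).comp (h.measurable_sample t ht))
      fun ω => hmean _ _ _ _
  have hU'i : ∀ t, 1 ≤ t → Integrable (U' t) Pr := fun t ht =>
    integrable_of_abs_le (h.measurable_of_state_action hμ ht (F := fun s a ω =>
      ∑ s', M.jointP (θs ω) s a s' * V (θh t ω) s') fun s a => Finset.measurable_sum _ fun s' _ =>
        ((M.measurable_jointP s a s').comp h.measurable_param).mul
          ((hVm s').comp (h.measurable_sample t ht))) fun ω => hmean _ _ _ _
  have hVi : ∀ t, 1 ≤ t → Integrable (fun ω => V (θh t ω) (X (t + 1) ω)) Pr := fun t ht =>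
    integrable_of_abs_le (measurable_apply_of_countable
      (fun s => h.measurable_state (t + 1) (by omega) s) (F := fun s ω => V (θh t ω) s)
      fun s => (hVm s).comp (h.measurable_sample t ht)) (B := B) fun ω => by
        rw [abs_of_nonneg (hV0 _ _)]; exact hVB _ _
  have hnext : ∀ t, 1 ≤ t → ∫ ω, V (θh t ω) (X (t + 1) ω) ∂Pr = ∫ ω, U' t ω ∂Pr := fun t ht =>
    h.integral_next_state hμ ht (F := fun s' ω => V (θh t ω) s')
      (fun s' => (hVm s').comp (measurable_sample_pastSigma θs X A θh ht (Nat.lt_succ_self t)))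
      (B := B) fun s' ω => by rw [abs_of_nonneg (hV0 _ _)]; exact hVB _ _
  have hdi : ∀ i t, 1 ≤ t → Integrable (d i t) Pr := fun i t ht =>
    h.integrable_sum_abs_P_sub hμ i ht
  have hUU' : ∀ t ω, U t ω - U' t ω ≤ B / 2 * ∑ i, d i t ω := fun t ω => by
    refine (sum_mul_sub_sum_mul_le (by rw [M.sum_jointP, M.sum_jointP]) (hV0 _) (hVB _)).trans ?_
    refine mul_le_mul_of_nonneg_left ?_ (by linarith)
    exact sum_abs_prod_sub_prod_le (p := fun i y => M.P i (θh t ω i) (X t ω i) (A t ω i) y)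
      (q := fun i y => M.P i (θs ω i) (X t ω i) (A t ω i) y) (fun i y => M.P_nonneg _ _ _ _ _)
      (fun i y => M.P_nonneg _ _ _ _ _) (fun i => M.P_sum _ _ _ _) (fun i => M.P_sum _ _ _ _)
  -- a bound for the contribution of an episode, known when the episode starts
  let Ψ : ℕ → (ℕ → ∀ i, S i) → (ℕ → Fin n → Bool) → (∀ i, Θ i) → ℝ := fun t x a θ =>
    if EpisodeStart x a t then ((schedule x a t).2 + 1 : ℝ) * (C - J θ) else 0
  have hΨdep : ∀ t, DependsOnHistory t (Ψ t) := fun t x a x' a' h1 h2 => by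
    funext θ
    have e1 : EpisodeStart x a t = EpisodeStart x' a' t :=
      dependsOnHistory_episodeStart t x a x' a' h1 h2
    have e2 : schedule x a t = schedule x' a' t := dependsOnHistory_schedule t x a x' a' h1 h2
    simp only [Ψ, e1, e2]
  have hΨm : ∀ t x a, Measurable (Ψ t x a) := fun t x a =>
    Measurable.ite (MeasurableSet.const _) (measurable_const.mul (measurable_const.sub hJm))
      measurable_const
  have hC0 : 0 ≤ C := by
    obtain ⟨ω⟩ := nonempty_of_isProbabilityMeasure Pr
    exact (hJ0 (θs ω)).trans (hJC _)
  have hΨb : ∀ t x a θ, |Ψ t x a θ| ≤ (t + 1) * C := fun t x a θ => by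
    simp only [Ψ]
    split_ifs
    · have h1 : ((schedule x a t).2 : ℝ) ≤ t := by exact_mod_cast schedule_snd_le x a t
      rw [abs_of_nonneg (mul_nonneg (by positivity) (by linarith [hJC θ]))]
      exact mul_le_mul (by linarith) (by linarith [hJ0 θ]) (by linarith [hJC θ]) (by positivity)
    · rw [abs_zero]; positivity
  have hΨhi : ∀ t, 1 ≤ t →
      Integrable (fun ω => Ψ t (fun τ => X τ ω) (fun τ => A τ ω) (θh t ω)) Pr := fun t ht =>
    integrable_of_abs_le
      (h.measurable_of_history hμ ht (hΨdep t) (hΨm t) (h.measurable_sample t ht))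
      fun ω => hΨb _ _ _ _
  have hΨsi : ∀ t, 1 ≤ t →
      Integrable (fun ω => Ψ t (fun τ => X τ ω) (fun τ => A τ ω) (θs ω)) Pr := fun t ht =>
    integrable_of_abs_le (h.measurable_of_history hμ ht (hΨdep t) (hΨm t) h.measurable_param)
      fun ω => hΨb _ _ _ _
  have hΨ : ∀ t, 1 ≤ t → ∫ ω, Ψ t (fun τ => X τ ω) (fun τ => A τ ω) (θh t ω) ∂Pr =
      ∫ ω, Ψ t (fun τ => X τ ω) (fun τ => A τ ω) (θs ω) ∂Pr := fun t ht =>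
    h.integral_sample_eq hμ ht (hΨdep t) (hΨm t) (fun x a θ hs => if_neg hs) (hΨb t)
  have hJi : Integrable (fun ω => (T : ℝ) * (C - J (θs ω))) Pr :=
    (integrable_of_abs_le (measurable_const.sub (hJm.comp h.measurable_param)) (B := C)
      fun ω => by
        change |C - J (θs ω)| ≤ C
        rw [abs_of_nonneg (sub_nonneg.2 (hJC _))]
        linarith [hJ0 (θs ω)]).const_mul _
  -- the cost of sampling: only the lengths of the episodes are not known when sampling
  have hsampling : ∑ t ∈ Icc 1 T, ∫ ω, Ψ t (fun τ => X τ ω) (fun τ => A τ ω) (θh t ω) ∂Pr -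
      ∫ ω, (T : ℝ) * (C - J (θs ω)) ∂Pr ≤ C * N := by
    rw [sum_congr rfl fun t ht => hΨ t (mem_Icc.1 ht).1,
      ← integral_finsetSum _ fun t ht => hΨsi t (mem_Icc.1 ht).1,
      ← integral_sub (integrable_finsetSum _ fun t ht => hΨsi t (mem_Icc.1 ht).1) hJi]
    refine (integral_mono ((integrable_finsetSum _ fun t ht => hΨsi t (mem_Icc.1 ht).1).sub hJi)
      (integrable_const (C * N)) fun ω => ?_).trans_eq (by simp)
    simp only [Ψ, Pi.sub_apply]
    set x := fun τ => X τ ω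
    set a := fun τ => A τ ω
    have e : ∑ t ∈ Icc 1 T, (if EpisodeStart x a t then
        ((schedule x a t).2 + 1 : ℝ) * (C - J (θs ω)) else 0) =
        ((schedule x a T).1 + numEpisodes x a T) * (C - J (θs ω)) := by
      rw [← sum_prevLength, numEpisodes, card_filter, Nat.cast_sum, ← sum_add_distrib, sum_mul]
      refine sum_congr rfl fun t _ => ?_
      split_ifs <;> simp
    have h1 : ((schedule x a T).1 : ℝ) ≤ T := by exact_mod_cast schedule_fst_le x a T
    have h2 : 0 ≤ C - J (θs ω) := by linarith [hJC (θs ω)]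
    have h3 : C - J (θs ω) ≤ C := by linarith [hJ0 (θs ω)]
    have h4 : (numEpisodes x a T : ℝ) * (C - J (θs ω)) ≤ N * C :=
      mul_le_mul (hN x a) h3 h2 ((Nat.cast_nonneg _).trans (hN x a))
    rw [e]
    nlinarith
  -- pointwise decomposition
  have hpt : ∀ ω, T * J (θs ω) - ∑ t ∈ Icc 1 T, M.reward kind (X t ω) (A t ω) ≤
      (∑ t ∈ Icc 1 T, Ψ t (fun τ => X τ ω) (fun τ => A τ ω) (θh t ω) - T * (C - J (θs ω))) + B * N +
        ∑ t ∈ Icc 1 T, (U t ω - V (θh t ω) (X (t + 1) ω)) := by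
    intro ω
    have h1 := sum_le_sum_prevLength (fun τ => X τ ω) (fun τ => A τ ω)
      (f := fun t => C - J (θh t ω)) (fun t => by linarith [hJC (θh t ω)])
      (fun t ht hs => by rw [h.sample_eq ω t ht hs]) T
    have h2 := sum_sub_le_mul_numEpisodes (fun τ => X τ ω) (fun τ => A τ ω)
      (v := fun t s => V (θh t ω) s) (fun t => X t ω) (fun t s => hV0 _ _) (fun t s => hVB _ _)
      (fun t ht hs => by rw [h.sample_eq ω t ht hs]) hT
    have h3 := mul_le_mul_of_nonneg_left (hN (fun τ => X τ ω) (fun τ => A τ ω)) hB0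
    have h4 : ∑ t ∈ Icc 1 T, M.reward kind (X t ω) (A t ω) =
        T * C - ∑ t ∈ Icc 1 T, (C - J (θh t ω)) -
        ∑ t ∈ Icc 1 T, (V (θh t ω) (X (t + 1) ω) - V (θh t ω) (X t ω)) -
        ∑ t ∈ Icc 1 T, (U t ω - V (θh t ω) (X (t + 1) ω)) := by
      have h5 : (T : ℝ) * C = ∑ t ∈ Icc 1 T, C := by simp
      rw [h5, ← sum_sub_distrib, ← sum_sub_distrib, ← sum_sub_distrib]
      refine sum_congr rfl fun t ht => ?_
      have h6 := hV (θh t ω) (X t ω)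
      rw [← h.action t (mem_Icc.1 ht).1 ω] at h6
      simp only [U]
      linarith
    rw [h4]
    simp only [Ψ]
    linarith
  have hR : Integrable (fun ω => T * J (θs ω) - ∑ t ∈ Icc 1 T, M.reward kind (X t ω) (A t ω))
      Pr := by
    refine Integrable.sub ((integrable_of_abs_le (hJm.comp h.measurable_param) (B := C)
      fun ω => ?_).const_mul _) (integrable_finsetSum _ fun t ht => ?_)
    · rw [Function.comp, abs_of_nonneg (hJ0 _)]; exact hJC _
    · refine integrable_of_abs_le (h.measurable_of_state_action hμ (mem_Icc.1 ht).1
        (F := fun s a _ => M.reward kind s a) fun s a => measurable_const)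
        (B := C + B) fun ω => ?_
      have h6 := hV (θh t ω) (X t ω)
      rw [← h.action t (mem_Icc.1 ht).1 ω] at h6
      have h7 := hJC (θh t ω)
      have h8 := hVB (θh t ω) (X t ω)
      have h9 : 0 ≤ ∑ s', M.jointP (θh t ω) (X t ω) (A t ω) s' * V (θh t ω) s' :=
        sum_nonneg fun s' _ => mul_nonneg (M.jointP_nonneg _ _ _ _) (hV0 _ _)
      rw [abs_of_nonneg (M.reward_nonneg kind _ _)]
      linarith
  refine ⟨hR, ?_⟩
  have hi1 : Integrable (fun ω => ∑ t ∈ Icc 1 T, Ψ t (fun τ => X τ ω) (fun τ => A τ ω) (θh t ω) -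
      T * (C - J (θs ω))) Pr :=
    (integrable_finsetSum _ fun t ht => hΨhi t (mem_Icc.1 ht).1).sub hJi
  have hUV : ∀ t ∈ Icc 1 T, Integrable (fun ω => U t ω - V (θh t ω) (X (t + 1) ω)) Pr :=
    fun t ht => (hUi t (mem_Icc.1 ht).1).sub (hVi t (mem_Icc.1 ht).1)
  have hUU'i : ∀ t ∈ Icc 1 T, Integrable (fun ω => U t ω - U' t ω) Pr :=
    fun t ht => (hUi t (mem_Icc.1 ht).1).sub (hU'i t (mem_Icc.1 ht).1)
  have hi2 : Integrable (fun ω => ∑ t ∈ Icc 1 T, (U t ω - V (θh t ω) (X (t + 1) ω))) Pr :=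
    integrable_finsetSum _ hUV
  have hmodel : ∫ ω, ∑ t ∈ Icc 1 T, (U t ω - V (θh t ω) (X (t + 1) ω)) ∂Pr ≤
      B / 2 * ∑ i, ∫ ω, ∑ t ∈ Icc 1 T, d i t ω ∂Pr := by
    have e1 : ∫ ω, ∑ t ∈ Icc 1 T, (U t ω - V (θh t ω) (X (t + 1) ω)) ∂Pr =
        ∫ ω, ∑ t ∈ Icc 1 T, (U t ω - U' t ω) ∂Pr := by
      rw [integral_finsetSum _ hUV, integral_finsetSum _ hUU'i]
      refine sum_congr rfl fun t ht => ?_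
      have ht := (mem_Icc.1 ht).1
      rw [integral_sub (hUi t ht) (hVi t ht), integral_sub (hUi t ht) (hU'i t ht), hnext t ht]
    have hdi' : ∀ i, Integrable (fun ω => ∑ t ∈ Icc 1 T, d i t ω) Pr := fun i =>
      integrable_finsetSum _ fun t ht => hdi i t (mem_Icc.1 ht).1
    rw [e1, ← integral_finsetSum _ fun i _ => hdi' i, ← integral_const_mul]
    refine integral_mono
      (integrable_finsetSum _ hUU'i)
      ((integrable_finsetSum _ fun i _ => hdi' i).const_mul _) fun ω => ?_
    simp only
    rw [sum_comm, mul_sum]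
    exact sum_le_sum fun t _ => hUU' t ω
  calc _ ≤ ∫ ω, ((∑ t ∈ Icc 1 T, Ψ t (fun τ => X τ ω) (fun τ => A τ ω) (θh t ω) -
        T * (C - J (θs ω))) + B * N +
        ∑ t ∈ Icc 1 T, (U t ω - V (θh t ω) (X (t + 1) ω))) ∂Pr :=
        integral_mono hR ((hi1.add (integrable_const _)).add hi2) hpt
    _ = (∑ t ∈ Icc 1 T, ∫ ω, Ψ t (fun τ => X τ ω) (fun τ => A τ ω) (θh t ω) ∂Pr -
        ∫ ω, (T : ℝ) * (C - J (θs ω)) ∂Pr) + B * N +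
        ∫ ω, ∑ t ∈ Icc 1 T, (U t ω - V (θh t ω) (X (t + 1) ω)) ∂Pr := by
        have ha : ∫ ω, ((∑ t ∈ Icc 1 T, Ψ t (fun τ => X τ ω) (fun τ => A τ ω) (θh t ω) -
            T * (C - J (θs ω))) + B * N +
            ∑ t ∈ Icc 1 T, (U t ω - V (θh t ω) (X (t + 1) ω))) ∂Pr =
            ∫ ω, ((∑ t ∈ Icc 1 T, Ψ t (fun τ => X τ ω) (fun τ => A τ ω) (θh t ω) -
            T * (C - J (θs ω))) + B * N) ∂Pr +
            ∫ ω, ∑ t ∈ Icc 1 T, (U t ω - V (θh t ω) (X (t + 1) ω)) ∂Pr :=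
          integral_add (hi1.add (integrable_const _)) hi2
        rw [ha, integral_add hi1 (integrable_const _),
          integral_sub (integrable_finsetSum _ fun t ht => hΨhi t (mem_Icc.1 ht).1) hJi,
          integral_finsetSum _ fun t ht => hΨhi t (mem_Icc.1 ht).1]
        simp
    _ ≤ C * N + B * N + B / 2 * ∑ i, ∫ ω, ∑ t ∈ Icc 1 T, d i t ω ∂Pr :=
        add_le_add (add_le_add hsampling le_rfl) hmodel
    _ = _ := by rw [add_mul]

end IsRBTSDE

/-- With the confidence level `L = 4 s log T`, where `s` is the number of states of an arm, the
contribution of the arm is of order `s √(T log T)`. -/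
theorem arm_bound_le {s T : ℕ} (hs : 1 ≤ s) (hT : 2 ≤ T) :
    10 * √(2 * (4 * s * Real.log T)) * √(s * T) + 4 * (T : ℝ) ^ 2 *
      ((s * 2 * 2 ^ s * T : ℝ) * Real.exp (-(4 * s * Real.log T))) ≤
      37 * s * √(T * Real.log T) := by
  have hT' : (2 : ℝ) ≤ T := by exact_mod_cast hT
  have hs' : (1 : ℝ) ≤ s := by exact_mod_cast hs
  have hlog2 : (0.6931471803 : ℝ) < Real.log 2 := Real.log_two_gt_d9
  have hlogT : Real.log 2 ≤ Real.log T := Real.log_le_log (by norm_num) hT'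
  have hQ : 1 ≤ √(T * Real.log T) := Real.one_le_sqrt.2 (by nlinarith)
  have e1 : √(2 * (4 * s * Real.log T)) * √(s * T) = √8 * s * √(T * Real.log T) := by
    rw [← Real.sqrt_mul (by positivity), show 2 * (4 * s * Real.log T) * (s * T) =
      8 * (s ^ 2 * (T * Real.log T)) by ring, Real.sqrt_mul (by norm_num),
      Real.sqrt_mul (by positivity), Real.sqrt_sq (by linarith)]
    ring
  have h8 : √8 ≤ 29 / 10 := Real.sqrt_le_iff.2 (by norm_num)
  have e2 : Real.exp (-(4 * s * Real.log T)) = ((T : ℝ) ^ (4 * s))⁻¹ := by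
    rw [Real.exp_neg, show 4 * (s : ℝ) * Real.log T = ((4 * s : ℕ) : ℝ) * Real.log T by push_cast; ring,
      ← Real.log_pow, Real.exp_log (by positivity)]
  -- `2 ^ s ≤ T ^ s` and `T ^ (3 + s) ≤ T ^ (4 s)`
  have h9 : 4 * (T : ℝ) ^ 2 * ((s * 2 * 2 ^ s * T : ℝ) * Real.exp (-(4 * s * Real.log T))) ≤
      8 * s := by
    rw [e2, ← mul_assoc, ← div_eq_mul_inv, div_le_iff₀ (by positivity)]
    have h1 : (2 : ℝ) ^ s ≤ (T : ℝ) ^ s := pow_le_pow_left₀ (by norm_num) hT' s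
    have h2 : (T : ℝ) ^ (3 + s) ≤ (T : ℝ) ^ (4 * s) :=
      pow_le_pow_right₀ (by linarith) (by omega)
    calc 4 * (T : ℝ) ^ 2 * ((s : ℝ) * 2 * 2 ^ s * T) = 8 * (s : ℝ) * ((T : ℝ) ^ 3 * 2 ^ s) := by ring
      _ ≤ 8 * (s : ℝ) * ((T : ℝ) ^ 3 * (T : ℝ) ^ s) := by gcongr
      _ = 8 * (s : ℝ) * (T : ℝ) ^ (3 + s) := by rw [pow_add]
      _ ≤ _ := by gcongr
  have h10 : √8 * s * √(T * Real.log T) ≤ 29 / 10 * s * √(T * Real.log T) := by gcongr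
  have h11 : 8 * (s : ℝ) ≤ 8 * s * √(T * Real.log T) := le_mul_of_one_le_right (by positivity) hQ
  calc _ = 10 * (√(2 * (4 * s * Real.log T)) * √(s * T)) + 4 * (T : ℝ) ^ 2 *
      ((s * 2 * 2 ^ s * T : ℝ) * Real.exp (-(4 * s * Real.log T))) := by ring
    _ ≤ _ := by rw [e1]; nlinarith

end RestlessBandit

theorem theorem1 {n : ℕ} {S : Fin n → Type*} [∀ i, Fintype (S i)] [∀ i, DecidableEq (S i)]
    {Θ : Fin n → Type*} [∀ i, MeasurableSpace (Θ i)]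
    (M : RestlessBandit.Bandit S Θ) (hR : 0 < M.Rmax) (kind : RestlessBandit.RewardModel)
    (m : ℕ) (hm : 1 ≤ m) (hmn : m ≤ n)
    -- `g i θ lam` is the optimal policy of arm `i` in model `θ` at penalty `lam`
    (g : ∀ i, Θ i → ℝ → S i → Bool)
    -- every arm is indexable in every model
    (h_index : ∀ i θ, RestlessBandit.IsIndexable (M.P i θ) (M.armReward kind i) (g i θ))
    -- the Whittle index policies
    (μ : (∀ i, Θ i) → (∀ i, S i) → Fin n → Bool)
    (hμ : RestlessBandit.IsWhittlePolicy m g μ)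
    -- their average reward, which does not depend on the initial state
    (J : (∀ i, Θ i) → ℝ)
    (hJ : ∀ θ s, M.policyAverageReward kind θ (μ θ) s = J θ)
    -- the average-reward Bellman equation
    (h_bellman : ∀ θ, ∃ V : (∀ i, S i) → ℝ, (∃ C, ∀ s, |V s| ≤ C) ∧
      ∀ s, J θ + V s =
        M.reward kind s (μ θ s) + (M.policyMatrix θ (μ θ)).mulVec V s)
    -- the uniform bound on the ergodicity coefficients
    (lamStar : ℝ) (h_lamStar : lamStar < 1)
    (h_ergodic : ∀ θ, RestlessBandit.ergodicityCoeff (M.policyMatrix θ (μ θ)) ≤ lamStar)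
    -- a run of RB-TSDE
    {Ω : Type*} [MeasurableSpace Ω] (Pr : Measure Ω) [IsProbabilityMeasure Pr]
    (θs : Ω → ∀ i, Θ i) (X : ℕ → Ω → ∀ i, S i) (A : ℕ → Ω → Fin n → Bool)
    (θh : ℕ → Ω → ∀ i, Θ i)
    (h_run : RestlessBandit.IsRBTSDE M μ Pr θs X A θh)
    (T : ℕ) (hT : 2 ≤ T) :
    Integrable (fun ω => T * J (θs ω) - ∑ t ∈ Icc 1 T, M.reward kind (X t ω) (A t ω)) Pr ∧
    ∫ ω, (T * J (θs ω) - ∑ t ∈ Icc 1 T, M.reward kind (X t ω) (A t ω)) ∂Pr <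
      40 * kind.alpha n m * (M.Rmax / (1 - lamStar)) * (∑ i, (Fintype.card (S i) : ℝ)) *
        Real.sqrt (T * Real.log T) := by
  have hSne : ∀ i, Nonempty (S i) := M.nonempty_state
  have hn : 1 ≤ n := hm.trans hmn
  obtain ⟨ω₀⟩ := nonempty_of_isProbabilityMeasure Pr
  have s₀ : ∀ i, S i := X 1 ω₀
  set C : ℝ := kind.alpha n m * M.Rmax with hC
  set B : ℝ := C / (1 - lamStar) with hB
  set σ : ℝ := ∑ i, (Fintype.card (S i) : ℝ) with hσ
  set Q : ℝ := √(T * Real.log T) with hQ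
  have hα : 1 ≤ kind.alpha n m := by
    cases kind with
    | A => exact (Nat.one_le_cast (α := ℝ)).2 hn
    | B => exact (Nat.one_le_cast (α := ℝ)).2 hm
  have hC0 : 0 < C := by positivity
  have h1l : 0 < 1 - lamStar := by linarith
  have hB0 : 0 < B := by positivity
  have hK : ∀ θ s, ∑ s', M.policyMatrix θ (μ θ) s s' = 1 := fun θ s => M.sum_jointP θ s (μ θ s)
  have hK0 : ∀ θ s s', 0 ≤ M.policyMatrix θ (μ θ) s s' := fun θ s s' => M.jointP_nonneg _ _ _ _
  have hl0 : 0 ≤ lamStar := (RestlessBandit.ergodicityCoeff_nonneg (hK (θs ω₀))).trans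
    (h_ergodic (θs ω₀))
  have hCB : C ≤ B := (le_div_iff₀ h1l).2 (by nlinarith)
  have hρ0 : ∀ θ s, 0 ≤ M.reward kind s (μ θ s) := fun θ s => M.reward_nonneg kind s _
  have hρC : ∀ θ s, M.reward kind s (μ θ s) ≤ C := fun θ s =>
    M.reward_le kind s (hμ.card_active θ s)
  have hKm : ∀ s s', Measurable fun θ => M.policyMatrix θ (μ θ) s s' := fun s s' =>
    RestlessBandit.measurable_apply_of_countable (Y := fun θ => μ θ s)
      (fun a => hμ.measurable s (Set.to_countable _).measurableSet)
      (F := fun a θ => M.jointP θ s a s') fun a => M.measurable_jointP s a s'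
  have hρm : ∀ s, Measurable fun θ => M.reward kind s (μ θ s) := fun s =>
    RestlessBandit.measurable_apply_of_countable (Y := fun θ => μ θ s)
      (fun a => hμ.measurable s (Set.to_countable _).measurableSet)
      (F := fun a _ => M.reward kind s a) fun a => measurable_const
  have hJm : Measurable J := by
    rw [show J = fun θ => M.policyAverageReward kind θ (μ θ) s₀ from
      funext fun θ => (hJ θ s₀).symm]
    exact RestlessBandit.measurable_averageReward hKm hρm s₀
  have hJmem : ∀ θ, 0 ≤ J θ ∧ J θ ≤ C := fun θ => by
    obtain ⟨V, -, hV⟩ := h_bellman θ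
    exact RestlessBandit.bellman_averageReward_mem (hK0 θ) (hK θ) hV (hρ0 θ) (hρC θ)
  obtain ⟨V, hVm, hV0, hVB, hV⟩ := RestlessBandit.exists_measurable_bias hKm hρm hK hρ0 hρC
    h_lamStar h_ergodic fun θ => (h_bellman θ).imp fun V hV => hV.2
  have hcard : ∀ i, 1 ≤ Fintype.card (S i) := fun i => Fintype.card_pos
  have hσ1 : 1 ≤ ∑ i, Fintype.card (S i) :=
    (hcard ⟨0, hn⟩).trans (single_le_sum (fun i _ => Nat.zero_le (Fintype.card (S i)))
      (mem_univ (⟨0, hn⟩ : Fin n)))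
  have hσ1' : 1 ≤ σ := by rw [hσ]; exact_mod_cast hσ1
  have hT' : (2 : ℝ) ≤ T := by exact_mod_cast hT
  have hlog : Real.log 2 ≤ Real.log T := Real.log_le_log (by norm_num) hT'
  have hlog2 : (0.6931471803 : ℝ) < Real.log 2 := Real.log_two_gt_d9
  have hQ0 : 0 < Q := Real.sqrt_pos.2 (by nlinarith)
  obtain ⟨hint, hle⟩ := h_run.integral_regret_le hμ.measurable kind hJm (fun θ => (hJmem θ).1)
    (fun θ => (hJmem θ).2) hVm hV0 hVB hV (by omega : 1 ≤ T)
    (fun x a => RestlessBandit.numEpisodes_le x a hT hσ1)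
  refine ⟨hint, hle.trans_lt ?_⟩
  have harms : ∑ i, ∫ ω, ∑ t ∈ Icc 1 T, ∑ y, |M.P i (θh t ω i) (X t ω i) (A t ω i) y -
      M.P i (θs ω i) (X t ω i) (A t ω i) y| ∂Pr ≤ 37 * σ * Q := by
    rw [hσ, mul_sum, sum_mul]
    refine sum_le_sum fun i _ => ?_
    have hi : (1 : ℝ) ≤ Fintype.card (S i) := by exact_mod_cast hcard i
    refine (h_run.integral_sum_abs_P_sub_le hμ.measurable i
      (L := 4 * Fintype.card (S i) * Real.log T) (by nlinarith) T).trans ?_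
    exact RestlessBandit.arm_bound_le (hcard i) hT
  have h1 : (C + B) * (42 / 5 * σ * Q) ≤ (B + B) * (42 / 5 * σ * Q) := by gcongr
  have h2 := mul_le_mul_of_nonneg_left harms (by linarith : 0 ≤ B / 2)
  have h3 : 40 * kind.alpha n m * (M.Rmax / (1 - lamStar)) * σ * Q = 40 * (B * σ * Q) := by
    rw [hB, hC]; ring
  have h4 : 0 < B * σ * Q := by positivity
  rw [h3]
  refine lt_of_le_of_lt (add_le_add h1 h2) ?_
  nlinarith
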